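/- **Assortment optimization.** An instance consists of $n$ items, item $i$ having a fixed price $p_i\ge 0$ and a buyer's value $v_i\sim F_i$, and of an outside option giving the buyer utility $u_0\sim F_0$ and the seller $0$. All $F_i$ are finitely supported distributions, given as lists of mass points with positive probabilities; all numbers are rationals in binary, and the input size is their total bit length. For $S\subseteq\{1,\dots,n\}$ draw $u_0,v_1,\dots,v_n$ independently; the buyer picks an option of maximum utility among the items $i\in S$ (utility $v_i-p_i$) and the outside option, ties being broken in favor of the seller. $\mathrm{Rev}(S)$ is the expected price of the purchased item ($0$ if none). **The algorithm with $M\geq 1$ bins.** 1. *Reduction.* Item $i$ becomes an action with two configurations, each a joint distribution of an agent utility $u_i^A$ and a principal utility $u_i^P$: "out", with $(u_i^A,u_i^P)=(-\infty,0)$, and "in", with $(u_i^A,u_i^P)=\bigl(v_i-p_i,\;p_i\Pr_{u_0\sim F_0}[u_0\le v_i-p_i]\bigr)$, $v_i\sim F_i$. 2. *Preprocessing.* List all mass points (of all actions and configurations) in non-decreasing order of principal utility, and split each one, of probability $p$, into $\lfloor pM^2\rfloor$ masses of probability $1/M^2$ and a remainder. Add $\delta\ell$ to the agent utility of the $\ell$-th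 resulting mass ($\ell=0,1,\dots$), where $\delta>0$ is rational of polynomial bit length and so small that the strict order of distinct agent utilities is preserved. 3. *Main loop.* For every profile $\hat u_1\le\dots\le\hat u_M$ of agent utilities from the union of all supports, let $\hat u_0=-\infty$, $B_j=[\hat u_{j-1},\hat u_j)$ for $j<M$, $B_M=[\hat u_{M-1},\hat u_M]$, $B_{\le j}=\bigcup_{k\le j}B_k$. For a choice $\mathbf C=(C_1,\dots,C_n)$ of configurations put $q_{ij}=\Pr[u_i^A\in B_j\mid u_i^A\in B_{\le j}]$ ($0$ if $\Pr[u_i^A\in B_{\le j}]=0$) and $\bar q_{ij}=\lfloor q_{ij}M^2n\rfloor/(M^2n)$. By dynamic programming over the actions and the vectors $\mathbf k\in\{0,\dots,M^2n^2\}^M$ (with one memo table $\mathrm{OPT}(i,\mathbf k)$), find $\mathbf C$ maximizing $$\sum_{i=1}^n\sum_{j=6}^M \frac{j-5}{M-1}\,\mathbb E[u_i^P\mid u_i^A\in B_j]\;q_{ij} \quad\text{subject to}\quad \frac{1-1/M}{j}-\frac1{M^2}\;\le\;\sum_{i=1}^n\bar q_{ij}\;\le\;\frac{1+1/M}{j-1}\qquad(1\le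 j\le M),$$ with no upper bound for $j=1$. 4. *Output.* Among the configurations found for all profiles, take one with the largest true expected principal utility (all actions "out" if none was found), and stock the set $\mathrm{ALG}_M$ of the items that are "in". **Statement.** There is an absolute constant $K$ such that for every $M\ge 1$ and every instance, $$\mathrm{Rev}(\mathrm{ALG}_M)\;\ge\;\Bigl(1-\frac{K}{\sqrt M}\Bigr)\max_{S\subseteq\{1,\dots,n\}}\mathrm{Rev}(S),$$ and for every fixed $M\ge 1$ there is a polynomial $P_M$ such that on every instance of size $s$ the algorithm with $M$ bins takes at most $P_M(s)$ steps, where an operation on rational numbers (arithmetic, comparison) is charged the square of the bit length of the operands, an operation on natural numbers (counters) is charged polynomially in their bit length, and a visit to a list cell is charged one step. -/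

import Mathlib

namespace AssortmentOpt

/-! ## The assortment optimization problem -/

/-- A fixed-price item: its price and the distribution of the buyer's value for it, as a list of
mass points `(value, probability)`. -/
structure Item where
  price : ℚ
  dist : List (ℚ × ℚ)

/-- An instance: the items, and the distribution of the buyer's utility `u₀` for the outside
(no-purchase) option, as a list of mass points `(utility, probability)`. -/
structure Inst where
  items : List Item
  outside : List (ℚ × ℚ)

/-- The list of mass points is a probability distribution with probabilities in `(0, 1]`. -/
def IsDist (l : List (ℚ × ℚ)) : Prop :=
  (∀ x ∈ l, 0 < x.2) ∧ (l.map Prod.snd).sum = 1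

/-- Prices are nonnegative and all distributions are probability distributions. -/
def Inst.Valid (I : Inst) : Prop :=
  (∀ it ∈ I.items, 0 ≤ it.price ∧ IsDist it.dist) ∧ IsDist I.outside

/-- The set of items of `S` that the buyer is willing to purchase when the item utilities are
`u i` and the outside option has utility `u₀`: the utility is maximal among all available options,
the outside option included. -/
def favorites {n : ℕ} (S : Finset (Fin n)) (u₀ : ℚ) (u : Fin n → ℚ) : Finset (Fin n) :=
  S.filter fun i => u₀ ≤ u i ∧ ∀ j ∈ S, u j ≤ u i

/-- The revenue at a given realization, ties of the buyer being broken in favor of the seller;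
it is `0` if the buyer takes the outside option. (Prices are nonnegative.) -/
def payoff {n : ℕ} (price : Fin n → ℚ) (S : Finset (Fin n)) (u₀ : ℚ) (u : Fin n → ℚ) : ℚ :=
  (favorites S u₀ u).fold max 0 price

/-- The expected revenue of the assortment `S`: the values of the items and the utility of the
outside option are drawn independently (`ω i` is the mass point drawn for item `i`, and `o` the one
drawn for the outside option), and the buyer's utility for item `i` is its value minus its price. -/
def Inst.revenue (I : Inst) (S : Finset (Fin I.items.length)) : ℚ :=
  ∑ o : Fin I.outside.length,
    ∑ ω : (i : Fin I.items.length) → Fin (I.items[i]).dist.length,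
      I.outside[o].2 * (∏ i, ((I.items[i]).dist[ω i]).2) *
        payoff (fun i => (I.items[i]).price) S I.outside[o].1
          (fun i => ((I.items[i]).dist[ω i]).1 - (I.items[i]).price)

/-! ## Bit lengths -/

/-- Bit length of a rational number (binary numerator and denominator, and a sign). -/
def ratSize (x : ℚ) : ℕ := x.num.natAbs.size + x.den.size + 1

def distSize (l : List (ℚ × ℚ)) : ℕ := (l.map fun x => ratSize x.1 + ratSize x.2 + 1).sum + 1

/-- The length of the binary encoding of an instance. -/
def Inst.size (I : Inst) : ℕ :=
  (I.items.map fun it => ratSize it.price + distSize it.dist + 1).sum + distSize I.outside + 1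

/-! ## Step counting

A computation returns its value with the number of steps used. An arithmetic operation or a
comparison of rational numbers costs the square of the total bit length of the operands (schoolbook
multiplication, division and gcd); an addition or comparison of natural numbers costs the total bit
length; a visit to a list cell costs one step. All parts of the algorithm below are built from these
priced operations; expressions in the fixed parameter `M` alone are constants of the algorithm. -/

structure Timed (α : Type) where
  val : α
  steps : ℕ

instance : Monad Timed where
  pure a := ⟨a, 0⟩
  bind x f := ⟨(f x.val).val, x.steps + (f x.val).steps⟩

def tick : Timed Unit := ⟨(), 1⟩

def addT (x y : ℚ) : Timed ℚ := ⟨x + y, (ratSize x + ratSize y) ^ 2⟩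
def subT (x y : ℚ) : Timed ℚ := ⟨x - y, (ratSize x + ratSize y) ^ 2⟩
def mulT (x y : ℚ) : Timed ℚ := ⟨x * y, (ratSize x + ratSize y) ^ 2⟩
def divT (x y : ℚ) : Timed ℚ := ⟨x / y, (ratSize x + ratSize y) ^ 2⟩
def leT (x y : ℚ) : Timed Bool := ⟨decide (x ≤ y), (ratSize x + ratSize y) ^ 2⟩
def ltT (x y : ℚ) : Timed Bool := ⟨decide (x < y), (ratSize x + ratSize y) ^ 2⟩
/-- Integer part of a nonnegative rational number. -/
def floorT (x : ℚ) : Timed ℕ := ⟨⌊x⌋₊, (ratSize x) ^ 2⟩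
def castT (n : ℕ) : Timed ℚ := ⟨n, n.size + 1⟩

def natAddT (a b : ℕ) : Timed ℕ := ⟨a + b, a.size + b.size + 1⟩
def natMulT (a b : ℕ) : Timed ℕ := ⟨a * b, (a.size + b.size + 1) ^ 2⟩
def natEqT (a b : ℕ) : Timed Bool := ⟨decide (a = b), a.size + b.size + 1⟩

/-- Agent utilities are rational or `-∞ = ⊥`. -/
def utilSize : WithBot ℚ → ℕ
  | ⊥ => 1
  | (x : ℚ) => ratSize x

def utilLtT (x y : WithBot ℚ) : Timed Bool := ⟨decide (x < y), (utilSize x + utilSize y) ^ 2⟩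
/-- `x + e`, with `-∞ + e = -∞`. -/
def utilAddT (x : WithBot ℚ) (e : ℚ) : Timed (WithBot ℚ) :=
  ⟨x + (e : WithBot ℚ), (utilSize x + ratSize e) ^ 2⟩

def notT (b : Timed Bool) : Timed Bool := do return !(← b)

/-- `if b then c else false`. -/
def andT (b c : Timed Bool) : Timed Bool := do if ← b then c else return false

section Lists

variable {α β : Type}

def mapT (f : α → Timed β) : List α → Timed (List β)
  | [] => do tick; return []
  | a :: l => do
    tick
    let b ← f a
    let r ← mapT f l
    return b :: r

def foldT (f : β → α → Timed β) : β → List α → Timed β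
  | b, [] => do tick; return b
  | b, a :: l => do
    tick
    let b' ← f b a
    foldT f b' l

def filterT (f : α → Timed Bool) : List α → Timed (List α)
  | [] => do tick; return []
  | a :: l => do
    tick
    let b ← f a
    let r ← filterT f l
    if b then return a :: r else return r

def appendT : List α → List α → Timed (List α)
  | [], r => do tick; return r
  | a :: l, r => do
    tick
    let s ← appendT l r
    return a :: s

def flatMapT (f : α → Timed (List β)) : List α → Timed (List β)
  | [] => do tick; return []
  | a :: l => do
    tick
    let s ← f a
    let r ← flatMapT f l
    appendT s r

def lengthT : List α → Timed ℕ
  | [] => do tick; return 0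
  | _ :: l => do
    tick
    let k ← lengthT l
    natAddT k 1

/-- `[(i, a₀), (i + 1, a₁), …]`. -/
def enumT : ℕ → List α → Timed (List (ℕ × α))
  | _, [] => do tick; return []
  | i, a :: l => do
    tick
    let i' ← natAddT i 1
    let r ← enumT i' l
    return (i, a) :: r

/-- The entry at position `i`, if there is one. -/
def getT : List α → ℕ → Timed (Option α)
  | [], _ => do tick; return none
  | a :: _, 0 => do tick; return some a
  | _ :: l, i + 1 => do tick; getT l i

/-- `[k, k - 1, …, 0]`. -/
def downToT : ℕ → Timed (List ℕ)
  | 0 => do tick; return [0]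
  | k + 1 => do
    tick
    let r ← downToT k
    let j ← natAddT k 1
    return j :: r

/-- All lists of length `d` with entries from `xs`. -/
def tuplesT (xs : List α) : ℕ → Timed (List (List α))
  | 0 => do tick; return [[]]
  | d + 1 => do
    tick
    let r ← tuplesT xs d
    flatMapT (fun x => mapT (fun v => do tick; return x :: v) r) xs

/-- The list `[a, …, a]`, of the length of the given list. -/
def constT (a : β) (l : List α) : Timed (List β) := mapT (fun _ => do return a) l

def sumT (f : α → Timed ℚ) (l : List α) : Timed ℚ :=
  foldT (fun s a => do let x ← f a; addT s x) 0 l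

def prodT (f : α → Timed ℚ) (l : List α) : Timed ℚ :=
  foldT (fun s a => do let x ← f a; mulT s x) 1 l

end Lists

/-- Entrywise sum. -/
def vecAddT : List ℕ → List ℕ → Timed (List ℕ)
  | a :: v, b :: w => do
    tick
    let c ← natAddT a b
    let r ← vecAddT v w
    return c :: r
  | _, _ => do tick; return []

def vecEqT : List ℕ → List ℕ → Timed Bool
  | [], [] => do tick; return true
  | a :: v, b :: w => do tick; andT (natEqT a b) (vecEqT v w)
  | _, _ => do tick; return false

/-! ## Utility configuration and preprocessing -/

/-- A mass point of a joint distribution of the utilities for an action: agent utility, principal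
utility, probability. -/
structure Mass where
  uA : WithBot ℚ
  uP : ℚ
  pr : ℚ

/-- A configuration of an action: the induced joint distribution of the utilities. -/
abbrev Config := List Mass

/-- A utility configuration instance: for every action the list of its configurations. -/
abbrev UC := List (List Config)

/-- A mass point together with the indices of its action and its configuration. -/
structure Tagged where
  act : ℕ
  cfg : ℕ
  mass : Mass

def allMassesT (F : UC) : Timed (List Tagged) := do
  let A ← enumT 0 F
  flatMapT (fun a => do
    let C ← enumT 0 a.2
    flatMapT (fun c => mapT (fun t => do return ⟨a.1, c.1, t⟩) c.2) C) A

/-- Insertion into a list that is sorted by principal utility. -/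
def insertT (t : Tagged) : List Tagged → Timed (List Tagged)
  | [] => do tick; return [t]
  | s :: l => do
    tick
    if ← leT t.mass.uP s.mass.uP then
      return t :: s :: l
    else
      let r ← insertT t l
      return s :: r

/-- Sorting in non-decreasing order of principal utility. -/
def sortT : List Tagged → Timed (List Tagged)
  | [] => do tick; return []
  | t :: l => do
    tick
    let r ← sortT l
    insertT t r

/-- The minimum of `1` and of all positive differences of (finite) agent utilities. -/
def gapT (L : List Tagged) : Timed ℚ :=
  foldT (fun g s => foldT (fun g t =>
    match s.mass.uA, t.mass.uA with
    | (x : ℚ), (y : ℚ) => do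
      if ← ltT x y then
        let d ← subT y x
        if ← ltT d g then return d else return g
      else return g
    | _, _ => do return g) g L) 1 L

/-- The perturbation `δ`: it is so small that adding `δ ℓ`, where `ℓ` is at most the number of
point masses after the splitting, preserves the strict order of distinct agent utilities. -/
def deltaT (M : ℕ) (L : List Tagged) : Timed ℚ := do
  let g ← gapT L
  let len ← lengthT L
  let k ← natMulT len (M ^ 2 + 1)
  let k' ← natAddT k 1
  let d ← castT k'
  divT g d

/-- The agent utility `u + δ ℓ`. -/
def perturbT (δ : ℚ) (u : WithBot ℚ) (ℓ : ℕ) : Timed (WithBot ℚ) := do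
  let x ← castT ℓ
  let e ← mulT δ x
  utilAddT u e

/-- `k` point masses of probability `1 / M ^ 2` and one of probability `rem`, the agent utilities
being perturbed by `δ ℓ, δ (ℓ + 1), …`. Returns the next `ℓ` as well. -/
def piecesT (M : ℕ) (δ : ℚ) (t : Tagged) (rem : ℚ) : ℕ → ℕ → Timed (List Tagged × ℕ)
  | 0, ℓ => do
    tick
    let u ← perturbT δ t.mass.uA ℓ
    let ℓ' ← natAddT ℓ 1
    return ([⟨t.act, t.cfg, ⟨u, t.mass.uP, rem⟩⟩], ℓ')
  | k + 1, ℓ => do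
    tick
    let u ← perturbT δ t.mass.uA ℓ
    let ℓ' ← natAddT ℓ 1
    let r ← piecesT M δ t rem k ℓ'
    return (⟨t.act, t.cfg, ⟨u, t.mass.uP, 1 / (M : ℚ) ^ 2⟩⟩ :: r.1, r.2)

/-- Splits all point masses of the list into `⌊p M ^ 2⌋` masses of probability `1 / M ^ 2` and a
remainder. -/
def splitT (M : ℕ) (δ : ℚ) : ℕ → List Tagged → Timed (List Tagged)
  | _, [] => do tick; return []
  | ℓ, t :: l => do
    tick
    let x ← mulT t.mass.pr ((M : ℚ) ^ 2)
    let k ← floorT x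
    let kq ← castT k
    let whole ← mulT kq (1 / (M : ℚ) ^ 2)
    let rem ← subT t.mass.pr whole
    let s ← piecesT M δ t rem k ℓ
    let r ← splitT M δ s.2 l
    appendT s.1 r

/-- Distributes the point masses of `L` to the configurations of the instance again. -/
def regroupT (F : UC) (L : List Tagged) : Timed UC := do
  let A ← enumT 0 F
  mapT (fun a => do
    let C ← enumT 0 a.2
    mapT (fun c => do
      let l ← filterT (fun t => andT (natEqT t.act a.1) (natEqT t.cfg c.1)) L
      mapT (fun t => do return t.mass) l) C) A

def preprocessT (M : ℕ) (F : UC) : Timed UC := do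
  let L ← allMassesT F
  let L' ← sortT L
  let δ ← deltaT M L'
  let S ← splitT M δ 0 L'
  regroupT F S

/-! ## Bins and additive estimates -/

/-- The bin `B_j = [lo, hi)`, or `[lo, hi]` for the last one, with its index `j`. -/
structure Bin where
  idx : ℕ
  lo : WithBot ℚ
  hi : WithBot ℚ
  last : Bool

/-- The bins with boundaries `û_{j-1} = lo` and `û_j, …, û_M` (the list). -/
def binsT : ℕ → WithBot ℚ → List (WithBot ℚ) → Timed (List Bin)
  | _, _, [] => do tick; return []
  | j, lo, [h] => do tick; return [⟨j, lo, h, true⟩]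
  | j, lo, h :: h' :: l => do
    tick
    let j' ← natAddT j 1
    let r ← binsT j' h (h' :: l)
    return ⟨j, lo, h, false⟩ :: r

/-- `x ∈ B_{≤ j}`. -/
def inCumT (b : Bin) (x : WithBot ℚ) : Timed Bool :=
  if b.last then notT (utilLtT b.hi x) else utilLtT x b.hi

/-- `x ∈ B_j`. -/
def inBinT (b : Bin) (x : WithBot ℚ) : Timed Bool :=
  andT (inCumT b x) (notT (utilLtT x b.lo))

/-- `Pr[u_i^A ∈ B_{≤ j}]`. -/
def probCumT (b : Bin) (c : Config) : Timed ℚ :=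
  sumT (fun t => do if ← inCumT b t.uA then return t.pr else return 0) c

/-- `Pr[u_i^A ∈ B_j]`. -/
def probBinT (b : Bin) (c : Config) : Timed ℚ :=
  sumT (fun t => do if ← inBinT b t.uA then return t.pr else return 0) c

/-- `E[u_i^P ; u_i^A ∈ B_j]`. -/
def utilBinT (b : Bin) (c : Config) : Timed ℚ :=
  sumT (fun t => do if ← inBinT b t.uA then mulT t.pr t.uP else return 0) c

/-- The number of units `1 / D`, where `D = M ^ 2 n`, in `Pr[u_i^A ∈ B_j | u_i^A ∈ B_{≤ j}]`, rounded down
(`0` if the condition has probability `0`). -/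
def unitsT (D : ℚ) (c : Config) (b : Bin) : Timed ℕ := do
  let x ← probBinT b c
  let y ← probCumT b c
  let q ← divT x y
  let z ← mulT q D
  floorT z

/-- `c_j E[u_i^P | u_i^A ∈ B_j] Pr[u_i^A ∈ B_j | u_i^A ∈ B_{≤ j}]` where `c_j = (j - 5) / (M - 1)`,
for `j ≥ 6`; the contribution is `0` for `j ≤ 5`. -/
def weightedUtilT (M : ℕ) (c : Config) (b : Bin) : Timed ℚ := do
  let j ← castT b.idx
  if ← leT 6 j then
    let x ← utilBinT b c
    let y ← probCumT b c
    let v ← divT x y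
    let w ← subT j 5
    let w' ← divT w ((M : ℚ) - 1)
    mulT w' v
  else return 0

/-- The contribution `ψ_i` of a configuration to the approximate objective, and its contributions
to the rounded probability estimates of the bins. -/
def profileT (M : ℕ) (D : ℚ) (B : List Bin) (c : Config) : Timed (ℚ × List ℕ) := do
  let ψ ← sumT (weightedUtilT M c) B
  let k ← mapT (unitsT D c) B
  return (ψ, k)

/-! ## The dynamic program -/

/-- The constraint
`(1 - 1/M) / j - 1/M ^ 2 ≤ k / D ≤ (1 + 1/M) / (j - 1)`, where `D = M ^ 2 n`
(no upper bound for `j = 1`). -/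
def binFeasibleT (M : ℕ) (D : ℚ) (b : Bin) (k : ℕ) : Timed Bool := do
  let j ← castT b.idx
  let kq ← castT k
  let q ← divT kq D
  let lo ← divT (1 - 1 / (M : ℚ)) j
  let lo' ← subT lo (1 / (M : ℚ) ^ 2)
  if ← leT lo' q then
    if ← natEqT b.idx 1 then return true
    else
      let j' ← subT j 1
      let hi ← divT (1 + 1 / (M : ℚ)) j'
      leT q hi
  else return false

def feasibleT (M : ℕ) (D : ℚ) : List Bin → List ℕ → Timed Bool
  | b :: B, k :: v => do tick; andT (binFeasibleT M D b k) (feasibleT M D B v)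
  | _, _ => do tick; return true

/-- The best value of a subproblem with a list of configuration indices attaining it;
`none` is the value `-∞`. -/
abbrev Entry := Option (ℚ × List ℕ)

abbrev Table := List (List ℕ × Entry)

/-- Lookup by a scan of the table. -/
def lookupT (k : List ℕ) : Table → Timed Entry
  | [] => do tick; return none
  | e :: T => do
    tick
    if ← vecEqT k e.1 then return e.2 else lookupT k T

def baseTableT (M : ℕ) (D : ℚ) (B : List Bin) (box : List (List ℕ)) : Timed Table :=
  mapT (fun k => do
    if ← feasibleT M D B k then return (k, some (0, [])) else return (k, none)) box

/-- `OPT(i, k) = max_ℓ (ψ_i(ℓ) + OPT(i + 1, k + k^{i,ℓ}))`, where `opts` lists the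
`(ℓ, ψ_i(ℓ), k^{i,ℓ})` and `T` is the table of `OPT(i + 1, ·)`. -/
def entryT (opts : List (ℕ × (ℚ × List ℕ))) (T : Table) (k : List ℕ) : Timed Entry :=
  foldT (fun best o => do
    let k' ← vecAddT k o.2.2
    let e ← lookupT k' T
    match e with
    | none => return best
    | some (v, C) =>
      let w ← addT o.2.1 v
      match best with
      | none => return some (w, o.1 :: C)
      | some (w', C') =>
        if ← ltT w' w then return some (w, o.1 :: C) else return some (w', C')) none opts

/-- The table of `OPT(i, ·)` over all `k` in `box`, for the list of the actions `i, …, n`. -/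
def tableT (M : ℕ) (D : ℚ) (B : List Bin) (box : List (List ℕ)) : UC → Timed Table
  | [] => do tick; baseTableT M D B box
  | A :: F => do
    tick
    let T ← tableT M D B box F
    let P ← mapT (profileT M D B) A
    let opts ← enumT 0 P
    mapT (fun k => do let e ← entryT opts T k; return (k, e)) box

/-- The optimal solution `OPT(1, 0)` of the program for the given bins. Every entry of `k` ranges
over `0, …, M ^ 2 n · n`, as `n` actions contribute at most `M ^ 2 n` units each. -/
def solveT (M n : ℕ) (B : List Bin) (F : UC) : Timed Entry := do
  let m ← natMulT (M ^ 2) n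
  let D ← castT m
  let N ← natMulT m n
  let r ← downToT N
  let box ← tuplesT r M
  let T ← tableT M D B box F
  let zero ← constT 0 B
  lookupT zero T

/-! ## Evaluation of a configuration, and the main loop -/

/-- The distributions that are chosen by a list of configuration indices. -/
def selectT : UC → List ℕ → Timed (List Config)
  | A :: F, ℓ :: C => do
    tick
    let c ← getT A ℓ
    let r ← selectT F C
    return c.getD [] :: r
  | _, _ => do tick; return []

/-- `Pr[u_i^A < u]`. -/
def probLtT (u : WithBot ℚ) (c : Config) : Timed ℚ :=
  sumT (fun t => do if ← utilLtT t.uA u then return t.pr else return 0) c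

/-- The sum, over the actions of the second list and their point masses, of principal utility times
the probability that this point mass is drawn and all other actions (of both lists) yield a lower
agent utility. For the first list empty this is the expected principal utility, since after
preprocessing the finite agent utilities are distinct, and `-∞` goes with principal utility `0`. -/
def evalT : List Config → List Config → Timed ℚ
  | _, [] => do tick; return 0
  | pre, c :: post => do
    tick
    let x ← sumT (fun t => do
      let p ← prodT (probLtT t.uA) pre
      let q ← prodT (probLtT t.uA) post
      let pq ← mulT p q
      let w ← mulT t.pr t.uP
      mulT w pq) c
    let r ← evalT (c :: pre) post
    addT x r

/-- `û_1 ≤ û_2 ≤ …`. -/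
def sortedT : List (WithBot ℚ) → Timed Bool
  | x :: y :: l => do tick; andT (notT (utilLtT y x)) (sortedT (y :: l))
  | _ => do tick; return true

/-- The algorithm for utility configuration with `M` bins: after preprocessing it runs the dynamic
program for every profile of bin boundaries from the union of the supports, and returns the best
configuration found (by its true expected principal utility), as a list of configuration indices. -/
def configureT (M : ℕ) (F₀ : UC) : Timed (List ℕ) := do
  let F ← preprocessT M F₀
  let n ← lengthT F
  let L ← allMassesT F
  let cand ← mapT (fun t => do return t.mass.uA) L
  let all ← tuplesT cand M
  let prof ← filterT sortedT all
  let best : Entry ← foldT (fun best û => do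
    let B ← binsT 1 ⊥ û
    let e ← solveT M n B F
    match e with
    | none => return best
    | some (_, C) =>
      let sel ← selectT F C
      let w ← evalT [] sel
      match best with
      | none => return some (w, C)
      | some (w', C') =>
        if ← ltT w' w then return some (w, C) else return some (w', C')) none prof
  match best with
  | none => constT 0 F
  | some (_, C) => return C

/-! ## Assortment optimization through utility configuration -/

/-- `Pr[u₀ ≤ u]`. -/
def outsideProbT (outside : List (ℚ × ℚ)) (u : ℚ) : Timed ℚ :=
  sumT (fun x => do if ← leT x.1 u then return x.2 else return 0) outside

/-- The configuration "in" of an item: `u^A = v - p` and `u^P = p · Pr[u₀ ≤ v - p]`. -/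
def inConfigT (outside : List (ℚ × ℚ)) (it : Item) : Timed Config :=
  mapT (fun x => do
    let u ← subT x.1 it.price
    let g ← outsideProbT outside u
    let w ← mulT it.price g
    return ⟨(u : WithBot ℚ), w, x.2⟩) it.dist

/-- Every item becomes an action with the configurations `0` ("out": `u^A = -∞`, `u^P = 0`) and
`1` ("in"). -/
def reduceT (I : Inst) : Timed UC :=
  mapT (fun it => do
    let c ← inConfigT I.outside it
    return [[⟨⊥, 0, 1⟩], c]) I.items

/-- The algorithm with `M` bins for assortment optimization. The output says for every item whether
it is stocked (`1`) or not (`0`). -/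
def ptas (M : ℕ) (I : Inst) : Timed (List ℕ) := do
  let F ← reduceT I
  configureT M F

/-- The assortment that an output of the algorithm describes. -/
def Inst.stocked (I : Inst) (C : List ℕ) : Finset (Fin I.items.length) :=
  Finset.univ.filter fun i => C[(i : ℕ)]? = some 1

end AssortmentOpt

/-! Three facts carry the approximation guarantee.

First, the reduction and the preprocessing are exact. The perturbation keeps the strict order of
distinct utilities and, among equal ones, lets the larger principal utility win, which is
tie-breaking in favor of the seller. So the revenue of an assortment equals `utility` of the
corresponding configurations (`revenue_eq`, `IsRefinement.utility_choose`). Afterwards finite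
utilities are distinct across mass points, and every mass of an "in" configuration is at most 1/M²
(`exists_isRefinement`).

Second, the constraints control the distribution of the maximal agent utility. Let P_j be the
probability that all utilities lie below boundary j. For an optimal assortment S, boundaries with
j/M ≤ P_j ≤ j/M + 1/M² exist because the atoms are small (`IsModel.exists_isEven`). The ratios
P_{j+1}/P_j, together with the product inequalities of Weierstrass, bound the sums of the
conditional bin probabilities, so S is feasible for this profile (`IsEven.le_sum_condPr`,
`IsEven.sum_condPr_le`). Conversely, the upper constraints alone force P_j ≥ (j - 4)/(M - 1) for j ≥
5, so the objective of any feasible solution is at most its true utility (`IsChoice.allPr_ge`,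
`IsChoice.objective_le_utility`).

Third, the objective loses little on S. The loss consists of the first bin and of 6/M times the sum
of the bin utilities. Both are compared with `halfUtil`, the utility of an item when each other item
is present with probability 1/2. The comparison rests on c ≤ ((1 + c)/2)², on the correlation
inequality for monotone functions and on summation by parts (`IsEven.first_bin`,
`IsEven.sum_binUtil_le`). The sum of the `halfUtil` is twice the mean utility of a uniformly random
subset of S, hence at most twice the optimum (`IsModel.sum_halfUtil_le`). The loss is therefore at
most 32/√M times the optimum. Since the dynamic program is exact and the output maximizes the true
utility over all solutions found, K = 32 works.

For the running time, `PolyF` and `PolyT` express polynomial bounds on sizes and on steps and are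
closed under sequencing, branching and list operations. Recursions of unbounded depth need their own
invariants, because iterating a polynomial bound n times does not give a polynomial: sums and
products, the tables of the dynamic program, the evaluation, and the splitting of masses, where
probabilities at most 1 limit the number of pieces. -/

namespace AssortmentOpt

/-! ### Values of timed computations, with the step counts stripped off -/

section TimedSemantics

variable {α β : Type}

@[simp] theorem val_pure (a : α) : (pure a : Timed α).val = a := rfl
@[simp] theorem val_bind (x : Timed α) (f : α → Timed β) : (x >>= f).val = (f x.val).val := rfl
@[simp] theorem steps_pure (a : α) : (pure a : Timed α).steps = 0 := rfl
@[simp] theorem steps_bind (x : Timed α) (f : α → Timed β) :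
    (x >>= f).steps = x.steps + (f x.val).steps := rfl
@[simp] theorem steps_tick : tick.steps = 1 := rfl
@[simp] theorem val_ite (p : Prop) [Decidable p] (x y : Timed α) :
    (if p then x else y).val = if p then x.val else y.val := by split <;> rfl

@[simp] theorem addT_val (x y : ℚ) : (addT x y).val = x + y := rfl
@[simp] theorem subT_val (x y : ℚ) : (subT x y).val = x - y := rfl
@[simp] theorem mulT_val (x y : ℚ) : (mulT x y).val = x * y := rfl
@[simp] theorem divT_val (x y : ℚ) : (divT x y).val = x / y := rfl
@[simp] theorem leT_val (x y : ℚ) : (leT x y).val = decide (x ≤ y) := rfl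
@[simp] theorem ltT_val (x y : ℚ) : (ltT x y).val = decide (x < y) := rfl
@[simp] theorem floorT_val (x : ℚ) : (floorT x).val = ⌊x⌋₊ := rfl
@[simp] theorem castT_val (n : ℕ) : (castT n).val = n := rfl
@[simp] theorem natAddT_val (a b : ℕ) : (natAddT a b).val = a + b := rfl
@[simp] theorem natMulT_val (a b : ℕ) : (natMulT a b).val = a * b := rfl
@[simp] theorem natEqT_val (a b : ℕ) : (natEqT a b).val = decide (a = b) := rfl
@[simp] theorem utilLtT_val (x y : WithBot ℚ) : (utilLtT x y).val = decide (x < y) := rfl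
@[simp] theorem utilAddT_val (x : WithBot ℚ) (e : ℚ) :
    (utilAddT x e).val = x + (e : WithBot ℚ) := rfl
@[simp] theorem notT_val (b : Timed Bool) : (notT b).val = !b.val := rfl
@[simp] theorem andT_val (b c : Timed Bool) : (andT b c).val = (b.val && c.val) := by
  cases h : b.val <;> simp [andT, h]

@[simp] theorem mapT_val (f : α → Timed β) (l : List α) :
    (mapT f l).val = l.map fun a => (f a).val := by
  induction l with
  | nil => rfl
  | cons a l ih => simp [mapT, ih]

@[simp] theorem foldT_val (f : β → α → Timed β) (b : β) (l : List α) :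
    (foldT f b l).val = l.foldl (fun b a => (f b a).val) b := by
  induction l generalizing b with
  | nil => rfl
  | cons a l ih => simp [foldT, ih]

@[simp] theorem filterT_val (f : α → Timed Bool) (l : List α) :
    (filterT f l).val = l.filter fun a => (f a).val := by
  induction l with
  | nil => rfl
  | cons a l ih => cases h : (f a).val <;> simp [filterT, ih, h]

@[simp] theorem appendT_val (l r : List α) : (appendT l r).val = l ++ r := by
  induction l with
  | nil => rfl
  | cons a l ih => simp [appendT, ih]

@[simp] theorem flatMapT_val (f : α → Timed (List β)) (l : List α) :
    (flatMapT f l).val = l.flatMap fun a => (f a).val := by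
  induction l with
  | nil => rfl
  | cons a l ih => simp [flatMapT, ih]

@[simp] theorem lengthT_val (l : List α) : (lengthT l).val = l.length := by
  induction l with
  | nil => rfl
  | cons a l ih => simp [lengthT, ih]

@[simp] theorem enumT_val (i : ℕ) (l : List α) :
    (enumT i l).val = (l.zipIdx i).map Prod.swap := by
  induction l generalizing i with
  | nil => rfl
  | cons a l ih => simp [enumT, ih]

@[simp] theorem getT_val (l : List α) (i : ℕ) : (getT l i).val = l[i]? := by
  induction l generalizing i with
  | nil => rfl
  | cons a l ih => cases i <;> simp [getT, ih]

theorem mem_downToT {k x : ℕ} : x ∈ (downToT k).val ↔ x ≤ k := by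
  induction k with
  | zero => simp [downToT]
  | succ k ih => simp [downToT, ih]; omega

theorem mem_tuplesT {xs : List α} {d : ℕ} {v : List α} :
    v ∈ (tuplesT xs d).val ↔ v.length = d ∧ ∀ x ∈ v, x ∈ xs := by
  induction d generalizing v with
  | zero =>
    simp only [tuplesT, val_bind, val_pure, List.mem_singleton, List.length_eq_zero_iff]
    constructor
    · rintro rfl; simp
    · exact fun h => h.1
  | succ d ih =>
    simp only [tuplesT, val_bind, flatMapT_val, mapT_val, val_pure, List.mem_flatMap, List.mem_map]
    constructor
    · rintro ⟨x, hx, w, hw, rfl⟩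
      obtain ⟨h1, h2⟩ := ih.1 hw
      simpa [h1, hx] using h2
    · rintro ⟨h1, h2⟩
      cases v with
      | nil => simp at h1
      | cons x w => exact ⟨x, h2 x (by simp), w, ih.2 ⟨by simpa using h1, fun y hy => h2 y (by simp [hy])⟩, rfl⟩

@[simp] theorem constT_val (a : β) (l : List α) : (constT a l).val = l.map fun _ => a := by
  simp [constT]

@[simp] theorem sumT_val (f : α → Timed ℚ) (l : List α) :
    (sumT f l).val = (l.map fun a => (f a).val).sum := by
  have : ∀ s : ℚ, l.foldl (fun b a => b + (f a).val) s = s + (l.map fun a => (f a).val).sum := by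
    induction l with
    | nil => simp
    | cons a l ih => intro s; simp [ih, add_assoc]
  simp [sumT, this]

@[simp] theorem prodT_val (f : α → Timed ℚ) (l : List α) :
    (prodT f l).val = (l.map fun a => (f a).val).prod := by
  have : ∀ s : ℚ, l.foldl (fun b a => b * (f a).val) s = s * (l.map fun a => (f a).val).prod := by
    induction l with
    | nil => simp
    | cons a l ih => intro s; simp [ih, mul_assoc]
  simp [prodT, this]

end TimedSemantics

@[simp] theorem vecAddT_val (v w : List ℕ) : (vecAddT v w).val = List.zipWith (· + ·) v w := by
  induction v generalizing w with
  | nil => cases w <;> rfl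
  | cons a v ih => cases w <;> simp [vecAddT, ih]

@[simp] theorem vecEqT_val (v w : List ℕ) : (vecEqT v w).val = decide (v = w) := by
  induction v generalizing w with
  | nil => cases w <;> rfl
  | cons a v ih =>
    cases w with
    | nil => rfl
    | cons b w => by_cases h : a = b <;> simp [vecEqT, ih, h]

/-! ### Bins -/

/-- Reading the boundaries off a sequence `v` makes a bin a function of its number, so that sums
over bins become sums over a range of indices. From here on the index i belongs to bin number i + 1.
-/
theorem binsT_val (v : ℕ → WithBot ℚ) (j len : ℕ) :
    (binsT (j + 1) (v j) ((List.range' (j + 1) len).map v)).val =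
      (List.range' j len).map fun i => ⟨i + 1, v i, v (i + 1), decide (i + 1 = j + len)⟩ := by
  induction len generalizing j with
  | zero => rfl
  | succ len ih =>
    cases len with
    | zero => simp [binsT]
    | succ len =>
      have h := ih (j + 1)
      simp only [List.range'_succ, List.map_cons] at h ⊢
      simp only [binsT, val_bind, val_pure, natAddT_val]
      rw [h]
      simp [add_comm, add_left_comm]

/-- The sum of `f` over the mass points, weighted by their probabilities. -/
def ex (c : Config) (f : Mass → ℚ) : ℚ := (c.map fun t => t.pr * f t).sum

theorem sumT_ite_eq_ex (c : Config) (p : Mass → Timed Bool) (q : Mass → Prop) [DecidablePred q]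
    (h : ∀ t, (p t).val = decide (q t)) :
    (sumT (fun t => do if ← p t then return t.pr else return 0) c).val =
      ex c fun t => if q t then 1 else 0 := by
  simp only [sumT_val, ex]
  congr 2
  funext t
  by_cases hq : q t <;> simp [h, hq]

/-! ### Correctness of the dynamic program -/

/-- `C` is a choice of configurations of the actions `F` with objective value `v` which, starting
from the units `k`, stays inside `box` and ends in a feasible vector. -/
def IsPath (M : ℕ) (D : ℚ) (B : List Bin) (box : List (List ℕ)) :
    UC → List ℕ → List ℕ → ℚ → Prop
  | [], k, C, v => k ∈ box ∧ (feasibleT M D B k).val = true ∧ C = [] ∧ v = 0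
  | A :: F, k, C, v => k ∈ box ∧ ∃ ℓ c C' v', A[ℓ]? = some c ∧ C = ℓ :: C' ∧
      v = (profileT M D B c).val.1 + v' ∧
      IsPath M D B box F (List.zipWith (· + ·) k (profileT M D B c).val.2) C' v'

/-- The entry is an optimum of the set of solutions `P` (`none` if there is no solution). -/
def IsOpt (P : List ℕ → ℚ → Prop) : Entry → Prop
  | none => ∀ C v, ¬ P C v
  | some (v, C) => P C v ∧ ∀ C' v', P C' v' → v' ≤ v

theorem lookupT_map (k : List ℕ) (box : List (List ℕ)) (f : List ℕ → Entry) :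
    (lookupT k (box.map fun k => (k, f k))).val = if k ∈ box then f k else none := by
  induction box with
  | nil => rfl
  | cons b box ih =>
    by_cases h : k = b
    · subst h; simp [lookupT]
    · simp [lookupT, h, ih]

theorem isOpt_congr {P Q : List ℕ → ℚ → Prop} (h : ∀ C v, P C v ↔ Q C v) (e : Entry) :
    IsOpt P e ↔ IsOpt Q e := by
  cases e <;> simp [IsOpt, h]

/-- One step of the maximization in `entryT`. -/
theorem entryT_isOpt (opts : List (ℕ × (ℚ × List ℕ))) (T : Table) (k : List ℕ)
    (Q : List ℕ → List ℕ → ℚ → Prop)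
    (hT : ∀ k', IsOpt (Q k') (lookupT k' T).val) :
    IsOpt (fun C v => ∃ o ∈ opts, ∃ C' v', C = o.1 :: C' ∧ v = o.2.1 + v' ∧
      Q (List.zipWith (· + ·) k o.2.2) C' v') (entryT opts T k).val := by
  unfold entryT
  rw [foldT_val]
  set step := fun (b : Entry) (a : ℕ × (ℚ × List ℕ)) => _
  -- Loop invariant of the fold: the current entry is optimal among the options `opts₀` processed so
  -- far.
  suffices h : ∀ (opts₀ : List (ℕ × (ℚ × List ℕ))) (b : Entry),
      IsOpt (fun C v => ∃ o ∈ opts₀, ∃ C' v', C = o.1 :: C' ∧ v = o.2.1 + v' ∧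
        Q (List.zipWith (· + ·) k o.2.2) C' v') b →
      IsOpt (fun C v => ∃ o ∈ opts₀ ++ opts, ∃ C' v', C = o.1 :: C' ∧ v = o.2.1 + v' ∧
        Q (List.zipWith (· + ·) k o.2.2) C' v') (opts.foldl step b) by
    have := h [] none (by simp [IsOpt])
    simpa using this
  induction opts with
  | nil => intro opts₀ b h; simpa using h
  | cons o opts ih =>
    intro opts₀ b hb
    have h2 : IsOpt (fun C v => ∃ o' ∈ opts₀ ++ [o], ∃ C' v', C = o'.1 :: C' ∧ v = o'.2.1 + v' ∧
        Q (List.zipWith (· + ·) k o'.2.2) C' v') (step b o) := by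
      have hq := hT (List.zipWith (· + ·) k o.2.2)
      simp only [step, val_bind, vecAddT_val]
      rcases he : (lookupT (List.zipWith (· + ·) k o.2.2) T).val with _ | ⟨v, C⟩
      · rw [he] at hq
        simp only [val_pure]
        refine (isOpt_congr (fun C v => ?_) b).1 hb
        constructor
        · rintro ⟨o', ho', h⟩; exact ⟨o', by simp [ho'], h⟩
        · rintro ⟨o', ho', C', v', h1, h2, h3⟩
          rcases List.mem_append.1 ho' with ho' | ho'
          · exact ⟨o', ho', C', v', h1, h2, h3⟩
          · simp only [List.mem_singleton] at ho'; subst ho'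
            exact absurd h3 (hq _ _)
      · rw [he] at hq
        rcases b with _ | ⟨w', C''⟩
        · simp only [val_bind, addT_val, val_pure]
          refine ⟨⟨o, by simp, C, v, rfl, rfl, hq.1⟩, ?_⟩
          rintro C₁ v₁ ⟨o', ho', C', v', h1, h2, h3⟩
          rcases List.mem_append.1 ho' with ho' | ho'
          · exact absurd ⟨o', ho', C', v', h1, h2, h3⟩ (hb _ _)
          · simp only [List.mem_singleton] at ho'; subst ho'
            rw [h2]; have := hq.2 _ _ h3; linarith
        · simp only [val_bind, addT_val, ltT_val]
          have hb1 := hb.1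
          have hb2 := hb.2
          by_cases hlt : w' < o.2.1 + v
          · simp only [hlt, decide_true, if_true]
            refine ⟨⟨o, by simp, C, v, rfl, rfl, hq.1⟩, ?_⟩
            rintro C₁ v₁ ⟨o', ho', C', v', h1, h2, h3⟩
            rcases List.mem_append.1 ho' with ho' | ho'
            · exact (hb2 _ _ ⟨o', ho', C', v', h1, h2, h3⟩).trans hlt.le
            · simp only [List.mem_singleton] at ho'; subst ho'
              rw [h2]; have := hq.2 _ _ h3; linarith
          · simp only [hlt, decide_false, Bool.false_eq_true, if_false]
            obtain ⟨o', ho', h⟩ := hb1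
            refine ⟨⟨o', by simp [ho'], h⟩, ?_⟩
            rintro C₁ v₁ ⟨o', ho', C', v', h1, h2, h3⟩
            rcases List.mem_append.1 ho' with ho' | ho'
            · exact hb2 _ _ ⟨o', ho', C', v', h1, h2, h3⟩
            · simp only [List.mem_singleton] at ho'; subst ho'
              rw [h2]; have := hq.2 _ _ h3; linarith
    have := ih (opts₀ ++ [o]) (step b o) h2
    simpa using this

/-- Bellman's principle. The vector k is arbitrary: outside of `box` the lookup fails, and `IsPath`
has no solution there either, so both sides of the recursion agree without a case distinction at the
boundary of the box. -/
theorem tableT_isOpt (M : ℕ) (D : ℚ) (B : List Bin) (box : List (List ℕ)) (F : UC) (k : List ℕ) :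
    IsOpt (IsPath M D B box F k) (lookupT k (tableT M D B box F).val).val := by
  induction F generalizing k with
  | nil =>
    have : (tableT M D B box []).val =
        box.map fun k => (k, if (feasibleT M D B k).val then some (0, []) else none) := by
      simp only [tableT, baseTableT, val_bind, mapT_val]
      refine List.map_congr_left fun k _ => ?_
      split <;> simp
    rw [this, lookupT_map]
    by_cases hk : k ∈ box
    · by_cases hf : (feasibleT M D B k).val = true
      · simp [hk, hf, IsOpt, IsPath]
      · simp [hk, hf, IsOpt, IsPath]
    · simp [hk, IsOpt, IsPath]
  | cons A F ih =>
    simp only [tableT, val_bind, mapT_val, val_pure, enumT_val]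
    rw [lookupT_map]
    by_cases hk : k ∈ box
    · rw [if_pos hk]
      have h := entryT_isOpt (((A.map fun c => (profileT M D B c).val).zipIdx).map Prod.swap)
        (tableT M D B box F).val k _ ih
      refine (isOpt_congr (fun C v => ?_) _).1 h
      simp only [IsPath, hk, true_and]
      constructor
      · rintro ⟨o, ho, C', v', h1, h2, h3⟩
        obtain ⟨⟨p, ℓ⟩, hx, rfl⟩ := List.mem_map.1 ho
        have hx' := List.mem_zipIdx_iff_getElem?.1 hx
        simp only [List.getElem?_map, Option.map_eq_some_iff] at hx'
        obtain ⟨c, hc, hp⟩ := hx'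
        subst hp
        exact ⟨ℓ, c, C', v', hc, h1, h2, h3⟩
      · rintro ⟨ℓ, c, C', v', hc, h1, h2, h3⟩
        refine ⟨(ℓ, (profileT M D B c).val), List.mem_map.2 ⟨((profileT M D B c).val, ℓ), ?_, rfl⟩,
          C', v', h1, h2, h3⟩
        rw [List.mem_zipIdx_iff_getElem?]
        simp [hc]
    · rw [if_neg hk]
      intro C v h
      exact hk h.1

theorem solveT_isOpt (M n : ℕ) (B : List Bin) (F : UC) :
    ∃ box : List (List ℕ), (∀ k, k ∈ box ↔ k.length = M ∧ ∀ x ∈ k, x ≤ M ^ 2 * n * n) ∧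
      IsOpt (IsPath M ((M ^ 2 * n : ℕ) : ℚ) B box F (B.map fun _ => 0)) (solveT M n B F).val := by
  refine ⟨(tuplesT (downToT (M ^ 2 * n * n)).val M).val, fun k => ?_, ?_⟩
  · rw [mem_tuplesT]; simp only [mem_downToT]
  · have := tableT_isOpt M ((M ^ 2 * n : ℕ) : ℚ) B
      (tuplesT (downToT (M ^ 2 * n * n)).val M).val F (B.map fun _ => 0)
    simpa [solveT] using this

theorem feasibleT_map (M : ℕ) (D : ℚ) (B : List Bin) (f : Bin → ℕ) :
    (feasibleT M D B (B.map f)).val = true ↔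
      ∀ b ∈ B, (binFeasibleT M D b (f b)).val = true := by
  induction B with
  | nil => simp [feasibleT]
  | cons b B ih => simp [feasibleT, ih]

theorem profileT_units (M : ℕ) (D : ℚ) (B : List Bin) (c : Config) :
    (profileT M D B c).val.2 = B.map fun b => (unitsT D c b).val := by
  simp [profileT]

theorem profileT_psi (M : ℕ) (D : ℚ) (B : List Bin) (c : Config) :
    (profileT M D B c).val.1 = (B.map fun b => (weightedUtilT M c b).val).sum := by
  simp [profileT]

theorem zipWith_map_add {α : Type} (B : List α) (f g : α → ℕ) :
    List.zipWith (· + ·) (B.map f) (B.map g) = B.map fun b => f b + g b := by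
  induction B with
  | nil => rfl
  | cons b B ih => simp [ih]

@[simp] theorem selectT_cons (A : List Config) (F : UC) (ℓ : ℕ) (C : List ℕ) :
    (selectT (A :: F) (ℓ :: C)).val = (A[ℓ]?).getD [] :: (selectT F C).val := by
  simp [selectT]

@[simp] theorem selectT_nil (C : List ℕ) : (selectT [] C).val = [] := by
  cases C <;> simp [selectT]

/-- Unrolls the recursion: the value becomes a sum over the actions, and the final vector becomes
the start vector plus the total units. State vectors are kept in the form `B.map f`, so that vector
addition is addition of functions on bins. -/
theorem IsPath.sound {M : ℕ} {D : ℚ} {B : List Bin} {box : List (List ℕ)} {F : UC} {f : Bin → ℕ}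
    {C : List ℕ} {v : ℚ} (h : IsPath M D B box F (B.map f) C v) :
    List.Forall₂ (fun A ℓ => ℓ < A.length) F C ∧
      v = ((selectT F C).val.map fun c => (profileT M D B c).val.1).sum ∧
      ∀ b ∈ B, (binFeasibleT M D b
        (f b + ((selectT F C).val.map fun c => (unitsT D c b).val).sum)).val = true := by
  induction F generalizing f C v with
  | nil =>
    obtain ⟨-, h2, rfl, rfl⟩ := h
    rw [feasibleT_map] at h2
    simpa using h2
  | cons A F ih =>
    obtain ⟨-, ℓ, c, C', v', hc, rfl, rfl, h⟩ := h
    rw [profileT_units, zipWith_map_add] at h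
    obtain ⟨h1, h2, h3⟩ := ih h
    refine ⟨List.Forall₂.cons (List.getElem?_eq_some_iff.1 hc).1 h1, ?_, ?_⟩
    · simp [hc, h2]
    · intro b hb
      have := h3 b hb
      simpa [hc, add_assoc] using this

/-- The box loses nothing: every action adds at most m units to a bin, so a start vector with room
for m units per remaining action never leaves the box. -/
theorem isPath_of_feasible {M : ℕ} {D : ℚ} {B : List Bin} {box : List (List ℕ)} {F : UC}
    {f : Bin → ℕ} {C : List ℕ} (m N : ℕ)
    (hbox : ∀ k, k ∈ box ↔ k.length = M ∧ ∀ x ∈ k, x ≤ N) (hB : B.length = M)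
    (hC : List.Forall₂ (fun A ℓ => ℓ < A.length) F C)
    (hunits : ∀ c ∈ (selectT F C).val, ∀ b ∈ B, (unitsT D c b).val ≤ m)
    (hf : ∀ b ∈ B, f b + m * F.length ≤ N)
    (hfeas : ∀ b ∈ B, (binFeasibleT M D b
        (f b + ((selectT F C).val.map fun c => (unitsT D c b).val).sum)).val = true) :
    IsPath M D B box F (B.map f) C
      ((selectT F C).val.map fun c => (profileT M D B c).val.1).sum := by
  have hmem : B.map f ∈ box := by
    rw [hbox]
    refine ⟨by simpa using hB, fun x hx => ?_⟩
    obtain ⟨b, hb, rfl⟩ := List.mem_map.1 hx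
    have := hf b hb
    omega
  induction hC generalizing f with
  | nil =>
    refine ⟨hmem, ?_, rfl, by simp⟩
    rw [feasibleT_map]
    simpa using hfeas
  | @cons A ℓ F C hA hC ih =>
    refine ⟨hmem, ℓ, A[ℓ], C, _, List.getElem?_eq_getElem hA, rfl, by simp [hA]; rfl, ?_⟩
    rw [profileT_units, zipWith_map_add]
    have hu : ∀ b ∈ B, (unitsT D A[ℓ] b).val ≤ m := fun b hb =>
      hunits A[ℓ] (by simp [hA]) b hb
    have hf' : ∀ b ∈ B, f b + (unitsT D A[ℓ] b).val + m * F.length ≤ N := by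
      intro b hb
      have h1 := hf b hb
      have h2 := hu b hb
      simp only [List.length_cons, mul_add, mul_one] at h1
      omega
    refine ih (fun c hc => hunits c (by simp [hc])) hf' ?_ ?_
    · intro b hb
      have := hfeas b hb
      simpa [hA, add_assoc] using this
    · rw [hbox]
      refine ⟨by simpa using hB, fun x hx => ?_⟩
      obtain ⟨b, hb, rfl⟩ := List.mem_map.1 hx
      have := hf' b hb
      omega

/-! ### Preprocessing -/

section Sorting

theorem insertT_val (t : Tagged) (l : List Tagged) :
    (insertT t l).val = l.orderedInsert (fun a b => a.mass.uP ≤ b.mass.uP) t := by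
  induction l with
  | nil => rfl
  | cons s l ih =>
    by_cases h : t.mass.uP ≤ s.mass.uP <;> simp [insertT, h, ih, List.orderedInsert]

theorem sortT_val (l : List Tagged) :
    (sortT l).val = l.insertionSort (fun a b => a.mass.uP ≤ b.mass.uP) := by
  induction l with
  | nil => rfl
  | cons t l ih => simp [sortT, insertT_val, ih]

theorem sortT_perm (l : List Tagged) : (sortT l).val.Perm l := by
  rw [sortT_val]; exact List.perm_insertionSort _ _

theorem sortT_pairwise (l : List Tagged) :
    (sortT l).val.Pairwise (fun a b => a.mass.uP ≤ b.mass.uP) := by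
  rw [sortT_val]
  have : Std.Total (fun a b : Tagged => a.mass.uP ≤ b.mass.uP) := ⟨fun a b => le_total _ _⟩
  have : IsTrans Tagged (fun a b : Tagged => a.mass.uP ≤ b.mass.uP) :=
    ⟨fun a b c h1 h2 => le_trans h1 h2⟩
  exact List.pairwise_insertionSort _ _

end Sorting

/-! ### The minimal gap of the agent utilities and the perturbation -/

section Gap

variable {α : Type}

theorem foldl_le_init (f : ℚ → α → ℚ) (hf : ∀ b a, f b a ≤ b) (b : ℚ) (l : List α) :
    l.foldl f b ≤ b := by
  induction l generalizing b with
  | nil => exact le_rfl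
  | cons a l ih => exact (ih _).trans (hf b a)

theorem foldl_le_of_mem (f : ℚ → α → ℚ) (hf : ∀ b a, f b a ≤ b) {a : α} {q : ℚ}
    (hq : ∀ b, f b a ≤ q) (b : ℚ) {l : List α} (ha : a ∈ l) : l.foldl f b ≤ q := by
  induction l generalizing b with
  | nil => simp at ha
  | cons x l ih =>
    rcases List.mem_cons.1 ha with rfl | ha
    · exact (foldl_le_init f hf (f b a) l).trans (hq b)
    · exact ih _ ha

theorem foldl_pos (f : ℚ → α → ℚ) (hf : ∀ b a, 0 < b → 0 < f b a) (b : ℚ) (hb : 0 < b)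
    (l : List α) : 0 < l.foldl f b := by
  induction l generalizing b with
  | nil => exact hb
  | cons a l ih => exact ih _ (hf b a hb)

/-- The step of `gapT`. -/
def gapStep (g : ℚ) (s t : Tagged) : ℚ :=
  match s.mass.uA, t.mass.uA with
  | (x : ℚ), (y : ℚ) => if x < y ∧ y - x < g then y - x else g
  | _, _ => g

theorem gapT_val (L : List Tagged) :
    (gapT L).val = L.foldl (fun g s => L.foldl (fun g t => gapStep g s t) g) 1 := by
  unfold gapT
  simp only [foldT_val]
  congr 1
  funext g s
  congr 1
  funext g t
  unfold gapStep
  rcases s.mass.uA with _ | x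
  · rfl
  · rcases t.mass.uA with _ | y
    · rfl
    · by_cases h1 : x < y
      · by_cases h2 : y - x < g <;> simp [h1, h2]
      · simp [h1]

theorem gapStep_le (g : ℚ) (s t : Tagged) : gapStep g s t ≤ g := by
  unfold gapStep
  split
  · split
    · rename_i h; exact h.2.le
    · exact le_rfl
  · exact le_rfl

theorem gapT_pos (L : List Tagged) : 0 < (gapT L).val := by
  rw [gapT_val]
  refine foldl_pos _ (fun b a hb => foldl_pos _ (fun g t hg => ?_) _ hb _) _ one_pos _
  unfold gapStep
  split
  · split
    · rename_i h; linarith [h.1]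
    · exact hg
  · exact hg

/-- The state of the nested fold never increases, and it is at most y - x once the pair (s, t) has
been visited. -/
theorem gapT_le {L : List Tagged} {s t : Tagged} (hs : s ∈ L) (ht : t ∈ L) {x y : ℚ}
    (hx : s.mass.uA = x) (hy : t.mass.uA = y) (hxy : x < y) : (gapT L).val ≤ y - x := by
  rw [gapT_val]
  refine foldl_le_of_mem (a := s) _ (fun b a => foldl_le_init _ (fun g t => gapStep_le g _ t) _ _)
    (fun b => foldl_le_of_mem (a := t) _ (fun g t => gapStep_le g _ t) (fun g => ?_) _ ht) _ hs
  unfold gapStep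
  rw [hx, hy]
  simp only [hxy, true_and]
  split
  · exact le_rfl
  · linarith

theorem deltaT_val (M : ℕ) (L : List Tagged) :
    (deltaT M L).val = (gapT L).val / ((L.length * (M ^ 2 + 1) + 1 : ℕ) : ℚ) := by
  simp [deltaT]

theorem deltaT_pos (M : ℕ) (L : List Tagged) : 0 < (deltaT M L).val := by
  rw [deltaT_val]
  have := gapT_pos L
  positivity

end Gap

/-! ### Splitting into small masses and the numbering of the pieces -/

section Splitting

/-- The number of masses `1 / M ^ 2` split off. -/
def wholes (M : ℕ) (t : Tagged) : ℕ := ⌊t.mass.pr * (M : ℚ) ^ 2⌋₊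

/-- The pieces of a mass point. -/
def pieces (M : ℕ) (δ : ℚ) (t : Tagged) (ℓ : ℕ) : List Tagged :=
  (List.range (wholes M t + 1)).map fun r =>
    ⟨t.act, t.cfg, ⟨t.mass.uA + ((δ * ((ℓ + r : ℕ) : ℚ) : ℚ) : WithBot ℚ), t.mass.uP,
      if r < wholes M t then 1 / (M : ℚ) ^ 2 else
        t.mass.pr - (wholes M t : ℚ) * (1 / (M : ℚ) ^ 2)⟩⟩

/-- The mass points of the list with the numbers of their first pieces. -/
def starts (M : ℕ) : ℕ → List Tagged → List (Tagged × ℕ)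
  | _, [] => []
  | ℓ, t :: l => (t, ℓ) :: starts M (ℓ + wholes M t + 1) l

theorem piecesT_val (M : ℕ) (δ : ℚ) (t : Tagged) (rem : ℚ) (k ℓ : ℕ) :
    (piecesT M δ t rem k ℓ).val = ((List.range (k + 1)).map fun r =>
      ⟨t.act, t.cfg, ⟨t.mass.uA + ((δ * ((ℓ + r : ℕ) : ℚ) : ℚ) : WithBot ℚ), t.mass.uP,
        if r < k then 1 / (M : ℚ) ^ 2 else rem⟩⟩, ℓ + k + 1) := by
  induction k generalizing ℓ with
  | zero => simp [piecesT, perturbT]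
  | succ k ih =>
    rw [List.range_succ_eq_map]
    simp only [piecesT, val_bind, natAddT_val, ih, val_pure, List.map_cons, List.map_map, perturbT,
      castT_val, mulT_val, utilAddT_val, Prod.mk.injEq, List.cons.injEq]
    refine ⟨⟨by simp, ?_⟩, by omega⟩
    refine List.map_congr_left fun r _ => ?_
    simp only [Function.comp, Nat.succ_eq_add_one, Nat.add_lt_add_iff_right, add_assoc, add_comm 1 r]

theorem splitT_val (M : ℕ) (δ : ℚ) (ℓ : ℕ) (L : List Tagged) :
    (splitT M δ ℓ L).val = (starts M ℓ L).flatMap fun e => pieces M δ e.1 e.2 := by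
  induction L generalizing ℓ with
  | nil => rfl
  | cons t L ih =>
    simp only [splitT, val_bind, mulT_val, floorT_val, castT_val, subT_val, piecesT_val,
      appendT_val, ih, starts, List.flatMap_cons]
    rfl

@[simp] theorem starts_map_fst (M ℓ : ℕ) (L : List Tagged) : (starts M ℓ L).map Prod.fst = L := by
  induction L generalizing ℓ with
  | nil => rfl
  | cons t L ih => simp [starts, ih]

theorem le_of_mem_starts {M ℓ : ℕ} {L : List Tagged} {e : Tagged × ℕ} (he : e ∈ starts M ℓ L) :
    ℓ ≤ e.2 := by
  induction L generalizing ℓ with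
  | nil => simp [starts] at he
  | cons t L ih =>
    rcases List.mem_cons.1 he with rfl | he
    · exact le_rfl
    · have := ih he; omega

theorem starts_pairwise (M ℓ : ℕ) (L : List Tagged) (hL : L.Pairwise fun a b => a.mass.uP ≤ b.mass.uP) :
    (starts M ℓ L).Pairwise fun e e' =>
      e.1.mass.uP ≤ e'.1.mass.uP ∧ e.2 + wholes M e.1 < e'.2 := by
  induction L generalizing ℓ with
  | nil => exact List.Pairwise.nil
  | cons t L ih =>
    rw [List.pairwise_cons] at hL
    refine List.Pairwise.cons (fun e he => ⟨?_, ?_⟩) (ih _ hL.2)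
    · refine hL.1 _ ?_
      rw [← starts_map_fst M (ℓ + wholes M t + 1) L]
      exact List.mem_map_of_mem he
    · have := le_of_mem_starts he
      simp only; omega

theorem wholes_le {M : ℕ} {t : Tagged} (h : t.mass.pr ≤ 1) : wholes M t ≤ M ^ 2 := by
  refine Nat.floor_le_of_le ?_
  push_cast
  nlinarith [sq_nonneg (M : ℚ)]

theorem lt_of_mem_starts {M ℓ : ℕ} {L : List Tagged} (hL : ∀ t ∈ L, t.mass.pr ≤ 1)
    {e : Tagged × ℕ} (he : e ∈ starts M ℓ L) :
    e.2 + wholes M e.1 < ℓ + L.length * (M ^ 2 + 1) := by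
  induction L generalizing ℓ with
  | nil => simp [starts] at he
  | cons t L ih =>
    have ht := wholes_le (M := M) (hL t (by simp))
    simp only [List.length_cons, add_mul, one_mul]
    rcases List.mem_cons.1 he with rfl | he
    · simp only; omega
    · have := ih (fun t ht => hL t (by simp [ht])) he; omega

/-- The pieces of a mass point carry the consecutive numbers from its start to its start plus
`wholes`. These intervals are disjoint and follow the sorted order, so larger numbers never belong
to smaller principal utility. This is how the perturbation implements ties in favor of the seller.
-/
theorem starts_trichotomy {M ℓ : ℕ} {L : List Tagged}
    (hL : L.Pairwise fun a b => a.mass.uP ≤ b.mass.uP) {e e' : Tagged × ℕ}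
    (he : e ∈ starts M ℓ L) (he' : e' ∈ starts M ℓ L) (hne : e ≠ e') :
    (e.1.mass.uP ≤ e'.1.mass.uP ∧ e.2 + wholes M e.1 < e'.2) ∨
      (e'.1.mass.uP ≤ e.1.mass.uP ∧ e'.2 + wholes M e'.1 < e.2) := by
  let R : Tagged × ℕ → Tagged × ℕ → Prop := fun e e' =>
    (e.1.mass.uP ≤ e'.1.mass.uP ∧ e.2 + wholes M e.1 < e'.2) ∨
      (e'.1.mass.uP ≤ e.1.mass.uP ∧ e'.2 + wholes M e'.1 < e.2)
  have : Std.Symm R := ⟨fun _ _ h => h.symm⟩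
  have hp : (starts M ℓ L).Pairwise R := (starts_pairwise M ℓ L hL).imp fun h => Or.inl h
  exact hp.forall he he' hne

/-- Two shifts differ by at most δN, which is less than any gap between distinct utilities; hence
perturbed utilities are ordered lexicographically by utility and number. -/
theorem perturb_lt_iff {x y δ : ℚ} {a b N : ℕ} (ha : a ≤ N) (hb : b ≤ N) (hδ : 0 < δ)
    (h1 : x < y → δ * ((N + 1 : ℕ) : ℚ) ≤ y - x) (h2 : y < x → δ * ((N + 1 : ℕ) : ℚ) ≤ x - y) :
    x + δ * a < y + δ * b ↔ x < y ∨ (x = y ∧ a < b) := by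
  have ha' : (a : ℚ) ≤ N := by exact_mod_cast ha
  have hb' : (b : ℚ) ≤ N := by exact_mod_cast hb
  have ha0 : (0 : ℚ) ≤ a := by positivity
  have hb0 : (0 : ℚ) ≤ b := by positivity
  push_cast at h1 h2
  rcases lt_trichotomy x y with h | h | h
  · have := h1 h
    simp only [h, true_or, iff_true]
    nlinarith
  · subst h
    simp [hδ]
  · have := h2 h
    simp only [h.not_gt, h.ne', false_and, or_self, iff_false, not_lt]
    nlinarith

end Splitting

/-! ### Regrouping -/

section Regroup

/-- The masses of the list with the given tags. -/
def group (L : List Tagged) (i c : ℕ) : List Tagged :=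
  L.filter fun t => decide (t.act = i) && decide (t.cfg = c)

theorem regroupT_val (F : UC) (L : List Tagged) :
    (regroupT F L).val = F.zipIdx.map fun a => a.1.zipIdx.map fun c =>
      (group L a.2 c.2).map Tagged.mass := by
  simp [regroupT, group]

theorem allMassesT_val (F : UC) :
    (allMassesT F).val = F.zipIdx.flatMap fun a => a.1.zipIdx.flatMap fun c =>
      c.1.map fun t => ⟨a.2, c.2, t⟩ := by
  simp [allMassesT, List.flatMap_map]

/-- Each block carries its own position as tag, so filtering by a tag recovers exactly one block. It
is used once for actions and once for configurations. -/
theorem filter_flatMap_zipIdx {α β : Type} (f : α × ℕ → List β) (tag : β → ℕ)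
    (h : ∀ a, ∀ x ∈ f a, tag x = a.2) (s : ℕ) (l : List α) (i : ℕ) :
    ((l.zipIdx s).flatMap f).filter (fun x => decide (tag x = s + i)) =
      (l[i]?.map fun a => f (a, s + i)).getD [] := by
  induction l generalizing s i with
  | nil => simp
  | cons a l ih =>
    rw [List.zipIdx_cons, List.flatMap_cons, List.filter_append]
    cases i with
    | zero =>
      have h1 : (f (a, s)).filter (fun x => decide (tag x = s + 0)) = f (a, s) :=
        List.filter_eq_self.2 fun x hx => by simpa using h _ x hx
      have h2 : ((l.zipIdx (s + 1)).flatMap f).filter (fun x => decide (tag x = s + 0)) = [] := by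
        rw [List.filter_eq_nil_iff]
        intro x hx
        obtain ⟨b, hb, hx⟩ := List.mem_flatMap.1 hx
        have := List.le_snd_of_mem_zipIdx hb
        have := h _ x hx
        simp; omega
      rw [h1, h2]; simp
    | succ i =>
      have h1 : (f (a, s)).filter (fun x => decide (tag x = s + (i + 1))) = [] := by
        rw [List.filter_eq_nil_iff]
        intro x hx
        have := h _ x hx
        simp only at this
        simp; omega
      rw [h1, List.nil_append]
      have := ih (s + 1) i
      rw [show s + 1 + i = s + (i + 1) by ring] at this
      rw [this]; simp

theorem group_allMassesT (F : UC) (i c : ℕ) (A : List Config) (q : Config) (hA : F[i]? = some A)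
    (hq : A[c]? = some q) :
    group (allMassesT F).val i c = q.map fun t => ⟨i, c, t⟩ := by
  have e : group (allMassesT F).val i c =
      (((allMassesT F).val.filter fun t => decide (t.act = 0 + i)).filter
        fun t => decide (t.cfg = 0 + c)) := by
    rw [List.filter_filter]
    unfold group
    congr 1
    funext t
    simp [Bool.and_comm]
  rw [e, allMassesT_val, filter_flatMap_zipIdx _ Tagged.act]
  · rw [hA]
    simp only [Option.map_some, Option.getD_some]
    rw [filter_flatMap_zipIdx _ Tagged.cfg]
    · simp [hq]
    · intro a x hx
      obtain ⟨t, -, rfl⟩ := List.mem_map.1 hx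
      rfl
  · intro a x hx
    obtain ⟨b, -, hx⟩ := List.mem_flatMap.1 hx
    obtain ⟨t, -, rfl⟩ := List.mem_map.1 hx
    rfl

theorem group_flatMap_pieces (M : ℕ) (δ : ℚ) (E : List (Tagged × ℕ)) (i c : ℕ) :
    group (E.flatMap fun e => pieces M δ e.1 e.2) i c =
      (E.filter fun e => decide (e.1.act = i) && decide (e.1.cfg = c)).flatMap
        fun e => pieces M δ e.1 e.2 := by
  induction E with
  | nil => rfl
  | cons e E ih =>
    unfold group at ih ⊢
    rw [List.flatMap_cons, List.filter_append, ih, List.filter_cons]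
    by_cases h : (decide (e.1.act = i) && decide (e.1.cfg = c)) = true
    · rw [if_pos h, List.flatMap_cons]
      congr 1
      refine List.filter_eq_self.2 fun x hx => ?_
      obtain ⟨r, -, rfl⟩ := List.mem_map.1 hx
      exact h
    · rw [if_neg h]
      rw [List.filter_eq_nil_iff.2, List.nil_append]
      intro x hx
      obtain ⟨r, -, rfl⟩ := List.mem_map.1 hx
      exact h

/-- Lifts a permutation of images to one of the preimages. With f the first projection, it puts the
sorted mass points back into the order of the value distribution while they keep their start
numbers, even if several mass points coincide. -/
theorem exists_perm_map_eq {α β : Type} {f : α → β} {l : List α} {l' : List β}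
    (h : (l.map f).Perm l') : ∃ l₂ : List α, l₂.Perm l ∧ l₂.map f = l' := by
  induction l' generalizing l with
  | nil =>
    have : l = [] := by simpa using h.eq_nil
    exact ⟨[], by simp [this], rfl⟩
  | cons b l' ih =>
    have hb : b ∈ l.map f := h.mem_iff.2 (by simp)
    obtain ⟨a, ha, rfl⟩ := List.mem_map.1 hb
    obtain ⟨l₁, l₂, rfl⟩ := List.append_of_mem ha
    have h1 : ((l₁ ++ l₂).map f).Perm l' := by
      have h2 : ((a :: (l₁ ++ l₂)).map f).Perm (f a :: l') :=
        ((List.perm_middle (l₁ := l₁) (a := a) (l₂ := l₂)).symm.map f).trans h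
      simpa using h2
    obtain ⟨l₃, h3, h4⟩ := ih h1
    exact ⟨a :: l₃, (h3.cons a).trans List.perm_middle.symm, by simp [h4]⟩

end Regroup

/-! ### The instance after the reduction and the preprocessing -/

/-- The mass point of the configuration "in" for a mass point of the value distribution. -/
def inMass (I : Inst) (it : Item) (x : ℚ × ℚ) : Mass :=
  ⟨((x.1 - it.price : ℚ) : WithBot ℚ),
    it.price * (I.outside.map fun y => if y.1 ≤ x.1 - it.price then y.2 else 0).sum, x.2⟩

theorem reduceT_val (I : Inst) :
    (reduceT I).val = I.items.map fun it => [[⟨⊥, 0, 1⟩], it.dist.map (inMass I it)] := by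
  have h : ∀ u, (outsideProbT I.outside u).val =
      (I.outside.map fun y => if y.1 ≤ u then y.2 else 0).sum := by
    intro u
    simp only [outsideProbT, sumT_val]
    congr 2
    funext y
    by_cases h : y.1 ≤ u <;> simp [h]
  simp only [reduceT, mapT_val, val_bind, val_pure, inConfigT, subT_val, mulT_val, h]
  rfl

theorem IsDist.le_one {l : List (ℚ × ℚ)} (h : IsDist l) {x : ℚ × ℚ} (hx : x ∈ l) : x.2 ≤ 1 := by
  rw [← h.2]
  refine List.single_le_sum ?_ _ (List.mem_map_of_mem hx)
  intro y hy
  obtain ⟨z, hz, rfl⟩ := List.mem_map.1 hy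
  exact (h.1 z hz).le

/-- The mass points of the items. -/
abbrev Inst.Point (I : Inst) : Type :=
  Σ i : Fin I.items.length, Fin (I.items[i]).dist.length

variable {I : Inst}

/-- The utility of the buyer. -/
def Inst.Point.u (a : I.Point) : ℚ := ((I.items[a.1]).dist[a.2]).1 - (I.items[a.1]).price

def Inst.Point.pr (a : I.Point) : ℚ := ((I.items[a.1]).dist[a.2]).2

/-- The price of the item times the probability that the outside option is not better. -/
def Inst.Point.uP (a : I.Point) : ℚ :=
  (I.items[a.1]).price * (I.outside.map fun y => if y.1 ≤ a.u then y.2 else 0).sum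

/-- The price is fixed and the outside option loses more often against a larger utility. This
monotonicity within an item is what the correlation inequality needs later. -/
theorem Inst.Point.uP_mono (hI : I.Valid) {i : Fin I.items.length}
    {a b : Fin (I.items[i]).dist.length}
    (h : Inst.Point.u (I := I) ⟨i, a⟩ ≤ Inst.Point.u (I := I) ⟨i, b⟩) :
    Inst.Point.uP (I := I) ⟨i, a⟩ ≤ Inst.Point.uP (I := I) ⟨i, b⟩ := by
  unfold Inst.Point.uP
  refine mul_le_mul_of_nonneg_left ?_ (hI.1 _ (List.getElem_mem _)).1
  refine List.sum_le_sum fun y hy => ?_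
  have := (hI.2.1 y hy).le
  split
  · rename_i h1
    rw [if_pos (h1.trans h)]
  · split
    · exact this
    · exact le_rfl

theorem Inst.Point.uP_nonneg (hI : I.Valid) (a : I.Point) : 0 ≤ a.uP := by
  unfold Inst.Point.uP
  refine mul_nonneg (hI.1 _ (List.getElem_mem _)).1 (List.sum_nonneg ?_)
  intro x hx
  obtain ⟨y, hy, rfl⟩ := List.mem_map.1 hx
  have := (hI.2.1 y hy).le
  split
  · exact this
  · exact le_rfl

/-- The configurations after the preprocessing: the mass point `a` is replaced by the list `P a` of
pieces, the agent utilities of which are ordered like `κ`. -/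
structure IsRefinement (M : ℕ) (I : Inst) (outC inC : Fin I.items.length → Config)
    (κ : I.Point → ℚ) (P : I.Point → List Mass) : Prop where
  out : ∀ i, ∀ t ∈ outC i, t.uA = ⊥ ∧ t.uP = 0 ∧ 0 ≤ t.pr
  out_sum : ∀ i, ((outC i).map Mass.pr).sum = 1
  perm : ∀ i, (inC i).Perm ((List.finRange _).flatMap fun a => P ⟨i, a⟩)
  fin : ∀ a, ∀ x ∈ P a, ∃ z : ℚ, x.uA = z
  uP_eq : ∀ a, ∀ x ∈ P a, x.uP = a.uP
  pr_nonneg : ∀ a, ∀ x ∈ P a, 0 ≤ x.pr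
  pr_le : ∀ a, ∀ x ∈ P a, x.pr ≤ 1 / (M : ℚ) ^ 2
  pr_sum : ∀ a, ((P a).map Mass.pr).sum = a.pr
  lt_iff : ∀ a b, a ≠ b → ∀ x ∈ P a, ∀ y ∈ P b, x.uA < y.uA ↔ κ a < κ b
  nodup : ∀ a, ((P a).map Mass.uA).Nodup
  inj : Function.Injective κ
  lt_of_lt : ∀ a b : I.Point, a.u < b.u → κ a < κ b
  uP_le : ∀ a b : I.Point, a.u = b.u → κ a < κ b → a.uP ≤ b.uP

theorem sum_range_pieces (k : ℕ) (q p : ℚ) :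
    ((List.range (k + 1)).map fun r => if r < k then q else p - k * q).sum = p := by
  rw [List.range_succ, List.map_append, List.sum_append]
  have : (List.range k).map (fun r => if r < k then q else p - k * q) =
      (List.range k).map fun _ => q :=
    List.map_congr_left fun r hr => by simp [List.mem_range.1 hr]
  rw [this]
  simp

/-- The only place where the code of the preprocessing is analyzed. Everything later uses the
abstract order κ on the original mass points, given by the perturbed utility of the first piece. -/
theorem exists_isRefinement (M : ℕ) (hM : 1 ≤ M) (I : Inst) (hI : I.Valid) :
    ∃ outC inC κ P, IsRefinement M I outC inC κ P ∧
      (preprocessT M (reduceT I).val).val = List.ofFn fun i => [outC i, inC i] := by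
  have hM2 : (0 : ℚ) < (M : ℚ) ^ 2 := by positivity
  set F := (reduceT I).val with hF
  set A := (allMassesT F).val with hA
  set L := (sortT A).val with hL
  set δ := (deltaT M L).val with hδ
  set E := starts M 0 L with hE
  have hFlen : F.length = I.items.length := by simp [hF, reduceT_val]
  have hFi : ∀ i : Fin I.items.length, F[(i : ℕ)]? =
      some [[⟨⊥, 0, 1⟩], (I.items[i]).dist.map (inMass I I.items[i])] := by
    intro i; simp [hF, reduceT_val]
  have hpr : ∀ t ∈ L, 0 ≤ t.mass.pr ∧ t.mass.pr ≤ 1 := by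
    intro t ht
    have ht : t ∈ A := (sortT_perm A).mem_iff.1 ht
    rw [hA, allMassesT_val] at ht
    simp only [List.mem_flatMap, List.mem_map] at ht
    obtain ⟨⟨A', i⟩, ha, ⟨q, c⟩, hc, t, htq, rfl⟩ := ht
    dsimp only at htq ⊢
    have h1 : A' ∈ F := List.mem_of_getElem? (List.mem_zipIdx_iff_getElem?.1 ha)
    have h2 : q ∈ A' := List.mem_of_getElem? (List.mem_zipIdx_iff_getElem?.1 hc)
    rw [hF, reduceT_val] at h1
    obtain ⟨it, hit, rfl⟩ := List.mem_map.1 h1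
    simp only [List.mem_cons, List.not_mem_nil, or_false] at h2
    rcases h2 with rfl | rfl
    · simp only [List.mem_cons, List.not_mem_nil, or_false] at htq
      subst htq; simp
    · obtain ⟨x, hx, rfl⟩ := List.mem_map.1 htq
      have := (hI.1 it hit).2
      exact ⟨(this.1 x hx).le, this.le_one hx⟩
  have hsorted : L.Pairwise fun a b => a.mass.uP ≤ b.mass.uP := sortT_pairwise A
  have hEL : ∀ e ∈ E, e.1 ∈ L := by
    intro e he
    rw [← starts_map_fst M 0 L]
    exact List.mem_map_of_mem he
  have hEnodup : E.Nodup := (starts_pairwise M 0 L hsorted).imp fun {a b} h hab => by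
    subst hab; omega
  let Eg : ℕ → ℕ → List (Tagged × ℕ) := fun i c =>
    E.filter fun e => decide (e.1.act = i) && decide (e.1.cfg = c)
  have hEg : ∀ (i : Fin I.items.length) (c : ℕ) (q : Config),
      [[⟨⊥, 0, 1⟩], (I.items[i]).dist.map (inMass I I.items[i])][c]? = some q →
      ((Eg i c).map Prod.fst).Perm (q.map fun t => ⟨i, c, t⟩) := by
    intro i c q hq
    have h1 : (Eg i c).map Prod.fst = group L i c := by
      rw [← starts_map_fst M 0 L]
      unfold group
      rw [List.filter_map]
      rfl
    rw [h1, ← group_allMassesT F i c _ q (hFi i) hq]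
    exact (sortT_perm A).filter _
  -- Matches the mass points of item i with the entries of the sorted and numbered list, so that e
  -- below assigns to each original point its start number.
  have hal : ∀ i : Fin I.items.length, ∃ l : List (Tagged × ℕ), l.Perm (Eg i 1) ∧
      l.map Prod.fst = (I.items[i]).dist.map fun x => ⟨i, 1, inMass I I.items[i] x⟩ := by
    intro i
    have := exists_perm_map_eq (hEg i 1 _ rfl)
    simpa [Function.comp_def] using this
  choose al hal1 hal2 using hal
  have hlen : ∀ i, (al i).length = (I.items[i]).dist.length := by
    intro i
    have := congrArg List.length (hal2 i)
    simpa using this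
  let e : I.Point → Tagged × ℕ := fun a =>
    (al a.1)[(a.2 : ℕ)]'(by rw [hlen]; exact a.2.2)
  have he1 : ∀ a, (e a).1 = ⟨a.1, 1, ⟨(a.u : WithBot ℚ), a.uP, a.pr⟩⟩ := by
    intro a
    have h := List.getElem_of_eq (hal2 a.1) (i := a.2) (by simp [hlen])
    simp only [List.getElem_map] at h
    exact h
  have heE : ∀ a, e a ∈ E := by
    intro a
    have h1 : e a ∈ al a.1 := List.getElem_mem _
    have h2 := (hal1 a.1).mem_iff.1 h1
    exact List.mem_of_mem_filter h2
  have heinj : Function.Injective e := by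
    rintro ⟨i, a⟩ ⟨k, b⟩ hab
    have h1 := congrArg (fun e => e.1.act) hab
    simp only [he1] at h1
    have hik : i = k := Fin.ext h1
    subst hik
    have hnd : (al i).Nodup := (hal1 i).nodup_iff.2 (hEnodup.filter _)
    have := (List.Nodup.getElem_inj_iff hnd).1 hab
    exact congrArg (Sigma.mk i) (Fin.ext this)
  have hδpos : 0 < δ := deltaT_pos M L
  -- All numbers are at most N = length · (M² + 1), and δ was chosen as the gap divided by N + 1, so
  -- pieces compare lexicographically.
  have hlt : ∀ a b : I.Point, ∀ r r' : ℕ, r ≤ wholes M (e a).1 → r' ≤ wholes M (e b).1 →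
      (a.u + δ * (((e a).2 + r : ℕ) : ℚ) < b.u + δ * (((e b).2 + r' : ℕ) : ℚ) ↔
        a.u < b.u ∨ (a.u = b.u ∧ (e a).2 + r < (e b).2 + r')) := by
    intro a b r r' hr hr'
    have hN : ∀ a, (e a).2 + wholes M (e a).1 ≤ L.length * (M ^ 2 + 1) := fun a => by
      have := lt_of_mem_starts (fun t ht => (hpr t ht).2) (heE a)
      omega
    have hg : δ * ((L.length * (M ^ 2 + 1) + 1 : ℕ) : ℚ) = (gapT L).val := by
      rw [hδ, deltaT_val]
      exact div_mul_cancel₀ _ (by positivity)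
    refine perturb_lt_iff (N := L.length * (M ^ 2 + 1)) ?_ ?_ hδpos ?_ ?_
    · have := hN a; omega
    · have := hN b; omega
    · intro h
      rw [hg]
      exact gapT_le (hEL _ (heE a)) (hEL _ (heE b)) (by rw [he1]) (by rw [he1]) h
    · intro h
      rw [hg]
      exact gapT_le (hEL _ (heE b)) (hEL _ (heE a)) (by rw [he1]) (by rw [he1]) h
  let κ : I.Point → ℚ := fun a => a.u + δ * ((e a).2 : ℚ)
  have hκ : ∀ a b, κ a < κ b ↔ a.u < b.u ∨ (a.u = b.u ∧ (e a).2 < (e b).2) := by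
    intro a b
    have := hlt a b 0 0 (Nat.zero_le _) (Nat.zero_le _)
    simpa [κ] using this
  have htri : ∀ a b, a ≠ b → (a.uP ≤ b.uP ∧ (e a).2 + wholes M (e a).1 < (e b).2) ∨
      (b.uP ≤ a.uP ∧ (e b).2 + wholes M (e b).1 < (e a).2) := by
    intro a b hab
    have := starts_trichotomy hsorted (heE a) (heE b) (heinj.ne hab)
    simpa only [he1] using this
  let P : I.Point → List Mass := fun a => (pieces M δ (e a).1 (e a).2).map Tagged.mass
  have hP : ∀ a, ∀ x ∈ P a, ∃ r ≤ wholes M (e a).1,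
      x = ⟨((a.u + δ * (((e a).2 + r : ℕ) : ℚ) : ℚ) : WithBot ℚ), a.uP,
        if r < wholes M (e a).1 then 1 / (M : ℚ) ^ 2 else
        a.pr - (wholes M (e a).1 : ℚ) * (1 / (M : ℚ) ^ 2)⟩ := by
    intro a x hx
    simp only [P, pieces, List.map_map, List.mem_map, List.mem_range] at hx
    obtain ⟨r, hr, rfl⟩ := hx
    refine ⟨r, by omega, ?_⟩
    simp only [Function.comp, he1]
    rfl
  have hwh : ∀ a, (wholes M (e a).1 : ℚ) ≤ a.pr * (M : ℚ) ^ 2 ∧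
      a.pr * (M : ℚ) ^ 2 < (wholes M (e a).1 : ℚ) + 1 := by
    intro a
    have h0 : 0 ≤ (e a).1.mass.pr := (hpr _ (hEL _ (heE a))).1
    have h1 : (e a).1.mass.pr = a.pr := by rw [he1]
    have h2 : (0 : ℚ) ≤ (e a).1.mass.pr * (M : ℚ) ^ 2 := by positivity
    rw [← h1]
    exact ⟨Nat.floor_le h2, Nat.lt_floor_add_one _⟩
  refine ⟨fun i => (group (splitT M δ 0 L).val i 0).map Tagged.mass,
    fun i => (group (splitT M δ 0 L).val i 1).map Tagged.mass, κ, P, ?_, ?_⟩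
  · have hout : ∀ i : Fin I.items.length, ∃ ℓ, (group (splitT M δ 0 L).val i 0).map Tagged.mass =
        (pieces M δ ⟨i, 0, ⟨⊥, 0, 1⟩⟩ ℓ).map Tagged.mass := by
      intro i
      have h1 := hEg i 0 _ rfl
      simp only [List.map_cons, List.map_nil, List.perm_singleton] at h1
      rw [splitT_val, group_flatMap_pieces]
      change ∃ ℓ, ((Eg i 0).flatMap fun e => pieces M δ e.1 e.2).map Tagged.mass = _
      rcases hEi : Eg i 0 with _ | ⟨⟨t, ℓ⟩, l⟩
      · rw [hEi] at h1; simp at h1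
      · rw [hEi] at h1
        simp only [List.map_cons, List.cons.injEq, List.map_eq_nil_iff] at h1
        obtain ⟨rfl, rfl⟩ := h1
        exact ⟨ℓ, by simp⟩
    -- The two hypotheses say that k is the floor of pM²; they keep the remainder between 0 and
    -- 1/M².
    have hpM : ∀ (r k : ℕ) (p : ℚ), (k : ℚ) ≤ p * (M : ℚ) ^ 2 → p * (M : ℚ) ^ 2 < (k : ℚ) + 1 →
        0 ≤ (if r < k then 1 / (M : ℚ) ^ 2 else p - (k : ℚ) * (1 / (M : ℚ) ^ 2)) ∧
        (if r < k then 1 / (M : ℚ) ^ 2 else p - (k : ℚ) * (1 / (M : ℚ) ^ 2)) ≤ 1 / (M : ℚ) ^ 2 := by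
      intro r k p h1 h2
      have h3 : p = (p * (M : ℚ) ^ 2) * (1 / (M : ℚ) ^ 2) := by field_simp
      have h4 : (0 : ℚ) < 1 / (M : ℚ) ^ 2 := by positivity
      split
      · exact ⟨h4.le, le_rfl⟩
      · constructor <;> nlinarith
    refine ⟨?_, ?_, ?_, ?_, ?_, ?_, ?_, ?_, ?_, ?_, ?_, ?_, ?_⟩
    · intro i t ht
      obtain ⟨ℓ, hℓ⟩ := hout i
      rw [hℓ] at ht
      simp only [pieces, List.map_map, List.mem_map, List.mem_range] at ht
      obtain ⟨r, hr, rfl⟩ := ht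
      refine ⟨rfl, rfl, ?_⟩
      simp only [Function.comp]
      refine (hpM _ _ 1 (Nat.floor_le (by positivity)) (Nat.lt_floor_add_one _)).1
    · intro i
      obtain ⟨ℓ, hℓ⟩ := hout i
      simp only [hℓ, pieces, List.map_map]
      exact sum_range_pieces _ _ 1
    · intro i
      rw [splitT_val, group_flatMap_pieces]
      refine (((hal1 i).symm.flatMap_right _).map _).trans ?_
      rw [List.map_flatMap]
      have h1 : al i = (List.finRange (I.items[i]).dist.length).map fun a => e ⟨i, a⟩ := by
        refine List.ext_getElem (by simp [hlen]) fun j h1 h2 => ?_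
        simp [e]
      rw [h1, List.flatMap_map]
    · intro a x hx
      obtain ⟨r, -, rfl⟩ := hP a x hx
      exact ⟨_, rfl⟩
    · intro a x hx
      obtain ⟨r, -, rfl⟩ := hP a x hx
      rfl
    · intro a x hx
      obtain ⟨r, -, rfl⟩ := hP a x hx
      exact (hpM _ _ _ (hwh a).1 (hwh a).2).1
    · intro a x hx
      obtain ⟨r, -, rfl⟩ := hP a x hx
      exact (hpM _ _ _ (hwh a).1 (hwh a).2).2
    · intro a
      simp only [P, pieces, List.map_map]
      have h1 : (e a).1.mass.pr = a.pr := by rw [he1]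
      rw [← h1]
      exact sum_range_pieces _ _ _
    · intro a b hab x hx y hy
      obtain ⟨r, hr, rfl⟩ := hP a x hx
      obtain ⟨r', hr', rfl⟩ := hP b y hy
      simp only [WithBot.coe_lt_coe]
      rw [hlt a b r r' hr hr', hκ]
      -- The number intervals of different points are disjoint, so comparing any two of their pieces
      -- gives the same result as comparing their first pieces.
      have := htri a b hab
      constructor
      · rintro (h | ⟨h, h'⟩)
        · exact Or.inl h
        · exact Or.inr ⟨h, by omega⟩
      · rintro (h | ⟨h, h'⟩)
        · exact Or.inl h
        · exact Or.inr ⟨h, by omega⟩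
    · intro a
      simp only [P, pieces, List.map_map]
      refine List.Nodup.map_on ?_ List.nodup_range
      intro r hr r' hr' h
      simp only [Function.comp, he1] at h
      have h2 := WithBot.coe_injective h
      have h3 : δ * (((e a).2 + r : ℕ) : ℚ) = δ * (((e a).2 + r' : ℕ) : ℚ) := by
        linarith
      have h4 := mul_left_cancel₀ hδpos.ne' h3
      have h5 : (e a).2 + r = (e a).2 + r' := by exact_mod_cast h4
      omega
    · intro a b hab
      by_contra hne
      have h1 := hκ a b
      have h2 := hκ b a
      have h3 := htri a b hne
      rw [hab] at h1 h2
      simp only [lt_self_iff_false, false_iff, not_or, not_and, not_lt] at h1 h2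
      have h4 : a.u = b.u := le_antisymm h2.1 h1.1
      have h5 := h1.2 h4
      have h6 := h2.2 h4.symm
      omega
    · intro a b h
      exact (hκ a b).2 (Or.inl h)
    · intro a b h h'
      rcases (hκ a b).1 h' with h1 | ⟨-, h1⟩
      · exact absurd h h1.ne
      · rcases htri a b (by rintro rfl; exact lt_irrefl _ h') with h2 | h2
        · exact h2.1
        · omega
  · have : (preprocessT M F).val = (regroupT F (splitT M δ 0 L).val).val := rfl
    rw [this, regroupT_val]
    refine List.ext_getElem (by simp [hFlen]) fun i h1 h2 => ?_
    have hi : i < I.items.length := by simpa using h2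
    have h3 := hFi ⟨i, hi⟩
    have h4 : F[i]'(by rw [hFlen]; exact hi) = _ := (List.getElem?_eq_some_iff.1 h3).2
    simp only [List.getElem_map, List.getElem_zipIdx, List.getElem_ofFn, h4]
    simp

/-! ### The revenue of an assortment -/

/-- Independence: conditional on coordinate i, the expectation of a product over other coordinates
factorizes, and the coordinates outside of T and i integrate to 1. -/
theorem sum_pi_prod_mul {ι : Type*} [Fintype ι] [DecidableEq ι] {α : ι → Type*}
    [∀ i, Fintype (α i)] [∀ i, DecidableEq (α i)] (f : ∀ k, α k → ℚ) (hf : ∀ k, ∑ b, f k b = 1)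
    (i : ι) (T : Finset ι) (hi : i ∉ T) (h : α i → ℚ) (g : ∀ k, α k → α i → ℚ) :
    ∑ ω : ∀ k, α k, (∏ k, f k (ω k)) * (h (ω i) * ∏ k ∈ T, g k (ω k) (ω i)) =
      ∑ a, f i a * h a * ∏ k ∈ T, ∑ b, f k b * g k b a := by
  -- Coordinate i is frozen at a by an indicator in its own factor, which makes the summand a pure
  -- product over all coordinates.
  let w : ∀ (a : α i) (k : ι), α k → ℚ := fun a k b =>
    f k b * ((if hk : k = i then (if hk ▸ b = a then h a else 0) else 1) *
      if k ∈ T then g k b a else 1)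
  have h1 : ∀ a, ∑ ω : ∀ k, α k, ∏ k, w a k (ω k) =
      f i a * h a * ∏ k ∈ T, ∑ b, f k b * g k b a := by
    intro a
    have h2 := Finset.prod_univ_sum (fun k => (Finset.univ : Finset (α k))) (w a)
    rw [Fintype.piFinset_univ] at h2
    rw [← h2, ← Finset.mul_prod_erase _ _ (Finset.mem_univ i)]
    congr 1
    · simp [w, hi]
    · have hT : T ⊆ Finset.univ.erase i := fun k hk =>
        Finset.mem_erase.2 ⟨fun h => hi (h ▸ hk), Finset.mem_univ k⟩
      rw [← Finset.prod_subset hT]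
      · refine Finset.prod_congr rfl fun k hk => Finset.sum_congr rfl fun b _ => ?_
        have : k ≠ i := fun h => hi (h ▸ hk)
        simp [w, this, hk]
      · intro k hk hkT
        have : k ≠ i := (Finset.mem_erase.1 hk).1
        simp [w, this, hkT, hf]
  simp only [← h1]
  rw [Finset.sum_comm]
  refine Finset.sum_congr rfl fun ω _ => ?_
  rw [Finset.sum_eq_single (ω i)]
  · simp only [w, Finset.prod_mul_distrib]
    congr 2
    · rw [Finset.prod_eq_single i]
      · simp
      · intro k _ hk; simp [hk]
      · simp
    · rw [Finset.prod_ite_mem, Finset.univ_inter]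
  · intro a _ ha
    refine Finset.prod_eq_zero (Finset.mem_univ i) ?_
    simp [w, Ne.symm ha]
  · simp

variable {I : Inst}

/-- The outside option only decides whether anything is bought: if it does not beat the top utility,
the favorites are all items tied at the top, and otherwise there are none. -/
theorem payoff_eq {n : ℕ} (price : Fin n → ℚ) (S : Finset (Fin n)) (u₀ : ℚ) (u : Fin n → ℚ)
    {i₀ : Fin n} (hi₀ : i₀ ∈ S) (hmax : ∀ j ∈ S, u j ≤ u i₀) :
    payoff price S u₀ u = (if u₀ ≤ u i₀ then 1 else 0) *
      (S.filter fun i => u i = u i₀).fold max 0 price := by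
  unfold payoff favorites
  split
  · rename_i h
    rw [one_mul]
    congr 1
    ext i
    simp only [Finset.mem_filter, and_congr_right_iff]
    intro hi
    constructor
    · rintro ⟨-, h2⟩; exact le_antisymm (hmax i hi) (h2 _ hi₀)
    · intro h2; rw [h2]; exact ⟨h, hmax⟩
  · rename_i h
    rw [zero_mul]
    have : (S.filter fun i => u₀ ≤ u i ∧ ∀ j ∈ S, u j ≤ u i) = ∅ := by
      rw [Finset.filter_eq_empty_iff]
      rintro i hi ⟨h1, -⟩
      exact h (h1.trans (hmax i hi))
    rw [this, Finset.fold_empty]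

/-- The point that is drawn for item `i`. -/
abbrev Inst.point (I : Inst) (ω : (i : Fin I.items.length) → Fin (I.items[i]).dist.length)
    (i : Fin I.items.length) : I.Point := ⟨i, ω i⟩

theorem sum_fin_getElem {α : Type*} (l : List α) (f : α → ℚ) :
    ∑ o : Fin l.length, f l[o] = (l.map f).sum := by
  have := Fin.sum_univ_fun_getElem l f
  exact this

/-- For fixed item values the κ-maximal item i₀ has top utility, and among the items tied with it it
has the largest uP. At equal utility uP is the price times a common factor q, so i₀ has the largest
price among the tied items, unless q = 0 and nothing is earned. -/
theorem sum_payoff (hI : I.Valid) {κ : I.Point → ℚ} (hinj : Function.Injective κ)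
    (hlt : ∀ a b : I.Point, a.u < b.u → κ a < κ b)
    (hle : ∀ a b : I.Point, a.u = b.u → κ a < κ b → a.uP ≤ b.uP)
    (S : Finset (Fin I.items.length))
    (ω : (i : Fin I.items.length) → Fin (I.items[i]).dist.length) :
    ∑ o : Fin I.outside.length, I.outside[o].2 * payoff (fun i => (I.items[i]).price) S
        I.outside[o].1 (fun i => (I.point ω i).u) =
      ∑ i ∈ S, (I.point ω i).uP *
        ∏ k ∈ S.erase i, if κ (I.point ω k) < κ (I.point ω i) then 1 else 0 := by
  rcases S.eq_empty_or_nonempty with rfl | hS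
  · simp [payoff, favorites]
  obtain ⟨i₀, hi₀, hmax⟩ := S.exists_max_image (fun i => κ (I.point ω i)) hS
  have hne : ∀ i k, i ≠ k → κ (I.point ω i) ≠ κ (I.point ω k) := by
    intro i k hik h
    exact hik (congrArg Sigma.fst (hinj h))
  rw [Finset.sum_eq_single i₀]
  · have h1 : ∏ k ∈ S.erase i₀, (if κ (I.point ω k) < κ (I.point ω i₀) then (1 : ℚ) else 0) = 1 := by
      refine Finset.prod_eq_one fun k hk => ?_
      rw [Finset.mem_erase] at hk
      rw [if_pos (lt_of_le_of_ne (hmax k hk.2) (hne _ _ hk.1))]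
    rw [h1, mul_one]
    have humax : ∀ j ∈ S, (I.point ω j).u ≤ (I.point ω i₀).u := by
      intro j hj
      by_contra h
      exact absurd (hmax j hj) (hlt _ _ (not_le.1 h)).not_ge
    simp only [payoff_eq _ S _ (fun i => (I.point ω i).u) hi₀ humax]
    set m := (S.filter fun i => (I.point ω i).u = (I.point ω i₀).u).fold max 0
      fun i => (I.items[i]).price with hm
    set q := (I.outside.map fun y => if y.1 ≤ (I.point ω i₀).u then y.2 else 0).sum with hq
    have h2 : ∑ o : Fin I.outside.length,
        I.outside[o].2 * ((if I.outside[o].1 ≤ (I.point ω i₀).u then 1 else 0) * m) = q * m := by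
      rw [hq, ← sum_fin_getElem, Finset.sum_mul]
      refine Finset.sum_congr rfl fun o _ => ?_
      split <;> simp
    rw [h2]
    have hq0 : 0 ≤ q := by
      refine List.sum_nonneg fun x hx => ?_
      obtain ⟨y, hy, rfl⟩ := List.mem_map.1 hx
      have := (hI.2.1 y hy).le
      split
      · exact this
      · exact le_rfl
    have h3 : (I.point ω i₀).uP = q * (I.items[i₀]).price := mul_comm _ _
    rw [h3]
    refine le_antisymm ?_ (mul_le_mul_of_nonneg_left ?_ hq0)
    -- If q = 0, both sides vanish; otherwise the comparison of the uP can be divided by q to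
    -- compare prices.
    · rcases hq0.eq_or_lt with h0 | h0
      · rw [← h0]; simp
      refine mul_le_mul_of_nonneg_left ?_ hq0
      rw [hm, Finset.fold_max_le]
      refine ⟨(hI.1 _ (List.getElem_mem _)).1, fun i hi => ?_⟩
      rw [Finset.mem_filter] at hi
      by_cases hii : i = i₀
      · subst hii; exact le_rfl
      have h4 := hle _ _ hi.2 (lt_of_le_of_ne (hmax i hi.1) (hne _ _ hii))
      unfold Inst.Point.uP at h4
      rw [hi.2] at h4
      exact le_of_mul_le_mul_right h4 h0
    · rw [hm, Finset.le_fold_max]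
      right
      exact ⟨i₀, by simp [hi₀], le_rfl⟩
  · intro i hi hii
    have : ∏ k ∈ S.erase i, (if κ (I.point ω k) < κ (I.point ω i) then (1 : ℚ) else 0) = 0 := by
      refine Finset.prod_eq_zero (i := i₀) (Finset.mem_erase.2 ⟨Ne.symm hii, hi₀⟩) ?_
      rw [if_neg (not_lt.2 (hmax i hi))]
    rw [this, mul_zero]
  · intro h; exact absurd hi₀ h

/-- Summing out the outside option first leaves one winning term per item; independence then turns
the indicator that all others are κ-smaller into a product of distribution functions. -/
theorem revenue_eq (hI : I.Valid) {κ : I.Point → ℚ} (hinj : Function.Injective κ)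
    (hlt : ∀ a b : I.Point, a.u < b.u → κ a < κ b)
    (hle : ∀ a b : I.Point, a.u = b.u → κ a < κ b → a.uP ≤ b.uP)
    (S : Finset (Fin I.items.length)) :
    I.revenue S = ∑ i ∈ S, ∑ a : Fin (I.items[i]).dist.length,
      Inst.Point.pr (I := I) ⟨i, a⟩ * Inst.Point.uP (I := I) ⟨i, a⟩ *
        ∏ k ∈ S.erase i, ∑ b : Fin (I.items[k]).dist.length,
          Inst.Point.pr (I := I) ⟨k, b⟩ * if κ ⟨k, b⟩ < κ ⟨i, a⟩ then 1 else 0 := by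
  have h1 : I.revenue S = ∑ ω : (i : Fin I.items.length) → Fin (I.items[i]).dist.length,
      ∑ i ∈ S, (∏ k, (I.point ω k).pr) * ((I.point ω i).uP *
        ∏ k ∈ S.erase i, if κ (I.point ω k) < κ (I.point ω i) then 1 else 0) := by
    unfold Inst.revenue
    rw [Finset.sum_comm]
    refine Finset.sum_congr rfl fun ω _ => ?_
    rw [← Finset.mul_sum, ← sum_payoff hI hinj hlt hle, Finset.mul_sum]
    refine Finset.sum_congr rfl fun o _ => ?_
    rw [mul_comm (I.outside[o].2), mul_assoc]
    rfl
  rw [h1, Finset.sum_comm]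
  refine Finset.sum_congr rfl fun i hi => ?_
  exact sum_pi_prod_mul (fun k b => Inst.Point.pr (I := I) ⟨k, b⟩)
    (fun k => (sum_fin_getElem (I.items[k]).dist Prod.snd).trans
      (hI.1 _ (List.getElem_mem _)).2.2) i (S.erase i) (by simp)
    (fun a => Inst.Point.uP (I := I) ⟨i, a⟩)
    (fun k b a => if κ ⟨k, b⟩ < κ ⟨i, a⟩ then 1 else 0)

/-! ### Expectations over the mass points of a configuration -/

section Expectation

variable {c : Config} {f g : Mass → ℚ}

theorem ex_congr (h : ∀ t ∈ c, f t = g t) : ex c f = ex c g := by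
  unfold ex
  congr 1
  exact List.map_congr_left fun t ht => by rw [h t ht]

theorem ex_perm {c' : Config} (h : c.Perm c') (f : Mass → ℚ) : ex c f = ex c' f :=
  (h.map _).sum_eq

theorem ex_add (c : Config) (f g : Mass → ℚ) : ex c (fun t => f t + g t) = ex c f + ex c g := by
  unfold ex
  rw [← List.sum_map_add]
  simp only [mul_add]

theorem ex_const_mul (c : Config) (r : ℚ) (f : Mass → ℚ) : ex c (fun t => r * f t) = r * ex c f := by
  unfold ex
  rw [← List.sum_map_mul_left]
  simp only [mul_left_comm]

theorem ex_mul_const (c : Config) (r : ℚ) (f : Mass → ℚ) : ex c (fun t => f t * r) = ex c f * r := by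
  rw [mul_comm, ← ex_const_mul]
  simp only [mul_comm]

@[simp] theorem ex_zero (c : Config) : ex c (fun _ => 0) = 0 := by
  simp [ex]

theorem ex_sum {ι : Type*} (c : Config) (s : Finset ι) (f : ι → Mass → ℚ) :
    ex c (fun t => ∑ i ∈ s, f i t) = ∑ i ∈ s, ex c (f i) := by
  classical
  induction s using Finset.induction_on with
  | empty => simp
  | insert a s ha ih => simp only [Finset.sum_insert ha, ex_add, ih]

theorem ex_mono (hc : ∀ t ∈ c, 0 ≤ t.pr) (h : ∀ t ∈ c, f t ≤ g t) : ex c f ≤ ex c g := by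
  unfold ex
  exact List.sum_le_sum fun t ht => mul_le_mul_of_nonneg_left (h t ht) (hc t ht)

theorem ex_nonneg (hc : ∀ t ∈ c, 0 ≤ t.pr) (h : ∀ t ∈ c, 0 ≤ f t) : 0 ≤ ex c f := by
  have := ex_mono (g := f) (f := fun _ => 0) hc h
  simpa using this

theorem ex_one (c : Config) : ex c (fun _ => 1) = (c.map Mass.pr).sum := by
  simp [ex]

end Expectation

/-- `Pr[u_i^A < u]`. -/
def cdf (c : Config) (u : WithBot ℚ) : ℚ := ex c fun t => if t.uA < u then 1 else 0

theorem probLtT_val (u : WithBot ℚ) (c : Config) : (probLtT u c).val = cdf c u := by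
  exact sumT_ite_eq_ex c (fun t => utilLtT t.uA u) (fun t => t.uA < u) (fun t => by simp)

theorem prod_erase_eq_prod_ite {n : ℕ} (i : Fin n) (f : Fin n → ℚ) :
    ∏ k ∈ Finset.univ.erase i, f k = ∏ k, if k = i then 1 else f k := by
  rw [← Finset.prod_erase (a := i) Finset.univ (by simp)]
  refine Finset.prod_congr rfl fun k hk => ?_
  rw [if_neg (Finset.mem_erase.1 hk).1]

/-- The expected principal utility if the agent utilities are distinct. -/
def utility {n : ℕ} (cf : Fin n → Config) : ℚ :=
  ∑ i, ex (cf i) fun t => t.uP * ∏ k ∈ Finset.univ.erase i, cdf (cf k) t.uA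

/-- The processed actions in `pre` only contribute a factor to each term; generalizing over them
makes the induction on the remaining actions work. -/
theorem evalT_ofFn {n : ℕ} (pre : List Config) (cf : Fin n → Config) :
    (evalT pre (List.ofFn cf)).val = ∑ i, ex (cf i) fun t =>
      t.uP * ((pre.map fun c => cdf c t.uA).prod *
        ∏ k ∈ Finset.univ.erase i, cdf (cf k) t.uA) := by
  induction n generalizing pre with
  | zero => simp [evalT]
  | succ n ih =>
    rw [List.ofFn_succ]
    simp only [evalT, val_bind, addT_val, sumT_val, prodT_val, mulT_val, probLtT_val]
    rw [ih, Fin.sum_univ_succ]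
    simp only [prod_erase_eq_prod_ite, Fin.prod_univ_succ, List.map_ofFn, List.prod_ofFn]
    congr 1
    · unfold ex
      congr 1
      refine List.map_congr_left fun t _ => ?_
      simp [Fin.succ_ne_zero, mul_assoc]
    · refine Finset.sum_congr rfl fun i _ => ex_congr fun t _ => ?_
      have : (0 : Fin (n + 1)) ≠ i.succ := (Fin.succ_ne_zero i).symm
      simp only [this, if_false, Fin.succ_inj, List.map_cons, List.prod_cons]
      ring

theorem evalT_nil_ofFn {n : ℕ} (cf : Fin n → Config) :
    (evalT [] (List.ofFn cf)).val = utility cf := by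
  rw [evalT_ofFn]
  simp [utility]

/-- The configurations of the actions if the actions in `S` are "in". -/
def choose {n : ℕ} (outC inC : Fin n → Config) (S : Finset (Fin n)) (i : Fin n) : Config :=
  if i ∈ S then inC i else outC i

/-- The properties of the preprocessed configurations of `n` items. -/
structure IsModel {n : ℕ} (M : ℕ) (outC inC : Fin n → Config) : Prop where
  out : ∀ i, ∀ t ∈ outC i, t.uA = ⊥ ∧ t.uP = 0 ∧ 0 ≤ t.pr
  out_sum : ∀ i, ((outC i).map Mass.pr).sum = 1
  fin : ∀ i, ∀ t ∈ inC i, ∃ z : ℚ, t.uA = z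
  uP_nonneg : ∀ i, ∀ t ∈ inC i, 0 ≤ t.uP
  pr_nonneg : ∀ i, ∀ t ∈ inC i, 0 ≤ t.pr
  pr_le : ∀ i, ∀ t ∈ inC i, t.pr ≤ 1 / (M : ℚ) ^ 2
  in_sum : ∀ i, ((inC i).map Mass.pr).sum = 1
  mono : ∀ i, ∀ s ∈ inC i, ∀ t ∈ inC i, s.uA < t.uA → s.uP ≤ t.uP
  nodup : ∀ i, ((inC i).map Mass.uA).Nodup
  ne : ∀ i k, i ≠ k → ∀ s ∈ inC i, ∀ t ∈ inC k, s.uA ≠ t.uA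

namespace IsRefinement

variable {M : ℕ} {I : Inst} {outC inC : Fin I.items.length → Config} {κ : I.Point → ℚ}
  {P : I.Point → List Mass}

theorem mem_iff (h : IsRefinement M I outC inC κ P) {i : Fin I.items.length} {t : Mass} :
    t ∈ inC i ↔ ∃ a, t ∈ P ⟨i, a⟩ := by
  rw [(h.perm i).mem_iff]; simp

theorem ex_in (h : IsRefinement M I outC inC κ P) (i : Fin I.items.length) (f : Mass → ℚ) :
    ex (inC i) f = ∑ a, ex (P ⟨i, a⟩) f := by
  rw [ex_perm (h.perm i), Fin.sum_univ_def]
  unfold ex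
  rw [List.map_flatMap, List.flatMap_def, List.sum_flatten, List.map_map]
  rfl

theorem isModel (h : IsRefinement M I outC inC κ P) (hI : I.Valid) : IsModel M outC inC := by
  refine ⟨h.out, h.out_sum, ?_, ?_, ?_, ?_, ?_, ?_, ?_, ?_⟩
  · intro i t ht
    obtain ⟨a, ha⟩ := h.mem_iff.1 ht
    exact h.fin _ t ha
  · intro i t ht
    obtain ⟨a, ha⟩ := h.mem_iff.1 ht
    rw [h.uP_eq _ t ha]
    exact Inst.Point.uP_nonneg hI _
  · intro i t ht
    obtain ⟨a, ha⟩ := h.mem_iff.1 ht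
    exact h.pr_nonneg _ t ha
  · intro i t ht
    obtain ⟨a, ha⟩ := h.mem_iff.1 ht
    exact h.pr_le _ t ha
  · intro i
    rw [← ex_one, h.ex_in]
    simp only [ex_one, h.pr_sum]
    exact (sum_fin_getElem (I.items[i]).dist Prod.snd).trans (hI.1 _ (List.getElem_mem _)).2.2
  · intro i s hs t ht hst
    obtain ⟨a, ha⟩ := h.mem_iff.1 hs
    obtain ⟨b, hb⟩ := h.mem_iff.1 ht
    rw [h.uP_eq _ _ ha, h.uP_eq _ _ hb]
    by_cases hab : a = b
    · rw [hab]
    · have h1 := (h.lt_iff ⟨i, a⟩ ⟨i, b⟩ (by simpa using hab) s ha t hb).1 hst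
      refine Inst.Point.uP_mono hI ?_
      by_contra h2
      exact lt_asymm h1 (h.lt_of_lt _ _ (not_le.1 h2))
  · intro i
    rw [((h.perm i).map _).nodup_iff, List.map_flatMap, List.nodup_flatMap]
    refine ⟨fun a _ => h.nodup _, ?_⟩
    refine (List.nodup_finRange _).imp fun {a b} hab => ?_
    intro z hz hz'
    obtain ⟨s, hs, rfl⟩ := List.mem_map.1 hz
    obtain ⟨t, ht, hst⟩ := List.mem_map.1 hz'
    have hab' : (⟨i, a⟩ : I.Point) ≠ ⟨i, b⟩ := by simpa using hab
    have h1 := h.lt_iff _ _ hab' s hs t ht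
    have h2 := h.lt_iff _ _ hab'.symm t ht s hs
    rw [hst] at h1 h2
    simp only [lt_self_iff_false, false_iff, not_lt] at h1 h2
    exact hab' (h.inj (le_antisymm h2 h1))
  · intro i k hik s hs t ht hst
    obtain ⟨a, ha⟩ := h.mem_iff.1 hs
    obtain ⟨b, hb⟩ := h.mem_iff.1 ht
    have hab' : (⟨i, a⟩ : I.Point) ≠ ⟨k, b⟩ := fun h => hik (congrArg Sigma.fst h)
    have h1 := h.lt_iff _ _ hab' s ha t hb
    have h2 := h.lt_iff _ _ hab'.symm t hb s ha
    rw [hst] at h1 h2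
    simp only [lt_self_iff_false, false_iff, not_lt] at h1 h2
    exact hab' (h.inj (le_antisymm h2 h1))

end IsRefinement

namespace IsModel

variable {n M : ℕ} {outC inC : Fin n → Config}

theorem cdf_out (h : IsModel M outC inC) (i : Fin n) {u : WithBot ℚ} (hu : u ≠ ⊥) :
    cdf (outC i) u = 1 := by
  refine Eq.trans (ex_congr fun t ht => ?_) ((ex_one _).trans (h.out_sum i))
  rw [(h.out i t ht).1, if_pos (bot_lt_iff_ne_bot.2 hu)]

/-- Actions that are "out" earn nothing and lie at -∞, hence below every finite utility, so they
disappear from the sum and from the products. -/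
theorem utility_choose (h : IsModel M outC inC) (S : Finset (Fin n)) :
    utility (choose outC inC S) = ∑ i ∈ S, ex (inC i) fun t =>
      t.uP * ∏ k ∈ S.erase i, cdf (inC k) t.uA := by
  unfold utility
  rw [← Finset.sum_subset (Finset.subset_univ S)]
  · refine Finset.sum_congr rfl fun i hi => ?_
    simp only [choose, hi, if_true]
    refine ex_congr fun t ht => ?_
    congr 1
    rw [← Finset.prod_subset (Finset.erase_subset_erase i (Finset.subset_univ S))]
    · refine Finset.prod_congr rfl fun k hk => ?_
      rw [if_pos (Finset.mem_of_mem_erase hk)]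
    · intro k hk hkS
      have hk' : k ∉ S := fun hS => hkS (Finset.mem_erase.2 ⟨(Finset.mem_erase.1 hk).1, hS⟩)
      rw [if_neg hk']
      obtain ⟨z, hz⟩ := h.fin i t ht
      exact h.cdf_out k (by rw [hz]; exact WithBot.coe_ne_bot)
  · intro i _ hi
    rw [← ex_zero (choose outC inC S i)]
    refine ex_congr fun t ht => ?_
    simp only [choose, hi, if_false] at ht
    rw [(h.out i t ht).2.1, zero_mul]

end IsModel

/-- Exactness of the reduction: uP and the comparisons with pieces of other points are constant
along the pieces of a point, so the piece probabilities add up to that of the point and `revenue_eq`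
applies. -/
theorem IsRefinement.utility_choose {M : ℕ} {I : Inst}
    {outC inC : Fin I.items.length → Config} {κ : I.Point → ℚ} {P : I.Point → List Mass}
    (h : IsRefinement M I outC inC κ P) (hI : I.Valid) (S : Finset (Fin I.items.length)) :
    utility (choose outC inC S) = I.revenue S := by
  rw [(h.isModel hI).utility_choose, revenue_eq hI h.inj h.lt_of_lt h.uP_le]
  refine Finset.sum_congr rfl fun i _ => ?_
  rw [h.ex_in]
  refine Finset.sum_congr rfl fun a _ => ?_
  have h1 : ∀ t ∈ P ⟨i, a⟩, t.uP * ∏ k ∈ S.erase i, cdf (inC k) t.uA =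
      Inst.Point.uP (I := I) ⟨i, a⟩ *
        ∏ k ∈ S.erase i, ∑ b : Fin (I.items[k]).dist.length,
          Inst.Point.pr (I := I) ⟨k, b⟩ * if κ ⟨k, b⟩ < κ ⟨i, a⟩ then 1 else 0 := by
    intro t ht
    rw [h.uP_eq _ t ht]
    congr 1
    refine Finset.prod_congr rfl fun k hk => ?_
    unfold cdf
    rw [h.ex_in]
    refine Finset.sum_congr rfl fun b _ => ?_
    have hne : (⟨k, b⟩ : I.Point) ≠ ⟨i, a⟩ := fun h =>
      (Finset.mem_erase.1 hk).1 (congrArg Sigma.fst h)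
    rw [ex_congr (g := fun _ => if κ ⟨k, b⟩ < κ ⟨i, a⟩ then 1 else 0) (fun s hs =>
      if_congr (h.lt_iff _ _ hne s hs t ht) rfl rfl)]
    rw [← h.pr_sum, ← ex_one, ← ex_mul_const]
    simp only [one_mul]
  rw [ex_congr h1, mul_assoc, ← h.pr_sum, ← ex_one, ← ex_mul_const]
  simp only [one_mul]

/-! ### Bins -/

/-- `x` lies below the bin boundary with the number `j`; the last bin is unbounded. -/
def Below (M : ℕ) (v : ℕ → WithBot ℚ) (j : ℕ) (x : WithBot ℚ) : Prop := j < M → x < v j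

instance (M : ℕ) (v : ℕ → WithBot ℚ) (j : ℕ) (x : WithBot ℚ) : Decidable (Below M v j x) := by
  unfold Below; infer_instance

/-- `E[f; u^A below the boundary j]`. -/
def cumEx (M : ℕ) (v : ℕ → WithBot ℚ) (c : Config) (f : Mass → ℚ) (j : ℕ) : ℚ :=
  ex c fun t => if Below M v j t.uA then f t else 0

/-- `Pr[u^A below the boundary j]`. -/
def cumPr (M : ℕ) (v : ℕ → WithBot ℚ) (c : Config) (j : ℕ) : ℚ := cumEx M v c (fun _ => 1) j

/-- The bin boundaries `-∞ = v 0 ≤ v 1 ≤ … ≤ v M`. -/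
structure IsProfile (M : ℕ) (v : ℕ → WithBot ℚ) : Prop where
  pos : 1 ≤ M
  zero : v 0 = ⊥
  mono : ∀ j < M, v j ≤ v (j + 1)

/-- The list of the bins. -/
def binList (M : ℕ) (v : ℕ → WithBot ℚ) : List Bin :=
  (List.range M).map fun i => ⟨i + 1, v i, v (i + 1), decide (i + 1 = M)⟩

theorem binsT_profile (M : ℕ) (v : ℕ → WithBot ℚ) (h : v 0 = ⊥) :
    (binsT 1 ⊥ ((List.range' 1 M).map v)).val = binList M v := by
  rw [← h]
  have := binsT_val v 0 M
  simp only [Nat.zero_add] at this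
  rw [this, binList, List.range_eq_range']

theorem cdf_mono {c : Config} (hc : ∀ t ∈ c, 0 ≤ t.pr) {u w : WithBot ℚ} (h : u ≤ w) :
    cdf c u ≤ cdf c w := by
  refine ex_mono hc fun t _ => ?_
  by_cases h1 : t.uA < u
  · simp [h1, h1.trans_le h]
  · rw [if_neg h1]; positivity

theorem cdf_nonneg {c : Config} (hc : ∀ t ∈ c, 0 ≤ t.pr) (u : WithBot ℚ) : 0 ≤ cdf c u :=
  ex_nonneg hc fun t _ => by positivity

theorem cdf_le_one {c : Config} (hc : ∀ t ∈ c, 0 ≤ t.pr) (hs : (c.map Mass.pr).sum = 1)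
    (u : WithBot ℚ) : cdf c u ≤ 1 := by
  rw [← hs, ← ex_one]
  refine ex_mono hc fun t _ => ?_
  split <;> norm_num

section

variable {M : ℕ} {v : ℕ → WithBot ℚ} {c : Config} {f g : Mass → ℚ}

theorem cumPr_eq_cdf {j : ℕ} (hj : j < M) : cumPr M v c j = cdf c (v j) := by
  unfold cumPr cumEx cdf
  refine ex_congr fun t _ => if_congr ?_ rfl rfl
  simp [Below, hj]

theorem cumEx_last : cumEx M v c f M = ex c f := by
  unfold cumEx
  refine ex_congr fun t _ => if_pos ?_
  simp [Below]

theorem IsProfile.cumEx_zero (hv : IsProfile M v) : cumEx M v c f 0 = 0 := by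
  refine (ex_congr fun t _ => if_neg ?_).trans (ex_zero c)
  have := hv.pos
  simp only [Below, hv.zero, not_lt_bot, imp_false, not_not]
  omega

theorem IsProfile.below_mono (hv : IsProfile M v) {j : ℕ} {x : WithBot ℚ} (h : Below M v j x) :
    Below M v (j + 1) x := fun hj => (h (by omega)).trans_le (hv.mono j (by omega))

/-- The part of the expectation that comes from bin number `j + 1`. -/
theorem IsProfile.cumEx_succ_sub (hv : IsProfile M v) (c : Config) (f : Mass → ℚ) (j : ℕ) :
    cumEx M v c f (j + 1) - cumEx M v c f j =
      ex c fun t => if Below M v (j + 1) t.uA ∧ ¬ Below M v j t.uA then f t else 0 := by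
  rw [sub_eq_iff_eq_add]
  unfold cumEx
  rw [← ex_add]
  refine ex_congr fun t _ => ?_
  by_cases h1 : Below M v j t.uA
  · simp [h1, hv.below_mono h1]
  · simp [h1]

/-- The comparison is only required inside the bin. It serves to replace a winning probability by
its value at the lower or upper end of a bin. -/
theorem IsProfile.bin_mono (hv : IsProfile M v) (hc : ∀ t ∈ c, 0 ≤ t.pr) (j : ℕ)
    (h : ∀ t ∈ c, v j ≤ t.uA → (j + 1 < M → t.uA < v (j + 1)) → f t ≤ g t) :
    cumEx M v c f (j + 1) - cumEx M v c f j ≤ cumEx M v c g (j + 1) - cumEx M v c g j := by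
  rw [hv.cumEx_succ_sub, hv.cumEx_succ_sub]
  refine ex_mono hc fun t ht => ?_
  split
  · rename_i h1
    refine h t ht ?_ h1.1
    by_contra h2
    exact h1.2 fun _ => not_le.1 h2
  · exact le_rfl

theorem IsProfile.bin_nonneg (hv : IsProfile M v) (hc : ∀ t ∈ c, 0 ≤ t.pr) (j : ℕ)
    (h : ∀ t ∈ c, 0 ≤ f t) :
    0 ≤ cumEx M v c f (j + 1) - cumEx M v c f j := by
  rw [hv.cumEx_succ_sub]
  refine ex_nonneg hc fun t ht => ?_
  split
  · exact h t ht
  · exact le_rfl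

theorem IsProfile.cumPr_le_succ (hv : IsProfile M v) (hc : ∀ t ∈ c, 0 ≤ t.pr) (j : ℕ) :
    cumPr M v c j ≤ cumPr M v c (j + 1) := by
  have := hv.bin_nonneg (f := fun _ => 1) hc j (fun t _ => zero_le_one)
  unfold cumPr
  linarith

theorem cumPr_nonneg (hc : ∀ t ∈ c, 0 ≤ t.pr) (j : ℕ) : 0 ≤ cumPr M v c j := by
  refine ex_nonneg hc fun t _ => ?_
  positivity

theorem sum_bins (hv : IsProfile M v) (c : Config) (f : Mass → ℚ) :
    ex c f = ∑ j ∈ Finset.range M, (cumEx M v c f (j + 1) - cumEx M v c f j) := by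
  rw [Finset.sum_range_sub, cumEx_last, hv.cumEx_zero, sub_zero]

/-- As no utility exceeds v M, the closed last bin of the algorithm captures the same points as the
unbounded last bin of `Below`. -/
theorem inCumT_val {i : ℕ} (hi : i < M) {x : WithBot ℚ} (hx : x ≤ v M) :
    (inCumT ⟨i + 1, v i, v (i + 1), decide (i + 1 = M)⟩ x).val = decide (Below M v (i + 1) x) := by
  unfold inCumT Below
  by_cases h : i + 1 = M
  · simp [h, hx]
  · have : i + 1 < M := by omega
    simp [h, this]

theorem inBinT_val {i : ℕ} (hi : i < M) {x : WithBot ℚ} (hx : x ≤ v M) :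
    (inBinT ⟨i + 1, v i, v (i + 1), decide (i + 1 = M)⟩ x).val =
      decide (Below M v (i + 1) x ∧ ¬ Below M v i x) := by
  unfold inBinT
  rw [andT_val, inCumT_val hi hx, Bool.decide_and]
  congr 1
  simp only [notT_val, utilLtT_val, Below, hi, forall_const, decide_not]

theorem sumT_ite_of_mem (c : Config) (p : Mass → Timed Bool) (r : Mass → Timed ℚ) (q : Mass → Prop)
    [DecidablePred q] (f : Mass → ℚ) (h : ∀ t ∈ c, (p t).val = decide (q t))
    (hr : ∀ t, (r t).val = t.pr * f t) :
    (sumT (fun t => do if ← p t then r t else return 0) c).val =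
      ex c fun t => if q t then f t else 0 := by
  simp only [sumT_val, ex]
  congr 1
  refine List.map_congr_left fun t ht => ?_
  by_cases hq : q t <;> simp [h t ht, hq, hr]

theorem probCumT_val {i : ℕ} (hi : i < M) (hc : ∀ t ∈ c, t.uA ≤ v M) :
    (probCumT ⟨i + 1, v i, v (i + 1), decide (i + 1 = M)⟩ c).val = cumPr M v c (i + 1) :=
  sumT_ite_of_mem c _ (fun t => pure t.pr) _ (fun _ => 1) (fun t ht => inCumT_val hi (hc t ht))
    (fun t => by simp)

theorem probBinT_val (hv : IsProfile M v) {i : ℕ} (hi : i < M) (hc : ∀ t ∈ c, t.uA ≤ v M) :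
    (probBinT ⟨i + 1, v i, v (i + 1), decide (i + 1 = M)⟩ c).val =
      cumPr M v c (i + 1) - cumPr M v c i := by
  unfold cumPr
  rw [hv.cumEx_succ_sub]
  exact sumT_ite_of_mem c _ (fun t => pure t.pr) _ (fun _ => 1)
    (fun t ht => inBinT_val hi (hc t ht)) (fun t => by simp)

theorem utilBinT_val (hv : IsProfile M v) {i : ℕ} (hi : i < M) (hc : ∀ t ∈ c, t.uA ≤ v M) :
    (utilBinT ⟨i + 1, v i, v (i + 1), decide (i + 1 = M)⟩ c).val =
      cumEx M v c Mass.uP (i + 1) - cumEx M v c Mass.uP i := by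
  rw [hv.cumEx_succ_sub]
  exact sumT_ite_of_mem c _ (fun t => mulT t.pr t.uP) _ Mass.uP
    (fun t ht => inBinT_val hi (hc t ht)) (fun t => by simp)

/-- `E[u^P | u^A ∈ B_{j+1}] Pr[u^A ∈ B_{j+1} | u^A ∈ B_{≤ j+1}]`. -/
def binUtil (M : ℕ) (v : ℕ → WithBot ℚ) (c : Config) (j : ℕ) : ℚ :=
  (cumEx M v c Mass.uP (j + 1) - cumEx M v c Mass.uP j) / cumPr M v c (j + 1)

/-- `Pr[u^A ∈ B_{j+1} | u^A ∈ B_{≤ j+1}]`. -/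
def condPr (M : ℕ) (v : ℕ → WithBot ℚ) (c : Config) (j : ℕ) : ℚ :=
  (cumPr M v c (j + 1) - cumPr M v c j) / cumPr M v c (j + 1)

/-- The coefficient of bin number `j + 1`. -/
def coeff (M j : ℕ) : ℚ := if 5 ≤ j then ((j : ℚ) - 4) / ((M : ℚ) - 1) else 0

/-- The approximate objective. -/
def objective (M : ℕ) (v : ℕ → WithBot ℚ) (c : Config) : ℚ :=
  ∑ j ∈ Finset.range M, coeff M j * binUtil M v c j

theorem unitsT_val (hv : IsProfile M v) {i : ℕ} (hi : i < M) (hc : ∀ t ∈ c, t.uA ≤ v M) (D : ℚ) :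
    (unitsT D c ⟨i + 1, v i, v (i + 1), decide (i + 1 = M)⟩).val = ⌊condPr M v c i * D⌋₊ := by
  simp only [unitsT, val_bind, probBinT_val hv hi hc, probCumT_val hi hc, divT_val, mulT_val,
    floorT_val, condPr]

theorem weightedUtilT_val (hv : IsProfile M v) {i : ℕ} (hi : i < M) (hc : ∀ t ∈ c, t.uA ≤ v M) :
    (weightedUtilT M c ⟨i + 1, v i, v (i + 1), decide (i + 1 = M)⟩).val =
      coeff M i * binUtil M v c i := by
  unfold coeff
  simp only [weightedUtilT, val_bind, castT_val, leT_val]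
  have h6 : ((6 : ℚ) ≤ ((i + 1 : ℕ) : ℚ)) ↔ 5 ≤ i := by
    constructor
    · intro h
      have : 6 ≤ i + 1 := by exact_mod_cast h
      omega
    · intro h
      have : 6 ≤ i + 1 := by omega
      exact_mod_cast this
  by_cases h : 5 ≤ i
  · simp only [h6, h, decide_true, if_true, val_bind, utilBinT_val hv hi hc,
      probCumT_val hi hc, divT_val, subT_val, mulT_val, binUtil]
    push_cast
    ring
  · simp only [h6, h, decide_false, Bool.false_eq_true, if_false, val_pure, zero_mul]

theorem profileT_objective (hv : IsProfile M v) (hc : ∀ t ∈ c, t.uA ≤ v M) (D : ℚ) :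
    (profileT M D (binList M v) c).val.1 = objective M v c := by
  rw [profileT_psi, binList, List.map_map]
  unfold objective
  rw [← List.sum_toFinset _ List.nodup_range, List.toFinset_range]
  refine Finset.sum_congr rfl fun i hi => ?_
  exact weightedUtilT_val hv (Finset.mem_range.1 hi) hc

end

theorem binFeasibleT_val (M : ℕ) (D : ℚ) (i k : ℕ) (lo hi : WithBot ℚ) (l : Bool) :
    (binFeasibleT M D ⟨i + 1, lo, hi, l⟩ k).val = true ↔
      (1 - 1 / (M : ℚ)) / ((i : ℚ) + 1) - 1 / (M : ℚ) ^ 2 ≤ k / D ∧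
        (i = 0 ∨ (k : ℚ) / D ≤ (1 + 1 / (M : ℚ)) / i) := by
  simp only [binFeasibleT, val_bind, castT_val, divT_val, subT_val, leT_val]
  push_cast
  by_cases h2 : i = 0 <;> simp [h2]

/-! ### Lower bound for the utility of a feasible solution -/

/-- The union bound. With q the conditional bin probabilities, the product is the ratio of
consecutive values of `allPr` when the later value is nonzero. -/
theorem one_sub_sum_le_prod {ι : Type*} (s : Finset ι) (q : ι → ℚ) (h0 : ∀ i ∈ s, 0 ≤ q i)
    (h1 : ∀ i ∈ s, q i ≤ 1) : 1 - ∑ i ∈ s, q i ≤ ∏ i ∈ s, (1 - q i) := by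
  classical
  induction s using Finset.induction_on with
  | empty => simp
  | insert a s ha ih =>
    rw [Finset.sum_insert ha, Finset.prod_insert ha]
    have h2 := ih (fun i hi => h0 i (by simp [hi])) fun i hi => h1 i (by simp [hi])
    have h3 := h0 a (by simp)
    have h4 := h1 a (by simp)
    have h5 : ∏ i ∈ s, (1 - q i) ≤ 1 := Finset.prod_le_one
      (fun i hi => sub_nonneg.2 (h1 i (by simp [hi]))) fun i hi => by
        linarith [h0 i (by simp [hi])]
    nlinarith

theorem one_add_sum_le_prod {ι : Type*} (s : Finset ι) (q : ι → ℚ) (h0 : ∀ i ∈ s, 0 ≤ q i) :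
    1 + ∑ i ∈ s, q i ≤ ∏ i ∈ s, (1 + q i) := by
  classical
  induction s using Finset.induction_on with
  | empty => simp
  | insert a s ha ih =>
    rw [Finset.sum_insert ha, Finset.prod_insert ha]
    have h2 := ih fun i hi => h0 i (by simp [hi])
    have h3 := h0 a (by simp)
    have h4 : 0 ≤ ∑ i ∈ s, q i := Finset.sum_nonneg fun i hi => h0 i (by simp [hi])
    nlinarith

/-- The choice of the configurations: probability distributions with nonnegative utilities. -/
structure IsChoice {n : ℕ} (cf : Fin n → Config) : Prop where
  pr_nonneg : ∀ k, ∀ t ∈ cf k, 0 ≤ t.pr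
  sum_eq : ∀ k, ((cf k).map Mass.pr).sum = 1
  uP_nonneg : ∀ k, ∀ t ∈ cf k, 0 ≤ t.uP

section

variable {n M : ℕ} {v : ℕ → WithBot ℚ} {cf : Fin n → Config}

theorem IsChoice.cumPr_last (hcf : IsChoice cf) (k : Fin n) : cumPr M v (cf k) M = 1 := by
  unfold cumPr
  rw [cumEx_last, ex_one, hcf.sum_eq]

theorem IsChoice.cumPr_nonneg (hcf : IsChoice cf) (k : Fin n) (j : ℕ) : 0 ≤ cumPr M v (cf k) j :=
  AssortmentOpt.cumPr_nonneg (hcf.pr_nonneg k) j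

theorem IsChoice.cumPr_le_succ (hcf : IsChoice cf) (hv : IsProfile M v) (k : Fin n) (j : ℕ) :
    cumPr M v (cf k) j ≤ cumPr M v (cf k) (j + 1) :=
  hv.cumPr_le_succ (hcf.pr_nonneg k) j

theorem IsChoice.condPr_nonneg (hcf : IsChoice cf) (hv : IsProfile M v) (k : Fin n) (j : ℕ) :
    0 ≤ condPr M v (cf k) j :=
  div_nonneg (sub_nonneg.2 (hcf.cumPr_le_succ hv k j)) (hcf.cumPr_nonneg k _)

theorem IsChoice.condPr_le_one (hcf : IsChoice cf) (k : Fin n) (j : ℕ) :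
    condPr M v (cf k) j ≤ 1 :=
  div_le_one_of_le₀ (by linarith [hcf.cumPr_nonneg (M := M) (v := v) k j]) (hcf.cumPr_nonneg k _)

/-- The chain rule for conditional probabilities. If the condition has probability 0, so has the
smaller event, and the value given to the quotient is irrelevant. -/
theorem IsChoice.cumPr_eq_mul (hcf : IsChoice cf) (hv : IsProfile M v) (k : Fin n) (j : ℕ) :
    cumPr M v (cf k) j = cumPr M v (cf k) (j + 1) * (1 - condPr M v (cf k) j) := by
  unfold condPr
  have h1 := hcf.cumPr_le_succ hv k j
  have h0 := hcf.cumPr_nonneg (M := M) (v := v) k j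
  rcases (hcf.cumPr_nonneg (M := M) (v := v) k (j + 1)).eq_or_lt with h | h
  · rw [← h] at h1 ⊢
    rw [zero_mul]; exact le_antisymm h1 h0
  · field_simp; ring

/-- The probability that all agent utilities lie below the boundary number `j`. -/
def allPr (M : ℕ) (v : ℕ → WithBot ℚ) (cf : Fin n → Config) (j : ℕ) : ℚ :=
  ∏ k, cumPr M v (cf k) j

/-- Downward induction from P_M = 1: with s the sum of conditional probabilities, P_j ≥ P_{j+1}(1 -
s) and s ≤ 1/(j - 3), so the bounds telescope as (j - 3)/(M - 1) · (j - 4)/(j - 3). The term 1/M² in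
the hypothesis is the rounding error of the dynamic program. -/
theorem IsChoice.allPr_ge (hcf : IsChoice cf) (hv : IsProfile M v)
    (hup : ∀ j, 1 ≤ j → j < M →
      ∑ k, condPr M v (cf k) j ≤ (1 + 1 / (M : ℚ)) / j + 1 / (M : ℚ) ^ 2) :
    ∀ d j, j + d = M → 5 ≤ j → ((j : ℚ) - 4) / ((M : ℚ) - 1) ≤ allPr M v cf j := by
  intro d
  induction d with
  | zero =>
    intro j hj h5
    have hjM : j = M := by omega
    subst hjM
    have : allPr j v cf j = 1 := by simp [allPr, hcf.cumPr_last]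
    rw [this]
    have : (5 : ℚ) ≤ j := by exact_mod_cast h5
    rw [div_le_one (by linarith)]
    linarith
  | succ d ih =>
    intro j hj h5
    have h1 := ih (j + 1) (by omega) (by omega)
    have hj5 : (5 : ℚ) ≤ j := by exact_mod_cast h5
    have hjM : (j : ℚ) + 1 ≤ M := by
      have : j + 1 ≤ M := by omega
      exact_mod_cast this
    have hM : (6 : ℚ) ≤ M := by linarith
    set s := ∑ k, condPr M v (cf k) j with hs
    have h2 : allPr M v cf (j + 1) * (1 - s) ≤ allPr M v cf j := by
      have h3 : allPr M v cf j = allPr M v cf (j + 1) * ∏ k, (1 - condPr M v (cf k) j) := by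
        unfold allPr
        rw [← Finset.prod_mul_distrib]
        exact Finset.prod_congr rfl fun k _ => hcf.cumPr_eq_mul hv k j
      rw [h3]
      refine mul_le_mul_of_nonneg_left ?_ (Finset.prod_nonneg fun k _ => hcf.cumPr_nonneg k _)
      exact one_sub_sum_le_prod _ _ (fun k _ => hcf.condPr_nonneg hv k j)
        fun k _ => hcf.condPr_le_one k j
    have h4 := hup j (by omega) (by omega)
    -- After multiplication with j - 3 and division by j, the two error terms add at most 1 each to
    -- the numerator, which the shift by 3 absorbs.
    have h5' : ((j : ℚ) - 3) * s ≤ 1 := by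
      have h6 : ((j : ℚ) - 3) * s ≤
          ((j : ℚ) - 3) * ((1 + 1 / (M : ℚ)) / j + 1 / (M : ℚ) ^ 2) :=
        mul_le_mul_of_nonneg_left h4 (by linarith)
      refine h6.trans ?_
      have h7 : ((j : ℚ) - 3) * ((1 + 1 / (M : ℚ)) / j + 1 / (M : ℚ) ^ 2) =
          (((j : ℚ) - 3) + ((j : ℚ) - 3) / M + (j / M) * (((j : ℚ) - 3) / M)) / j := by
        field_simp
      rw [h7, div_le_one (by linarith)]
      have h8 : ((j : ℚ) - 3) / M ≤ 1 := by rw [div_le_one (by linarith)]; linarith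
      have h9 : (j : ℚ) / M ≤ 1 := by rw [div_le_one (by linarith)]; linarith
      have h10 : 0 ≤ ((j : ℚ) - 3) / M := div_nonneg (by linarith) (by linarith)
      have h11 : (j / M) * (((j : ℚ) - 3) / M) ≤ 1 := mul_le_one₀ h9 h10 h8
      linarith
    have hs1 : 0 ≤ 1 - s := by nlinarith
    refine le_trans ?_ h2
    refine le_trans ?_ (mul_le_mul_of_nonneg_right h1 hs1)
    push_cast
    rw [div_mul_eq_mul_div]
    refine div_le_div_of_nonneg_right ?_ (by linarith)
    nlinarith

theorem prod_cdf_mono (hcf : IsChoice cf) (T : Finset (Fin n)) {u w : WithBot ℚ} (h : u ≤ w) :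
    ∏ l ∈ T, cdf (cf l) u ≤ ∏ l ∈ T, cdf (cf l) w :=
  Finset.prod_le_prod (fun l _ => cdf_nonneg (hcf.pr_nonneg l) u)
    fun l _ => cdf_mono (hcf.pr_nonneg l) h

theorem IsChoice.binUtil_nonneg (hcf : IsChoice cf) (hv : IsProfile M v) (k : Fin n) (j : ℕ) :
    0 ≤ binUtil M v (cf k) j :=
  div_nonneg (hv.bin_nonneg (hcf.pr_nonneg k) j (hcf.uP_nonneg k)) (hcf.cumPr_nonneg k _)

theorem IsChoice.binUtil_mul_le (hcf : IsChoice cf) (hv : IsProfile M v) (k : Fin n) (j : ℕ) :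
    binUtil M v (cf k) j * cumPr M v (cf k) (j + 1) ≤
      cumEx M v (cf k) Mass.uP (j + 1) - cumEx M v (cf k) Mass.uP j := by
  unfold binUtil
  rcases eq_or_ne (cumPr M v (cf k) (j + 1)) 0 with h | h
  · rw [h, mul_zero]
    exact hv.bin_nonneg (hcf.pr_nonneg k) j (hcf.uP_nonneg k)
  · rw [div_mul_cancel₀ _ h]

/-- A solution that satisfies the upper bounds has at least its objective value as utility. -/
theorem IsChoice.objective_le_utility (hcf : IsChoice cf) (hv : IsProfile M v)
    (hup : ∀ j, 1 ≤ j → j < M →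
      ∑ k, condPr M v (cf k) j ≤ (1 + 1 / (M : ℚ)) / j + 1 / (M : ℚ) ^ 2) :
    ∑ k, objective M v (cf k) ≤ utility cf := by
  unfold utility
  refine Finset.sum_le_sum fun k _ => ?_
  rw [sum_bins hv]
  unfold objective
  refine Finset.sum_le_sum fun j hj => ?_
  have hjM := Finset.mem_range.1 hj
  have hh : ∀ t ∈ cf k, 0 ≤ ∏ l ∈ Finset.univ.erase k, cdf (cf l) t.uA := fun t _ =>
    Finset.prod_nonneg fun l _ => cdf_nonneg (hcf.pr_nonneg l) _
  unfold coeff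
  split
  · rename_i h5
    -- H is the probability that the other actions lie below the lower end of the bin, a lower bound
    -- for winning from any point of the bin. Together with the factor of action k it gives `allPr`,
    -- which dominates the coefficient.
    set H := ∏ l ∈ Finset.univ.erase k, cumPr M v (cf l) j with hH
    have hH0 : 0 ≤ H := Finset.prod_nonneg fun l _ => hcf.cumPr_nonneg l _
    have h1 : (cumEx M v (cf k) Mass.uP (j + 1) - cumEx M v (cf k) Mass.uP j) * H ≤
        cumEx M v (cf k) (fun t => t.uP * ∏ l ∈ Finset.univ.erase k, cdf (cf l) t.uA) (j + 1) -
        cumEx M v (cf k) (fun t => t.uP * ∏ l ∈ Finset.univ.erase k, cdf (cf l) t.uA) j := by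
      have h2 := hv.bin_mono (c := cf k) (f := fun t => t.uP * H)
        (g := fun t => t.uP * ∏ l ∈ Finset.univ.erase k, cdf (cf l) t.uA) (hcf.pr_nonneg k) j
        (fun t ht hvt _ => by
          refine mul_le_mul_of_nonneg_left ?_ (hcf.uP_nonneg k t ht)
          rw [hH]
          simp only [cumPr_eq_cdf hjM]
          exact prod_cdf_mono hcf _ hvt)
      refine le_trans (le_of_eq ?_) h2
      rw [hv.cumEx_succ_sub, hv.cumEx_succ_sub, ← ex_mul_const]
      refine ex_congr fun t _ => ?_
      split <;> simp
    refine le_trans ?_ h1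
    refine le_trans ?_ (mul_le_mul_of_nonneg_right (hcf.binUtil_mul_le hv k j) hH0)
    rw [mul_comm, mul_assoc]
    refine mul_le_mul_of_nonneg_left ?_ (hcf.binUtil_nonneg hv k j)
    have h3 := hcf.allPr_ge hv hup (M - j) j (by omega) h5
    refine h3.trans ?_
    unfold allPr
    rw [← Finset.mul_prod_erase _ _ (Finset.mem_univ k)]
    exact mul_le_mul_of_nonneg_right (hcf.cumPr_le_succ hv k j) hH0
  · rw [zero_mul]
    exact hv.bin_nonneg (hcf.pr_nonneg k) j fun t ht =>
      mul_nonneg (hcf.uP_nonneg k t ht) (hh t ht)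

end

/-! ### The loss of the approximate objective -/

/-- Chebyshev's correlation inequality: a nondecreasing function has a smaller mean below a
threshold than overall. The proof compares two independent copies, one below and one not below the
threshold. -/
theorem cumEx_le_cumPr_mul {M : ℕ} {v : ℕ → WithBot ℚ} {c : Config} {a : Mass → ℚ}
    (hc : ∀ t ∈ c, 0 ≤ t.pr) (hs : (c.map Mass.pr).sum = 1)
    (ha : ∀ s ∈ c, ∀ t ∈ c, s.uA < t.uA → a s ≤ a t) (j : ℕ) :
    cumEx M v c a j ≤ cumPr M v c j * ex c a := by
  set X := cumEx M v c a j with hX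
  set P := cumPr M v c j with hP
  set Y := ex c (fun t => if Below M v j t.uA then 0 else a t) with hY
  set Q := ex c (fun t => if Below M v j t.uA then 0 else 1) with hQ
  have h1 : X + Y = ex c a := by
    rw [hX, hY, cumEx, ← ex_add]
    refine ex_congr fun t _ => ?_
    split <;> simp
  have h2 : P + Q = 1 := by
    rw [← hs, ← ex_one, hP, hQ, cumPr, cumEx, ← ex_add]
    refine ex_congr fun t _ => ?_
    split <;> simp
  have h3 : X * Q ≤ P * Y := by
    have e1 : X * Q = ex c fun s => ex c fun t =>
        (if Below M v j s.uA then a s else 0) * (if Below M v j t.uA then 0 else 1) := by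
      simp only [ex_const_mul]
      rw [ex_mul_const]; rfl
    have e2 : P * Y = ex c fun s => ex c fun t =>
        (if Below M v j s.uA then 1 else 0) * (if Below M v j t.uA then 0 else a t) := by
      simp only [ex_const_mul]
      rw [ex_mul_const]; rfl
    rw [e1, e2]
    refine ex_mono hc fun s hs => ex_mono hc fun t ht => ?_
    by_cases h1 : Below M v j s.uA
    · by_cases h2 : Below M v j t.uA
      · simp [h2]
      · simp only [h1, h2, if_true, if_false, mul_one, one_mul]
        refine ha s hs t ht ?_
        unfold Below at h1 h2
        push Not at h2
        exact (h1 h2.1).trans_le h2.2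
    · simp [h1]
  have h4 : Q = 1 - P := by linarith
  rw [h4] at h3
  rw [← h1]
  linarith

/-- Summation by parts. -/
theorem sum_le_of_increments (p A w : ℕ → ℝ) (T q : ℝ) (M : ℕ) (hT : 0 ≤ T) (hq : 0 ≤ q)
    (hp : ∀ j, 1 ≤ j → j ≤ M → 0 < p j) (hmono : ∀ j, p j ≤ p (j + 1))
    (hA0 : 0 ≤ A 1) (hA : ∀ j, A j ≤ p j * T)
    (hw : ∀ j, 1 ≤ j → j < M → w j * √(p (j + 1)) ≤ q * (A (j + 1) - A j)) :
    ∀ m, m + 1 ≤ M → ∑ j ∈ Finset.Ico 1 (m + 1), w j ≤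
      q * (A (m + 1) / √(p (m + 1)) + T * √(p (m + 1))) := by
  intro m
  induction m with
  | zero =>
    intro hm
    simp only [zero_add, Finset.Ico_self, Finset.sum_empty]
    positivity
  | succ m ih =>
    intro hm
    rw [Finset.sum_Ico_succ_top (by omega)]
    have h1 := ih (by omega)
    have h2 := hw (m + 1) (by omega) (by omega)
    set x := √(p (m + 1)) with hx
    set y := √(p (m + 1 + 1)) with hy
    have hp1 := hp (m + 1) (by omega) (by omega)
    have hp2 := hp (m + 1 + 1) (by omega) (by omega)
    have hx0 : 0 < x := Real.sqrt_pos.2 hp1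
    have hy0 : 0 < y := Real.sqrt_pos.2 hp2
    have hxy : x ≤ y := Real.sqrt_le_sqrt (hmono _)
    have hxx : x * x = p (m + 1) := Real.mul_self_sqrt hp1.le
    have h3 : w (m + 1) ≤ q * (A (m + 1 + 1) - A (m + 1)) / y := by
      rw [le_div_iff₀ hy0]; exact h2
    -- Passing from 1/x to 1/y in the potential costs A(y - x)/(xy). As A ≤ x²T and x ≤ y, the
    -- increment T(y - x) of the second term of the potential pays for it.
    have h4 : A (m + 1) / x - A (m + 1) / y ≤ T * (y - x) := by
      have h5 : A (m + 1) / x - A (m + 1) / y = A (m + 1) * (y - x) / (x * y) := by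
        field_simp
      rw [h5, div_le_iff₀ (by positivity)]
      have h6 := hA (m + 1)
      rw [← hxx] at h6
      have h7 : A (m + 1) * (y - x) ≤ x * x * T * (y - x) :=
        mul_le_mul_of_nonneg_right h6 (by linarith)
      have h8 : x * x * T * (y - x) ≤ x * y * T * (y - x) := by
        refine mul_le_mul_of_nonneg_right ?_ (by linarith)
        refine mul_le_mul_of_nonneg_right ?_ hT
        exact mul_le_mul_of_nonneg_left hxy hx0.le
      linarith
    have h9 : q * (A (m + 1 + 1) - A (m + 1)) / y = q * (A (m + 1 + 1) / y) - q * (A (m + 1) / y) := by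
      ring
    rw [h9] at h3
    have h10 := mul_le_mul_of_nonneg_left h4 hq
    linarith

section

variable {n M : ℕ} {v : ℕ → WithBot ℚ} {cf : Fin n → Config}

/-- The factor by which the other actions, each of them being active with probability `1 / 2`,
reduce the utility. -/
def halfPr (cf : Fin n → Config) (i : Fin n) (u : WithBot ℚ) : ℚ :=
  ∏ k ∈ Finset.univ.erase i, (1 + cdf (cf k) u) / 2

/-- The expected utility of action `i` if the other actions are active with probability `1 / 2`. -/
def halfUtil (cf : Fin n → Config) (i : Fin n) : ℚ := ex (cf i) fun t => t.uP * halfPr cf i t.uA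

theorem IsChoice.halfPr_nonneg (hcf : IsChoice cf) (i : Fin n) (u : WithBot ℚ) :
    0 ≤ halfPr cf i u :=
  Finset.prod_nonneg fun k _ => by linarith [cdf_nonneg (hcf.pr_nonneg k) u]

theorem IsChoice.halfPr_mono (hcf : IsChoice cf) (i : Fin n) {u w : WithBot ℚ} (h : u ≤ w) :
    halfPr cf i u ≤ halfPr cf i w :=
  Finset.prod_le_prod (fun k _ => by linarith [cdf_nonneg (hcf.pr_nonneg k) u])
    fun k _ => by linarith [cdf_mono (hcf.pr_nonneg k) h]

/-- Factorwise this is c ≤ ((1 + c)/2)², that is, (1 - c)² ≥ 0. Removing each competitor with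
probability 1/2 thus raises a winning probability x to at least √x; this square root is the source
of the error 1/√M. -/
theorem IsChoice.prod_cdf_le_halfPr_sq (cf : Fin n → Config) (hcf : IsChoice cf) (i : Fin n)
    (u : WithBot ℚ) : ∏ k ∈ Finset.univ.erase i, cdf (cf k) u ≤ halfPr cf i u ^ 2 := by
  unfold halfPr
  rw [← Finset.prod_pow]
  refine Finset.prod_le_prod (fun k _ => cdf_nonneg (hcf.pr_nonneg k) u) fun k _ => ?_
  nlinarith [sq_nonneg (1 - cdf (cf k) u)]

theorem IsChoice.allPr_eq (i : Fin n) (j : ℕ) : allPr M v cf j =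
    cumPr M v (cf i) j * ∏ k ∈ Finset.univ.erase i, cumPr M v (cf k) j :=
  (Finset.mul_prod_erase _ _ (Finset.mem_univ i)).symm

theorem IsChoice.cumPr_le_one (hcf : IsChoice cf) (i : Fin n) (j : ℕ) :
    cumPr M v (cf i) j ≤ 1 := by
  rw [← hcf.sum_eq i, ← ex_one]
  refine ex_mono (hcf.pr_nonneg i) fun t _ => ?_
  split <;> norm_num

/-- Properties of a choice and a profile of bin boundaries that splits the distribution of the
maximum agent utility evenly. -/
structure IsEven (M : ℕ) (v : ℕ → WithBot ℚ) (cf : Fin n → Config) : Prop where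
  choice : IsChoice cf
  profile : IsProfile M v
  le : ∀ j ≤ M, (j : ℚ) / M ≤ allPr M v cf j
  ge : ∀ j ≤ M, allPr M v cf j ≤ (j : ℚ) / M + 1 / (M : ℚ) ^ 2

theorem IsEven.cumPr_pos (h : IsEven M v cf) (i : Fin n) {j : ℕ} (hj : 1 ≤ j) (hjM : j ≤ M) :
    0 < cumPr M v (cf i) j := by
  have h1 : (0 : ℚ) < allPr M v cf j := by
    refine lt_of_lt_of_le ?_ (h.le j hjM)
    have : (0 : ℚ) < j := by exact_mod_cast hj
    have : (0 : ℚ) < M := by exact_mod_cast h.profile.pos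
    positivity
  refine lt_of_le_of_ne (h.choice.cumPr_nonneg i j) fun h0 => ?_
  rw [IsChoice.allPr_eq i, ← h0, zero_mul] at h1
  exact lt_irrefl _ h1

theorem IsEven.halfUtil_nonneg (h : IsEven M v cf) (i : Fin n) : 0 ≤ halfUtil cf i :=
  ex_nonneg (h.choice.pr_nonneg i) fun t ht =>
    mul_nonneg (h.choice.uP_nonneg i t ht) (h.choice.halfPr_nonneg i _)

/-- Both the principal utility and the factor `halfPr` are nondecreasing in the agent utility, so
their product is correlated with it in the right direction. -/
theorem IsEven.cumEx_half_le (h : IsEven M v cf) (i : Fin n)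
    (hmono : ∀ s ∈ cf i, ∀ t ∈ cf i, s.uA < t.uA → s.uP ≤ t.uP) (j : ℕ) :
    cumEx M v (cf i) (fun t => t.uP * halfPr cf i t.uA) j ≤
      cumPr M v (cf i) j * halfUtil cf i := by
  refine cumEx_le_cumPr_mul (h.choice.pr_nonneg i) (h.choice.sum_eq i) (fun s hs t ht hst => ?_) j
  exact mul_le_mul (hmono s hs t ht hst) (h.choice.halfPr_mono i hst.le)
    (h.choice.halfPr_nonneg i _) (h.choice.uP_nonneg i t ht)

/-- Inside the first bin the winning probability x is at most H, of order 1/(MP), and at most the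
square of `halfPr`; so x is at most √H times `halfPr`. The correlation inequality supplies the
factor P that cancels the P in the denominator. The integer square root of M keeps everything
rational. -/
theorem IsEven.first_bin (h : IsEven M v cf) (i : Fin n) (hM : 1 < M)
    (hmono : ∀ s ∈ cf i, ∀ t ∈ cf i, s.uA < t.uA → s.uP ≤ t.uP) :
    cumEx M v (cf i) (fun t => t.uP * ∏ k ∈ Finset.univ.erase i, cdf (cf k) t.uA) 1 ≤
      2 / (Nat.sqrt M : ℚ) * halfUtil cf i := by
  set m : ℚ := (Nat.sqrt M : ℚ) with hm
  have hm0 : 0 < m := by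
    have : 0 < Nat.sqrt M := Nat.sqrt_pos.2 (by omega)
    rw [hm]
    exact_mod_cast this
  have hmM : m ^ 2 ≤ M := by
    have := Nat.sqrt_le' M
    rw [hm]
    exact_mod_cast this
  set P := cumPr M v (cf i) 1 with hP
  have hP0 : 0 < P := h.cumPr_pos i le_rfl (by omega)
  have hP1 : P ≤ 1 := h.choice.cumPr_le_one i 1
  set H := ∏ k ∈ Finset.univ.erase i, cumPr M v (cf k) 1 with hH
  have hH0 : 0 ≤ H := Finset.prod_nonneg fun k _ => h.choice.cumPr_nonneg k 1
  have hPH : P * H ≤ 2 / m ^ 2 := by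
    have h1 := h.ge 1 (by omega)
    rw [IsChoice.allPr_eq i] at h1
    refine h1.trans ?_
    have hM1 : (1 : ℚ) ≤ M := by exact_mod_cast hM.le
    have h2 : 1 / (M : ℚ) ^ 2 ≤ 1 / M := by
      refine one_div_le_one_div_of_le (by linarith) ?_
      nlinarith
    have h3 : 1 / (M : ℚ) ≤ 1 / m ^ 2 := one_div_le_one_div_of_le (by positivity) hmM
    push_cast
    calc 1 / (M : ℚ) + 1 / (M : ℚ) ^ 2 ≤ 1 / m ^ 2 + 1 / m ^ 2 := by linarith
      _ = 2 / m ^ 2 := by ring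
  -- A rational upper bound for √H: H ≤ 2/(m²P) ≤ 4/(m²P²), using P ≤ 1.
  set r := 2 / m / P with hr
  have hr0 : 0 < r := by positivity
  have hr2 : H ≤ r ^ 2 := by
    have h1 : r ^ 2 = 4 / m ^ 2 / P ^ 2 := by rw [hr]; field_simp; norm_num
    rw [h1, le_div_iff₀ (by positivity)]
    have h2 : 0 ≤ P * H := by positivity
    have h3 : (2 : ℚ) / m ^ 2 ≤ 4 / m ^ 2 := by gcongr; norm_num
    nlinarith
  have hle : ∀ t : Mass, t.uA < v 1 →
      ∏ k ∈ Finset.univ.erase i, cdf (cf k) t.uA ≤ r * halfPr cf i t.uA := by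
    intro t ht
    set x := ∏ k ∈ Finset.univ.erase i, cdf (cf k) t.uA with hx
    have hx0 : 0 ≤ x := Finset.prod_nonneg fun k _ => cdf_nonneg (h.choice.pr_nonneg k) _
    have hg0 := h.choice.halfPr_nonneg i t.uA
    have hxH : x ≤ H := by
      rw [hH]
      simp only [cumPr_eq_cdf hM]
      exact prod_cdf_mono h.choice _ ht.le
    have hxg := IsChoice.prod_cdf_le_halfPr_sq cf h.choice i t.uA
    rw [← hx] at hxg
    have h1 : x ^ 2 ≤ (r * halfPr cf i t.uA) ^ 2 := by
      rw [mul_pow, sq x]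
      exact mul_le_mul (hxH.trans hr2) hxg hx0 (by positivity)
    exact (pow_le_pow_iff_left₀ hx0 (by positivity) two_ne_zero).1 h1
  have h1 : cumEx M v (cf i) (fun t => t.uP * ∏ k ∈ Finset.univ.erase i, cdf (cf k) t.uA) 1 ≤
      r * cumEx M v (cf i) (fun t => t.uP * halfPr cf i t.uA) 1 := by
    unfold cumEx
    rw [← ex_const_mul]
    refine ex_mono (h.choice.pr_nonneg i) fun t ht => ?_
    split
    · rename_i hb
      have := mul_le_mul_of_nonneg_left (hle t (hb hM)) (h.choice.uP_nonneg i t ht)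
      linarith
    · simp
  refine h1.trans ((mul_le_mul_of_nonneg_left (h.cumEx_half_le i hmono 1) hr0.le).trans ?_)
  refine le_of_eq ?_
  rw [← mul_assoc, hr, div_mul_cancel₀ _ hP0.ne']

/-- Let A_j be the part of `halfUtil` below boundary j and p_j the probability of lying below it.
Bin j + 1 satisfies w_j √p_{j+1} ≤ √M (A_{j+1} - A_j), and A_j ≤ p_j A_M by correlation; summation
by parts removes the weights √p at the price of a factor 2. -/
theorem IsEven.sum_binUtil_le (h : IsEven M v cf) (i : Fin n)
    (hmono : ∀ s ∈ cf i, ∀ t ∈ cf i, s.uA < t.uA → s.uP ≤ t.uP) :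
    ((∑ j ∈ Finset.Ico 1 M, binUtil M v (cf i) j : ℚ) : ℝ) ≤ 2 * √(M : ℝ) * (halfUtil cf i : ℝ) := by
  set a : Mass → ℚ := fun t => t.uP * halfPr cf i t.uA with ha
  have hM0 : (0 : ℚ) < M := by exact_mod_cast h.profile.pos
  have hw : ∀ j, 1 ≤ j → j < M →
      (binUtil M v (cf i) j : ℝ) * √((cumPr M v (cf i) (j + 1) : ℚ) : ℝ) ≤
        √(M : ℝ) * (((cumEx M v (cf i) a (j + 1) : ℚ) : ℝ) - ((cumEx M v (cf i) a j : ℚ) : ℝ)) := by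
    intro j hj hjM
    set γ := halfPr cf i (v j) with hγ
    have hγ0 : 0 ≤ γ := h.choice.halfPr_nonneg i _
    set p := cumPr M v (cf i) (j + 1) with hp
    have hp0 : 0 < p := h.cumPr_pos i (by omega) (by omega)
    set w := binUtil M v (cf i) j with hw
    have hw0 : 0 ≤ w := h.choice.binUtil_nonneg h.profile i j
    have h1 : w * p * γ ≤ cumEx M v (cf i) a (j + 1) - cumEx M v (cf i) a j := by
      refine (mul_le_mul_of_nonneg_right (h.choice.binUtil_mul_le h.profile i j) hγ0).trans ?_
      have h2 := h.profile.bin_mono (c := cf i) (f := fun t => t.uP * γ) (g := a)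
        (h.choice.pr_nonneg i) j (fun t ht hvt _ =>
          mul_le_mul_of_nonneg_left (h.choice.halfPr_mono i hvt) (h.choice.uP_nonneg i t ht))
      refine le_trans (le_of_eq ?_) h2
      rw [h.profile.cumEx_succ_sub, h.profile.cumEx_succ_sub, ← ex_mul_const]
      refine ex_congr fun t _ => ?_
      split <;> simp
    -- From 1/M ≤ j/M ≤ P_j ≤ pγ². This is where j ≥ 1 is needed, and why the first bin is treated
    -- separately.
    have h3 : 1 ≤ γ ^ 2 * p * M := by
      have h4 := IsChoice.prod_cdf_le_halfPr_sq cf h.choice i (v j)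
      simp only [← cumPr_eq_cdf hjM] at h4
      have h5 := h.le j hjM.le
      rw [IsChoice.allPr_eq i] at h5
      have h6 : cumPr M v (cf i) j * ∏ k ∈ Finset.univ.erase i, cumPr M v (cf k) j ≤ p * γ ^ 2 :=
        mul_le_mul (h.choice.cumPr_le_succ h.profile i j) h4
          (Finset.prod_nonneg fun k _ => h.choice.cumPr_nonneg k j) hp0.le
      have h7 := h5.trans h6
      rw [div_le_iff₀ hM0] at h7
      have h8 : (1 : ℚ) ≤ j := by exact_mod_cast hj
      linarith
    have h1' : (w : ℝ) * p * γ ≤ (cumEx M v (cf i) a (j + 1) : ℝ) - (cumEx M v (cf i) a j : ℝ) := by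
      exact_mod_cast h1
    have h3' : (1 : ℝ) ≤ (γ : ℝ) ^ 2 * p * M := by exact_mod_cast h3
    have hp0' : (0 : ℝ) < p := by exact_mod_cast hp0
    have hw0' : (0 : ℝ) ≤ w := by exact_mod_cast hw0
    have hγ0' : (0 : ℝ) ≤ γ := by exact_mod_cast hγ0
    have h9 : 1 ≤ √(M : ℝ) * √(p : ℝ) * γ := by
      have h10 : √(M : ℝ) * √(p : ℝ) * γ = √((γ : ℝ) ^ 2 * p * M) := by
        rw [Real.sqrt_mul (by positivity), Real.sqrt_mul (by positivity), Real.sqrt_sq hγ0']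
        ring
      rw [h10]
      exact Real.one_le_sqrt.2 h3'
    have h11 : (w : ℝ) * √(p : ℝ) ≤ √(M : ℝ) * ((w : ℝ) * p * γ) := by
      have h12 : √(M : ℝ) * ((w : ℝ) * p * γ) =
          (w : ℝ) * √(p : ℝ) * (√(M : ℝ) * √(p : ℝ) * γ) := by
        have := Real.mul_self_sqrt hp0'.le
        calc √(M : ℝ) * ((w : ℝ) * p * γ) = √(M : ℝ) * ((w : ℝ) * (√(p : ℝ) * √(p : ℝ)) * γ) := by
              rw [this]
          _ = _ := by ring
      rw [h12]
      exact le_mul_of_one_le_right (by positivity) h9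
    exact h11.trans (mul_le_mul_of_nonneg_left h1' (Real.sqrt_nonneg _))
  have hT0 : (0 : ℝ) ≤ (halfUtil cf i : ℝ) := by exact_mod_cast h.halfUtil_nonneg i
  have key := sum_le_of_increments (fun j => ((cumPr M v (cf i) j : ℚ) : ℝ))
    (fun j => ((cumEx M v (cf i) a j : ℚ) : ℝ)) (fun j => ((binUtil M v (cf i) j : ℚ) : ℝ))
    (halfUtil cf i : ℝ) (√(M : ℝ)) M hT0 (Real.sqrt_nonneg _)
    (fun j h1 h2 => by exact_mod_cast h.cumPr_pos i h1 h2)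
    (fun j => by exact_mod_cast h.choice.cumPr_le_succ h.profile i j)
    (by
      have : 0 ≤ cumEx M v (cf i) a 1 := ex_nonneg (h.choice.pr_nonneg i) fun t ht => by
        have := mul_nonneg (h.choice.uP_nonneg i t ht) (h.choice.halfPr_nonneg i t.uA)
        split
        · exact this
        · exact le_rfl
      exact_mod_cast this)
    (fun j => by exact_mod_cast h.cumEx_half_le i hmono j) hw (M - 1)
    (by have := h.profile.pos; omega)
  have e : M - 1 + 1 = M := by have := h.profile.pos; omega
  rw [e] at key
  -- At the end p_M = 1 and A_M is `halfUtil`, so both terms of the potential equal `halfUtil`.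
  simp only [h.choice.cumPr_last, cumEx_last, Rat.cast_one, Real.sqrt_one, div_one, mul_one] at key
  push_cast
  refine key.trans (le_of_eq ?_)
  have : ex (cf i) a = halfUtil cf i := rfl
  rw [this]; ring

/-- The distance between (j + 1)/M and (j - 4)/(M - 1) is at most 5/M, and evenness adds 1/M² ≤ 1/M.
For j < 5 the coefficient is 0, but (j + 1)/M ≤ 5/M. -/
theorem IsEven.allPr_succ_le_coeff (h : IsEven M v cf) (hM : 1 < M) {j : ℕ} (hj : j < M) :
    allPr M v cf (j + 1) ≤ coeff M j + 6 / M := by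
  refine (h.ge (j + 1) hj).trans ?_
  have hM1 : (1 : ℚ) < M := by exact_mod_cast hM
  have h2 : 1 / (M : ℚ) ^ 2 ≤ 1 / M := by
    refine one_div_le_one_div_of_le (by linarith) ?_
    nlinarith
  unfold coeff
  split
  · rename_i h5
    have h5' : (5 : ℚ) ≤ j := by exact_mod_cast h5
    have h3 : ((j : ℚ) - 4) / M ≤ ((j : ℚ) - 4) / ((M : ℚ) - 1) :=
      div_le_div_of_nonneg_left (by linarith) (by linarith) (by linarith)
    have h4 : ((j + 1 : ℕ) : ℚ) / M = ((j : ℚ) - 4) / M + 5 / M := by push_cast; ring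
    have h6 : (6 : ℚ) / M = 5 / M + 1 / M := by ring
    linarith
  · rename_i h5
    have h5' : ((j + 1 : ℕ) : ℚ) ≤ 5 := by
      have : j + 1 ≤ 5 := by omega
      exact_mod_cast this
    have h3 : ((j + 1 : ℕ) : ℚ) / M ≤ 5 / M := by gcongr
    have h6 : (6 : ℚ) / M = 5 / M + 1 / M := by ring
    linarith

/-- Within bin j + 1 the winning probability is bounded by its value at the upper end. This makes
the contribution at most `binUtil` times P_{j+1}, and P_{j+1} exceeds the coefficient by at most
6/M. -/
theorem IsEven.utility_item_le (h : IsEven M v cf) (hM : 1 < M) (i : Fin n)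
    (hmono : ∀ s ∈ cf i, ∀ t ∈ cf i, s.uA < t.uA → s.uP ≤ t.uP) :
    ex (cf i) (fun t => t.uP * ∏ k ∈ Finset.univ.erase i, cdf (cf k) t.uA) ≤
      2 / (Nat.sqrt M : ℚ) * halfUtil cf i + objective M v (cf i) +
        6 / M * ∑ j ∈ Finset.Ico 1 M, binUtil M v (cf i) j := by
  rw [sum_bins h.profile, Finset.range_eq_Ico, Finset.sum_eq_sum_Ico_succ_bot (by omega : 0 < M)]
  rw [h.profile.cumEx_zero, sub_zero, add_assoc]
  refine add_le_add (h.first_bin i hM hmono) ?_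
  unfold objective
  rw [Finset.range_eq_Ico, Finset.sum_eq_sum_Ico_succ_bot (by omega : 0 < M), Finset.mul_sum]
  have : coeff M 0 = 0 := by simp [coeff]
  rw [this, zero_mul]
  simp only [zero_add]
  rw [← Finset.sum_add_distrib]
  refine Finset.sum_le_sum fun j hj => ?_
  rw [Finset.mem_Ico] at hj
  set H := ∏ k ∈ Finset.univ.erase i, cumPr M v (cf k) (j + 1) with hH
  have h2 := h.profile.bin_mono (c := cf i)
    (f := fun t => t.uP * ∏ k ∈ Finset.univ.erase i, cdf (cf k) t.uA) (g := fun t => t.uP * H)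
    (h.choice.pr_nonneg i) j (fun t ht _ hvt => by
      refine mul_le_mul_of_nonneg_left ?_ (h.choice.uP_nonneg i t ht)
      refine Finset.prod_le_prod (fun k _ => cdf_nonneg (h.choice.pr_nonneg k) _) fun k _ => ?_
      by_cases hj1 : j + 1 < M
      · rw [cumPr_eq_cdf hj1]
        exact cdf_mono (h.choice.pr_nonneg k) (hvt hj1).le
      · have : j + 1 = M := by omega
        rw [this, h.choice.cumPr_last]
        exact cdf_le_one (h.choice.pr_nonneg k) (h.choice.sum_eq k) _)
  refine h2.trans ?_
  have h3 : cumEx M v (cf i) (fun t => t.uP * H) (j + 1) - cumEx M v (cf i) (fun t => t.uP * H) j =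
      binUtil M v (cf i) j * allPr M v cf (j + 1) := by
    rw [IsChoice.allPr_eq i, ← hH, ← mul_assoc, binUtil,
      div_mul_cancel₀ _ (h.cumPr_pos i (by omega) (by omega)).ne',
      h.profile.cumEx_succ_sub, h.profile.cumEx_succ_sub, ← ex_mul_const]
    refine ex_congr fun t _ => ?_
    split <;> simp
  rw [h3]
  have h4 := mul_le_mul_of_nonneg_left (h.allPr_succ_le_coeff hM hj.2)
    (h.choice.binUtil_nonneg h.profile i j)
  linarith

/-- The utility exceeds the approximate objective by a multiple of the sum of the `halfUtil`. -/
theorem IsEven.utility_le (h : IsEven M v cf) (hM : 1 < M)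
    (hmono : ∀ i, ∀ s ∈ cf i, ∀ t ∈ cf i, s.uA < t.uA → s.uP ≤ t.uP) :
    (utility cf : ℝ) ≤ ((∑ i, objective M v (cf i) : ℚ) : ℝ) +
      16 / √(M : ℝ) * ((∑ i, halfUtil cf i : ℚ) : ℝ) := by
  unfold utility
  push_cast
  rw [Finset.mul_sum, ← Finset.sum_add_distrib]
  refine Finset.sum_le_sum fun i _ => ?_
  have h1 : ((ex (cf i) (fun t => t.uP * ∏ k ∈ Finset.univ.erase i, cdf (cf k) t.uA) : ℚ) : ℝ) ≤
      ((2 / (Nat.sqrt M : ℚ) * halfUtil cf i + objective M v (cf i) +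
        6 / M * ∑ j ∈ Finset.Ico 1 M, binUtil M v (cf i) j : ℚ) : ℝ) := by
    exact_mod_cast h.utility_item_le hM i (hmono i)
  refine h1.trans ?_
  have h2 := h.sum_binUtil_le i (hmono i)
  have hT0 : (0 : ℝ) ≤ (halfUtil cf i : ℝ) := by exact_mod_cast h.halfUtil_nonneg i
  have hM0 : (0 : ℝ) < M := by exact_mod_cast (by omega : 0 < M)
  have hs0 : 0 < √(M : ℝ) := Real.sqrt_pos.2 hM0
  have hss : √(M : ℝ) * √(M : ℝ) = M := Real.mul_self_sqrt hM0.le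
  have hm0 : (1 : ℝ) ≤ (Nat.sqrt M : ℝ) := by
    have : 0 < Nat.sqrt M := Nat.sqrt_pos.2 (by omega)
    exact_mod_cast this
  -- Replaces the integer root by the real one: 2/⌊√M⌋ ≤ 4/√M. The bins after the first contribute
  -- (6/M) · 2√M = 12/√M, and 4 + 12 = 16.
  have hm : √(M : ℝ) ≤ 2 * (Nat.sqrt M : ℝ) := by
    have h3 : √(M : ℝ) ≤ (Nat.sqrt M : ℝ) + 1 := by
      rw [Real.sqrt_le_left (by positivity)]
      have := Nat.lt_succ_sqrt' M
      exact_mod_cast this.le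
    linarith
  have h4 : 2 / (Nat.sqrt M : ℝ) ≤ 4 / √(M : ℝ) := by
    rw [div_le_div_iff₀ (by linarith) hs0]
    linarith
  have h5 : 6 / (M : ℝ) * (2 * √(M : ℝ) * (halfUtil cf i : ℝ)) =
      12 / √(M : ℝ) * (halfUtil cf i : ℝ) := by
    rw [← hss]; field_simp; norm_num; ring
  have h6 := mul_le_mul_of_nonneg_left h2 (by positivity : (0 : ℝ) ≤ 6 / (M : ℝ))
  rw [h5] at h6
  have h7 := mul_le_mul_of_nonneg_right h4 hT0
  push_cast at h6 ⊢
  have h8 : 16 / √(M : ℝ) * (halfUtil cf i : ℝ) =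
    4 / √(M : ℝ) * (halfUtil cf i : ℝ) + 12 / √(M : ℝ) * (halfUtil cf i : ℝ) := by ring
  linarith

end

/-! ### Random subsets of an assortment -/

/-- Double counting: a subset R with a chosen element i is the same as i together with a subset of
the rest, namely R without i. -/
theorem sum_powerset_erase {ι : Type*} [DecidableEq ι] (S : Finset ι) (F : ι → Finset ι → ℚ) :
    ∑ R ∈ S.powerset, ∑ i ∈ R, F i (R.erase i) =
      ∑ i ∈ S, ∑ T ∈ (S.erase i).powerset, F i T := by
  rw [Finset.sum_sigma', Finset.sum_sigma']
  refine Finset.sum_bij' (fun x _ => ⟨x.2, x.1.erase x.2⟩) (fun y _ => ⟨insert y.1 y.2, y.1⟩)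
    ?_ ?_ ?_ ?_ ?_
  · rintro ⟨R, i⟩ h
    simp only [Finset.mem_sigma, Finset.mem_powerset] at h ⊢
    exact ⟨h.1 h.2, Finset.erase_subset_erase _ h.1⟩
  · rintro ⟨i, T⟩ h
    simp only [Finset.mem_sigma, Finset.mem_powerset] at h ⊢
    exact ⟨Finset.insert_subset h.1 (h.2.trans (Finset.erase_subset _ _)),
      Finset.mem_insert_self _ _⟩
  · rintro ⟨R, i⟩ h
    simp only [Finset.mem_sigma, Finset.mem_powerset] at h
    simp [Finset.insert_erase h.2]
  · rintro ⟨i, T⟩ h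
    simp only [Finset.mem_sigma, Finset.mem_powerset] at h
    have : i ∉ T := fun hi => Finset.notMem_erase i S (h.2 hi)
    simp [Finset.erase_insert this]
  · rintro ⟨R, i⟩ h
    rfl

namespace IsModel

variable {n M : ℕ} {outC inC : Fin n → Config}

theorem isChoice (h : IsModel M outC inC) (S : Finset (Fin n)) : IsChoice (choose outC inC S) := by
  refine ⟨fun k t ht => ?_, fun k => ?_, fun k t ht => ?_⟩
  · unfold choose at ht
    split at ht
    · exact h.pr_nonneg k t ht
    · exact (h.out k t ht).2.2
  · unfold choose
    split
    · exact h.in_sum k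
    · exact h.out_sum k
  · unfold choose at ht
    split at ht
    · exact h.uP_nonneg k t ht
    · rw [(h.out k t ht).2.1]

theorem choose_mono (h : IsModel M outC inC) (S : Finset (Fin n)) (i : Fin n) :
    ∀ s ∈ choose outC inC S i, ∀ t ∈ choose outC inC S i, s.uA < t.uA → s.uP ≤ t.uP := by
  intro s hs t ht hst
  unfold choose at hs ht
  split at hs
  · rename_i hi
    rw [if_pos hi] at ht
    exact h.mono i s hs t ht hst
  · rename_i hi
    rw [if_neg hi] at ht
    rw [(h.out i s hs).2.1, (h.out i t ht).2.1]

/-- Actions outside of S earn nothing, and each contributes (1 + 1)/2 = 1 to the products at finite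
utilities. -/
theorem sum_halfUtil (h : IsModel M outC inC) (S : Finset (Fin n)) :
    ∑ i, halfUtil (choose outC inC S) i = ∑ i ∈ S, ex (inC i) fun t =>
      t.uP * ∏ k ∈ S.erase i, (1 + cdf (inC k) t.uA) / 2 := by
  rw [← Finset.sum_subset (Finset.subset_univ S)]
  · refine Finset.sum_congr rfl fun i hi => ?_
    simp only [halfUtil, halfPr, choose, hi, if_true]
    refine ex_congr fun t ht => ?_
    congr 1
    rw [← Finset.prod_subset (Finset.erase_subset_erase i (Finset.subset_univ S))]
    · refine Finset.prod_congr rfl fun k hk => ?_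
      rw [if_pos (Finset.mem_of_mem_erase hk)]
    · intro k hk hkS
      have hk' : k ∉ S := fun hS => hkS (Finset.mem_erase.2 ⟨(Finset.mem_erase.1 hk).1, hS⟩)
      rw [if_neg hk']
      obtain ⟨z, hz⟩ := h.fin i t ht
      rw [h.cdf_out k (by rw [hz]; exact WithBot.coe_ne_bot)]
      norm_num
  · intro i _ hi
    unfold halfUtil
    refine (ex_congr fun t ht => ?_).trans (ex_zero _)
    simp only [choose, hi, if_false] at ht
    rw [(h.out i t ht).2.1, zero_mul]

/-- The utility of a uniformly random subset of `S` is half of the sum of the `halfUtil`. -/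
theorem sum_halfUtil_le (h : IsModel M outC inC) (S : Finset (Fin n)) (U : ℚ)
    (hU : ∀ R, utility (choose outC inC R) ≤ U) :
    ∑ i, halfUtil (choose outC inC S) i ≤ 2 * U := by
  rcases S.eq_empty_or_nonempty with rfl | hS
  · rw [h.sum_halfUtil, Finset.sum_empty]
    have := hU ∅
    rw [h.utility_choose, Finset.sum_empty] at this
    linarith
  -- For fixed i, summing ∏ c_k over the subsets of S without i gives ∏ (1 + c_k), which is 2^(|S| -
  -- 1) times the product defining `halfPr`. Each item lies in only half of the 2^|S| subsets, hence
  -- the factor 2 in the bound.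
  have h1 : ∑ R ∈ S.powerset, utility (choose outC inC R) =
      2 ^ (S.card - 1) * ∑ i, halfUtil (choose outC inC S) i := by
    simp only [h.utility_choose]
    rw [sum_powerset_erase S fun i T => ex (inC i) fun t => t.uP * ∏ k ∈ T, cdf (inC k) t.uA,
      h.sum_halfUtil, Finset.mul_sum]
    refine Finset.sum_congr rfl fun i hi => ?_
    rw [← ex_sum, ← ex_const_mul]
    refine ex_congr fun t _ => ?_
    rw [← Finset.mul_sum, ← Finset.prod_one_add, Finset.prod_div_distrib, Finset.prod_const,
      Finset.card_erase_of_mem hi]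
    field_simp
  have h2 : ∑ R ∈ S.powerset, utility (choose outC inC R) ≤ 2 ^ S.card * U := by
    refine (Finset.sum_le_card_nsmul _ _ U fun R _ => hU R).trans (le_of_eq ?_)
    rw [Finset.card_powerset, nsmul_eq_mul]; push_cast; ring
  have h3 : (2 : ℚ) ^ S.card = 2 ^ (S.card - 1) * 2 := by
    rw [← pow_succ]
    congr 1
    have := hS.card_pos
    omega
  rw [h1, h3, mul_assoc] at h2
  exact le_of_mul_le_mul_left h2 (by positivity)

end IsModel

/-! ### Feasibility of an even profile -/

/-- The ratio P_j/P_{j+1} is ∏ (1 - q_k) ≥ 1 - ∑ q_k, and evenness bounds it above by (j + 1/M)/(j +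
1). -/
theorem IsEven.le_sum_condPr {n M : ℕ} {v : ℕ → WithBot ℚ} {cf : Fin n → Config}
    (h : IsEven M v cf) {j : ℕ} (hj : j < M) :
    (1 - 1 / (M : ℚ)) / ((j : ℚ) + 1) ≤ ∑ k, condPr M v (cf k) j := by
  have hM0 : (0 : ℚ) < M := by exact_mod_cast h.profile.pos
  have h1 := one_sub_sum_le_prod Finset.univ (fun k => condPr M v (cf k) j)
    (fun k _ => h.choice.condPr_nonneg h.profile k j) fun k _ => h.choice.condPr_le_one k j
  set p := ∏ k, (1 - condPr M v (cf k) j) with hp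
  have h2 : allPr M v cf j = allPr M v cf (j + 1) * p := by
    unfold allPr
    rw [hp, ← Finset.prod_mul_distrib]
    exact Finset.prod_congr rfl fun k _ => h.choice.cumPr_eq_mul h.profile k j
  have h3 := h.ge j hj.le
  have h4 := h.le (j + 1) hj
  have hp0 : 0 ≤ p := Finset.prod_nonneg fun k _ => sub_nonneg.2 (h.choice.condPr_le_one k j)
  have h5 : ((j + 1 : ℕ) : ℚ) / M * p ≤ (j : ℚ) / M + 1 / (M : ℚ) ^ 2 :=
    (mul_le_mul_of_nonneg_right h4 hp0).trans (h2 ▸ h3)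
  have h6 : ((j : ℚ) + 1) * p ≤ j + 1 / M := by
    have h7 := mul_le_mul_of_nonneg_left h5 hM0.le
    have e1 : (M : ℚ) * (((j + 1 : ℕ) : ℚ) / M * p) = ((j : ℚ) + 1) * p := by
      push_cast; field_simp
    have e2 : (M : ℚ) * ((j : ℚ) / M + 1 / (M : ℚ) ^ 2) = j + 1 / M := by field_simp
    rw [e1, e2] at h7
    exact h7
  rw [div_le_iff₀ (by positivity)]
  have h8 : (0 : ℚ) ≤ (j : ℚ) + 1 := by positivity
  nlinarith [mul_le_mul_of_nonneg_right h1 h8]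

/-- The inverse ratio P_{j+1}/P_j is at most (j + 1 + 1/M)/j by evenness, and it expands as ∏ (1 +
r_k) ≥ 1 + ∑ r_k. -/
theorem IsEven.sum_condPr_le {n M : ℕ} {v : ℕ → WithBot ℚ} {cf : Fin n → Config}
    (h : IsEven M v cf) {j : ℕ} (hj1 : 1 ≤ j) (hj : j < M) :
    ∑ k, condPr M v (cf k) j ≤ (1 + 1 / (M : ℚ)) / j := by
  have hM0 : (0 : ℚ) < M := by exact_mod_cast h.profile.pos
  have hj0 : (0 : ℚ) < j := by exact_mod_cast hj1
  -- The increments relative to the smaller probability; they dominate the conditional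
  -- probabilities, whose denominator is the larger one.
  set r : Fin n → ℚ := fun k => (cumPr M v (cf k) (j + 1) - cumPr M v (cf k) j) / cumPr M v (cf k) j
    with hr
  have hpos : ∀ k, 0 < cumPr M v (cf k) j := fun k => h.cumPr_pos k hj1 hj.le
  have h0 : ∀ k, 0 ≤ cumPr M v (cf k) (j + 1) - cumPr M v (cf k) j := fun k =>
    sub_nonneg.2 (h.choice.cumPr_le_succ h.profile k j)
  have h1 := one_add_sum_le_prod Finset.univ r fun k _ => div_nonneg (h0 k) (hpos k).le
  have h2 : allPr M v cf j * ∏ k, (1 + r k) = allPr M v cf (j + 1) := by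
    unfold allPr
    rw [← Finset.prod_mul_distrib]
    refine Finset.prod_congr rfl fun k _ => ?_
    have := (hpos k).ne'
    simp only [hr]
    field_simp
    ring
  have h3 : ∑ k, condPr M v (cf k) j ≤ ∑ k, r k := by
    refine Finset.sum_le_sum fun k _ => ?_
    exact div_le_div_of_nonneg_left (h0 k) (hpos k) (h.choice.cumPr_le_succ h.profile k j)
  have h4 := h.le j hj.le
  have h5 := h.ge (j + 1) hj
  have h6 : (0 : ℚ) ≤ 1 + ∑ k, r k := by
    have : 0 ≤ ∑ k, r k := Finset.sum_nonneg fun k _ => div_nonneg (h0 k) (hpos k).le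
    linarith
  have h7 : (j : ℚ) / M * (1 + ∑ k, r k) ≤ ((j + 1 : ℕ) : ℚ) / M + 1 / (M : ℚ) ^ 2 := by
    refine le_trans ?_ h5
    rw [← h2]
    exact mul_le_mul h4 h1 h6 ((by positivity : (0 : ℚ) ≤ (j : ℚ) / M).trans h4)
  have h8 : (j : ℚ) * (1 + ∑ k, r k) ≤ j + 1 + 1 / M := by
    have h9 := mul_le_mul_of_nonneg_left h7 hM0.le
    have e1 : (M : ℚ) * ((j : ℚ) / M * (1 + ∑ k, r k)) = (j : ℚ) * (1 + ∑ k, r k) := by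
      field_simp
    have e2 : (M : ℚ) * (((j + 1 : ℕ) : ℚ) / M + 1 / (M : ℚ) ^ 2) = j + 1 + 1 / M := by
      push_cast; field_simp
    rw [e1, e2] at h9
    exact h9
  rw [le_div_iff₀ hj0]
  nlinarith [mul_le_mul_of_nonneg_right h3 hj0.le]

/-! ### Existence of an even profile -/

/-- `Pr[u_i^A ≤ u]`. -/
def cdfLe (c : Config) (u : WithBot ℚ) : ℚ := ex c fun t => if t.uA ≤ u then 1 else 0

theorem ex_eq_le_of_nodup {c : Config} {B : ℚ} (hB : 0 ≤ B) (hc : ∀ t ∈ c, t.pr ≤ B)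
    (h : (c.map Mass.uA).Nodup) (u : WithBot ℚ) : ex c (fun t => if t.uA = u then 1 else 0) ≤ B := by
  induction c with
  | nil => simpa [ex] using hB
  | cons t c ih =>
    rw [List.map_cons, List.nodup_cons] at h
    have e : ex (t :: c) (fun t => if t.uA = u then 1 else 0) =
        t.pr * (if t.uA = u then 1 else 0) + ex c (fun t => if t.uA = u then 1 else 0) := by
      simp [ex]
    rw [e]
    by_cases hu : t.uA = u
    · have : ex c (fun t => if t.uA = u then 1 else 0) = 0 := by
        refine (ex_congr fun s hs => if_neg fun hsu => ?_).trans (ex_zero c)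
        exact h.1 (hu ▸ hsu ▸ List.mem_map_of_mem hs)
      rw [this, if_pos hu]
      have := hc t (by simp)
      linarith
    · rw [if_neg hu]
      have := ih (fun s hs => hc s (by simp [hs])) h.2
      linarith

theorem cdfLe_eq_add (c : Config) (u : WithBot ℚ) :
    cdfLe c u = cdf c u + ex c (fun t => if t.uA = u then 1 else 0) := by
  unfold cdfLe cdf
  rw [← ex_add]
  refine ex_congr fun t _ => ?_
  rcases lt_trichotomy t.uA u with h | h | h
  · simp [h, h.le, h.ne]
  · simp [h]
  · simp [h.not_gt, h.not_ge, h.ne']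

namespace IsModel

variable {n M : ℕ} {outC inC : Fin n → Config}

/-- At a finite u at most one action has an atom, and that atom is at most 1/M². So the distribution
function of the maximum jumps by at most 1/M². -/
theorem prod_cdfLe_le (h : IsModel M outC inC) (hM : 1 ≤ M) (S : Finset (Fin n)) {u : WithBot ℚ}
    (hu : u ≠ ⊥) : ∏ k, cdfLe (choose outC inC S k) u ≤
      ∏ k, cdf (choose outC inC S k) u + 1 / (M : ℚ) ^ 2 := by
  have hc := h.isChoice S
  have hout : ∀ k, k ∉ S → ∀ t ∈ choose outC inC S k, t.uA ≠ u := by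
    intro k hk t ht hu'
    simp only [choose, hk, if_false] at ht
    exact hu (hu' ▸ (h.out k t ht).1)
  by_cases hex : ∃ k ∈ S, ∃ t ∈ inC k, t.uA = u
  · obtain ⟨k, hk, t, ht, htu⟩ := hex
    rw [← Finset.mul_prod_erase _ _ (Finset.mem_univ k),
      ← Finset.mul_prod_erase _ (fun k => cdf (choose outC inC S k) u) (Finset.mem_univ k)]
    have h1 : ∏ l ∈ Finset.univ.erase k, cdfLe (choose outC inC S l) u =
        ∏ l ∈ Finset.univ.erase k, cdf (choose outC inC S l) u := by
      refine Finset.prod_congr rfl fun l hl => ?_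
      have hlk := (Finset.mem_erase.1 hl).1
      rw [cdfLe_eq_add]
      rw [(ex_congr fun s hs => if_neg fun hsu => ?_).trans (ex_zero _), add_zero]
      by_cases hlS : l ∈ S
      · simp only [choose, hlS, if_true] at hs
        exact h.ne l k hlk s hs t ht (hsu.trans htu.symm)
      · exact hout l hlS s hs hsu
    rw [h1, cdfLe_eq_add, add_mul]
    have h2 : ex (choose outC inC S k) (fun t => if t.uA = u then 1 else 0) ≤ 1 / (M : ℚ) ^ 2 := by
      simp only [choose, hk, if_true]
      exact ex_eq_le_of_nodup (by positivity) (h.pr_le k) (h.nodup k) u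
    have h3 : ∏ l ∈ Finset.univ.erase k, cdf (choose outC inC S l) u ≤ 1 :=
      Finset.prod_le_one (fun l _ => cdf_nonneg (hc.pr_nonneg l) u)
        fun l _ => cdf_le_one (hc.pr_nonneg l) (hc.sum_eq l) u
    have h4 : 0 ≤ ∏ l ∈ Finset.univ.erase k, cdf (choose outC inC S l) u :=
      Finset.prod_nonneg fun l _ => cdf_nonneg (hc.pr_nonneg l) u
    have h5 := mul_le_mul h2 h3 h4 (by positivity)
    rw [mul_one] at h5
    linarith
  · push Not at hex
    have h1 : ∏ l, cdfLe (choose outC inC S l) u = ∏ l, cdf (choose outC inC S l) u := by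
      refine Finset.prod_congr rfl fun l _ => ?_
      rw [cdfLe_eq_add]
      rw [(ex_congr fun s hs => if_neg fun hsu => ?_).trans (ex_zero _), add_zero]
      by_cases hlS : l ∈ S
      · simp only [choose, hlS, if_true] at hs
        exact hex l hlS s hs hsu
      · exact hout l hlS s hs hsu
    rw [h1]
    have : (0 : ℚ) ≤ 1 / (M : ℚ) ^ 2 := by positivity
    linarith

/-- Quantiles of the maximal agent utility. The boundaries are taken from the supports, as the main
loop only tries those; v M is the largest candidate, so the last bin reaches everything. -/
theorem exists_isEven (h : IsModel M outC inC) (hM : 1 ≤ M) {S : Finset (Fin n)}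
    (hS : S.Nonempty) (cand : Finset (WithBot ℚ)) (hin : ∀ k, ∀ t ∈ inC k, t.uA ∈ cand)
    (hout : ∀ k, ∀ t ∈ outC k, t.uA ∈ cand) :
    ∃ v, IsEven M v (choose outC inC S) ∧ (∀ u ∈ cand, u ≤ v M) ∧
      ∀ j, 1 ≤ j → j ≤ M → v j ∈ cand := by
  set cf := choose outC inC S with hcf
  have hc : IsChoice cf := h.isChoice S
  have hM0 : (0 : ℚ) < M := by exact_mod_cast hM
  obtain ⟨i₀, hi₀⟩ := hS
  have hcf0 : cf i₀ = inC i₀ := by simp [hcf, choose, hi₀]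
  have hmem : ∀ k, ∀ t ∈ cf k, t.uA ∈ cand := by
    intro k t ht
    simp only [hcf, choose] at ht
    split at ht
    · exact hin k t ht
    · exact hout k t ht
  have hne : inC i₀ ≠ [] := by
    intro h0
    have := h.in_sum i₀
    rw [h0] at this; simp at this
  obtain ⟨t₀, ht₀⟩ := List.exists_mem_of_ne_nil _ hne
  obtain ⟨w, hw, hwmax⟩ := cand.exists_max_image id ⟨t₀.uA, hin _ _ ht₀⟩
  simp only [id] at hwmax
  have hwbot : w ≠ ⊥ := by
    obtain ⟨z, hz⟩ := h.fin i₀ t₀ ht₀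
    rintro rfl
    have := hwmax _ (hin _ _ ht₀)
    rw [hz] at this
    exact absurd this (by simp)
  let Φ : WithBot ℚ → ℚ := fun u => ∏ k, cdf (cf k) u
  have hΦmono : ∀ {u u'}, u ≤ u' → Φ u ≤ Φ u' := fun hu => prod_cdf_mono hc _ hu
  -- Strictly below the largest candidate w only the atom at w is missing; so w itself is admissible
  -- for every level j/M with j < M.
  have hΦw : 1 - 1 / (M : ℚ) ^ 2 ≤ Φ w := by
    have h1 := h.prod_cdfLe_le hM S hwbot
    rw [← hcf] at h1
    have h2 : ∏ k, cdfLe (cf k) w = 1 := by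
      refine Finset.prod_eq_one fun k _ => ?_
      rw [← hc.sum_eq k, ← ex_one]
      exact ex_congr fun t ht => if_pos (hwmax _ (hmem k t ht))
    rw [h2] at h1
    change 1 - _ ≤ ∏ k, cdf (cf k) w
    linarith
  have hM2 : 1 / (M : ℚ) ^ 2 ≤ 1 / M := by
    have : (1 : ℚ) ≤ M := by exact_mod_cast hM
    refine one_div_le_one_div_of_le hM0 ?_
    nlinarith
  have hΦw' : ∀ j < M, (j : ℚ) / M ≤ Φ w := by
    intro j hj
    have h1 : (j : ℚ) + 1 ≤ M := by
      have : j + 1 ≤ M := hj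
      exact_mod_cast this
    have h2 : (j : ℚ) / M ≤ (M - 1) / M := by gcongr; linarith
    have h3 : ((M : ℚ) - 1) / M = 1 - 1 / M := by field_simp
    linarith
  -- The boundary v j will be the least element of this set.
  let A : ℕ → Finset (WithBot ℚ) := fun j => cand.filter fun u => (j : ℚ) / M ≤ Φ u
  have hAne : ∀ j < M, (A j).Nonempty := fun j hj =>
    ⟨w, Finset.mem_filter.2 ⟨hw, hΦw' j hj⟩⟩
  let v : ℕ → WithBot ℚ := fun j =>
    if j = 0 then ⊥ else if hj : j < M then (A j).min' (hAne j hj) else w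
  have hvA : ∀ j, j ≠ 0 → ∀ hj : j < M, v j = (A j).min' (hAne j hj) := by
    intro j h0 hj; simp [v, h0, hj]
  have hvM : ∀ j, j ≠ 0 → ¬ j < M → v j = w := by
    intro j h0 hj; simp [v, h0, hj]
  have hvM' : v M = w := hvM M (by omega) (lt_irrefl M)
  have hvmem : ∀ j, j ≠ 0 → ∀ hj : j < M, v j ∈ A j := by
    intro j h0 hj; rw [hvA j h0 hj]; exact Finset.min'_mem _ _
  have hprof : IsProfile M v := by
    refine ⟨hM, by simp [v], fun j hj => ?_⟩
    by_cases h0 : j = 0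
    · have : v j = ⊥ := by simp [v, h0]
      rw [this]; exact bot_le
    · by_cases hj1 : j + 1 < M
      · rw [hvA j h0 hj]
        refine Finset.min'_le _ _ ?_
        have h1 := hvmem (j + 1) (by omega) hj1
        simp only [A, Finset.mem_filter] at h1 ⊢
        refine ⟨h1.1, le_trans ?_ h1.2⟩
        gcongr
        simp
      · rw [hvM (j + 1) (by omega) hj1]
        exact hwmax _ (Finset.mem_filter.1 (hvmem j h0 hj)).1
  have hall : ∀ j < M, allPr M v cf j = Φ (v j) := by
    intro j hj
    unfold allPr
    exact Finset.prod_congr rfl fun k _ => cumPr_eq_cdf hj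
  have hallM : allPr M v cf M = 1 := by
    unfold allPr
    exact Finset.prod_eq_one fun k _ => hc.cumPr_last k
  have hpos2 : (0 : ℚ) ≤ 1 / (M : ℚ) ^ 2 := by positivity
  have hall0 : allPr M v cf 0 = 0 := by
    unfold allPr
    refine Finset.prod_eq_zero (Finset.mem_univ i₀) ?_
    unfold cumPr
    exact hprof.cumEx_zero
  refine ⟨v, ⟨hc, hprof, fun j hj => ?_, fun j hj => ?_⟩, ?_, ?_⟩
  · rcases hj.lt_or_eq with hj | rfl
    · rcases Nat.eq_zero_or_pos j with rfl | h0
      · rw [hall0]; simp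
      · rw [hall j hj]
        exact (Finset.mem_filter.1 (hvmem j (by omega) hj)).2
    · rw [hallM, div_self hM0.ne']
  · rcases hj.lt_or_eq with hj | rfl
    · rcases Nat.eq_zero_or_pos j with rfl | h0
      · rw [hall0]; simp
      rw [hall j hj]
      have hj0 : (0 : ℚ) ≤ (j : ℚ) / M := by positivity
      have hmin : ∀ u ∈ cand, u < v j → Φ u < (j : ℚ) / M := by
        intro u hu huv
        by_contra hcon
        have h1 : u ∈ A j := Finset.mem_filter.2 ⟨hu, not_lt.1 hcon⟩
        have h2 := Finset.min'_le _ _ h1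
        rw [← hvA j (by omega) hj] at h2
        exact absurd huv h2.not_gt
      rcases (cand.filter fun u => u < v j).eq_empty_or_nonempty with he | hne'
      · have : Φ (v j) = 0 := by
          refine Finset.prod_eq_zero (Finset.mem_univ i₀) ?_
          refine (ex_congr fun t ht => if_neg fun htv => ?_).trans (ex_zero _)
          have : t.uA ∈ cand.filter fun u => u < v j :=
            Finset.mem_filter.2 ⟨hmem _ t ht, htv⟩
          rw [he] at this
          simp at this
        rw [this]; positivity
      · obtain ⟨u, hu, humax⟩ := Finset.exists_max_image _ id hne'
        simp only [id] at humax
        rw [Finset.mem_filter] at hu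
        -- Here u is the candidate just before v j: lying below v j means lying at or below u. By
        -- minimality of v j, Φ u < j/M, and one atom adds at most 1/M².
        have h1 : Φ (v j) = ∏ k, cdfLe (cf k) u := by
          refine Finset.prod_congr rfl fun k _ => ex_congr fun t ht => if_congr ?_ rfl rfl
          exact ⟨fun h => humax _ (Finset.mem_filter.2 ⟨hmem k t ht, h⟩),
            fun h => h.trans_lt hu.2⟩
        rw [h1]
        -- At -∞ the atoms are large, because of the actions that are "out". But i₀ is "in" and has
        -- no mass there, so the product vanishes.
        by_cases hub : u = ⊥
        · have h2 : ∏ k, cdfLe (cf k) u = 0 := by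
            refine Finset.prod_eq_zero (Finset.mem_univ i₀) ?_
            refine (ex_congr fun t ht => if_neg fun htu => ?_).trans (ex_zero _)
            rw [hcf0] at ht
            obtain ⟨z, hz⟩ := h.fin i₀ t ht
            rw [hz, hub] at htu
            exact absurd htu (by simp)
          rw [h2]; positivity
        · have h2 := h.prod_cdfLe_le hM S hub
          rw [← hcf] at h2
          have h3 : ∏ k, cdf (cf k) u < (j : ℚ) / M := hmin u hu.1 hu.2
          linarith
    · rw [hallM, div_self hM0.ne']
      linarith
  · intro u hu; rw [hvM']; exact hwmax u hu
  · intro j h1 hj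
    rcases hj.lt_or_eq with hj | rfl
    · exact (Finset.mem_filter.1 (hvmem j (by omega) hj)).1
    · rw [hvM']; exact hw

end IsModel

/-! ### The main loop -/

/-- Invariant of the main loop: the stored value is the true value of the stored solution, and it
never falls below that of a solution already seen. -/
theorem foldl_best {α : Type} (e : α → Entry) (w : List ℕ → ℚ) (step : Entry → α → Entry)
    (hstep : ∀ b a, step b a = match e a with
      | none => b
      | some (_, C) => match b with
        | none => some (w C, C)
        | some (w', C') => if w' < w C then some (w C, C) else some (w', C'))
    (good : List ℕ → Prop) (l : List α) (hl : ∀ a ∈ l, ∀ v C, e a = some (v, C) → good C) :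
    ∀ b : Entry, (∀ w' C', b = some (w', C') → w' = w C' ∧ good C') →
      (∀ w' C', l.foldl step b = some (w', C') → w' = w C' ∧ good C') ∧
      ∀ C₀, (b = some (w C₀, C₀) ∨ ∃ a ∈ l, ∃ v, e a = some (v, C₀)) →
        ∃ C, l.foldl step b = some (w C, C) ∧ w C₀ ≤ w C := by
  induction l with
  | nil =>
    intro b hb
    refine ⟨hb, fun C₀ h => ?_⟩
    rcases h with h | ⟨a, ha, -⟩
    · exact ⟨C₀, h, le_rfl⟩
    · simp at ha
  | cons a l ih =>
    intro b hb
    rw [List.foldl_cons]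
    have h1 : (∀ w' C', step b a = some (w', C') → w' = w C' ∧ good C') ∧
        ∀ C₀, (b = some (w C₀, C₀) ∨ ∃ v, e a = some (v, C₀)) →
          ∃ C, step b a = some (w C, C) ∧ w C₀ ≤ w C := by
      rw [hstep]
      rcases he : e a with _ | ⟨v, C⟩
      · refine ⟨hb, fun C₀ h => ?_⟩
        rcases h with h | ⟨v, h⟩
        · exact ⟨C₀, h, le_rfl⟩
        · simp at h
      · have hg := hl a (by simp) v C he
        rcases b with _ | ⟨w₁, C₁⟩
        · simp only [Option.some.injEq, Prod.mk.injEq, and_imp]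
          refine ⟨?_, fun C₀ h => ?_⟩
          · rintro w' C' rfl rfl; exact ⟨rfl, hg⟩
          · rcases h with h | ⟨v, -, h⟩
            · simp at h
            · subst h; exact ⟨C, ⟨rfl, rfl⟩, le_rfl⟩
        · obtain ⟨h1, h2⟩ := hb w₁ C₁ rfl
          subst h1
          by_cases hlt : w C₁ < w C
          · simp only [hlt, if_true, Option.some.injEq, Prod.mk.injEq, and_imp]
            refine ⟨?_, fun C₀ h => ?_⟩
            · rintro w' C' rfl rfl; exact ⟨rfl, hg⟩
            · rcases h with ⟨-, h⟩ | ⟨v, -, h⟩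
              · subst h; exact ⟨C, ⟨rfl, rfl⟩, hlt.le⟩
              · subst h; exact ⟨C, ⟨rfl, rfl⟩, le_rfl⟩
          · simp only [hlt, if_false, Option.some.injEq, Prod.mk.injEq, and_imp]
            refine ⟨?_, fun C₀ h => ?_⟩
            · rintro w' C' rfl rfl; exact ⟨rfl, h2⟩
            · rcases h with ⟨-, h⟩ | ⟨v, -, h⟩
              · subst h; exact ⟨C₁, ⟨rfl, rfl⟩, le_rfl⟩
              · subst h; exact ⟨C₁, ⟨rfl, rfl⟩, not_lt.1 hlt⟩
    obtain ⟨h2, h3⟩ := ih (fun a' ha' => hl a' (by simp [ha'])) (step b a) h1.1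
    refine ⟨h2, fun C₀ h => ?_⟩
    have h4 : (b = some (w C₀, C₀) ∨ ∃ v, e a = some (v, C₀)) ∨
        ∃ a' ∈ l, ∃ v, e a' = some (v, C₀) := by
      rcases h with h | ⟨a', ha', v, h⟩
      · exact Or.inl (Or.inl h)
      · rcases List.mem_cons.1 ha' with rfl | ha'
        · exact Or.inl (Or.inr ⟨v, h⟩)
        · exact Or.inr ⟨a', ha', v, h⟩
    rcases h4 with h4 | h4
    · obtain ⟨C, hC, hle⟩ := h1.2 C₀ h4
      obtain ⟨C', hC', hle'⟩ := h3 C (Or.inl hC)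
      exact ⟨C', hC', hle.trans hle'⟩
    · exact h3 C₀ (Or.inr h4)

/-- The boundaries of the candidate profiles. -/
def candidates (F : UC) : List (WithBot ℚ) := (allMassesT F).val.map fun t => t.mass.uA

/-- The body of the main loop. -/
def mainStep (M n : ℕ) (F : UC) (best : Entry) (û : List (WithBot ℚ)) : Timed Entry := do
  let B ← binsT 1 ⊥ û
  let e ← solveT M n B F
  match e with
  | none => return best
  | some (_, C) =>
    let sel ← selectT F C
    let w ← evalT [] sel
    match best with
    | none => return some (w, C)
    | some (w', C') =>
      if ← ltT w' w then return some (w, C) else return some (w', C')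

theorem configureT_eq (M : ℕ) (F₀ : UC) : configureT M F₀ = (do
    let F ← preprocessT M F₀
    let n ← lengthT F
    let L ← allMassesT F
    let cand ← mapT (fun t => do return t.mass.uA) L
    let all ← tuplesT cand M
    let prof ← filterT sortedT all
    let best ← foldT (mainStep M n F) none prof
    match best with
    | none => constT 0 F
    | some (_, C) => return C) := rfl

/-- One successful profile suffices to bound the output from below. The predicate `good` transports
a property of all solutions of the dynamic program to the output; it will be the validity of the
configuration indices. -/
theorem configureT_spec (M : ℕ) (F₀ : UC) {F : UC} (hF : (preprocessT M F₀).val = F)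
    (good : List ℕ → Prop)
    (hgood : ∀ û v C, (solveT M F.length (binsT 1 ⊥ û).val F).val = some (v, C) → good C)
    {û : List (WithBot ℚ)} (hlen : û.length = M) (hmem : ∀ u ∈ û, u ∈ candidates F)
    (hsorted : (sortedT û).val = true) {v : ℚ} {C : List ℕ}
    (hsolve : (solveT M F.length (binsT 1 ⊥ û).val F).val = some (v, C)) :
    good (configureT M F₀).val ∧
      (evalT [] (selectT F C).val).val ≤ (evalT [] (selectT F (configureT M F₀).val).val).val := by
  set prof := (tuplesT (candidates F) M).val.filter fun û => (sortedT û).val with hprof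
  have hû : û ∈ prof := by
    rw [hprof, List.mem_filter, mem_tuplesT]
    exact ⟨⟨hlen, hmem⟩, hsorted⟩
  have hstep : ∃ step : Entry → List (WithBot ℚ) → Entry,
      (∀ b a, step b a = match (solveT M F.length (binsT 1 ⊥ a).val F).val with
        | none => b
        | some (_, C) => match b with
          | none => some ((evalT [] (selectT F C).val).val, C)
          | some (w', C') => if w' < (evalT [] (selectT F C).val).val then
              some ((evalT [] (selectT F C).val).val, C) else some (w', C')) ∧
      (configureT M F₀).val = match prof.foldl step none with
        | none => F.map fun _ => 0
        | some (_, C) => C := by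
    refine ⟨fun b a => (mainStep M F.length F b a).val, ?_, ?_⟩
    · intro b a
      simp only [mainStep, val_bind]
      rcases (solveT M F.length (binsT 1 ⊥ a).val F).val with _ | ⟨v, C⟩
      · rfl
      · rcases b with _ | ⟨w', C'⟩
        · rfl
        · simp
    · rw [configureT_eq]
      simp only [val_bind, foldT_val, hF, lengthT_val, filterT_val, mapT_val, val_pure]
      change (match prof.foldl (fun b a => (mainStep M F.length F b a).val) none with
        | none => constT 0 F
        | some (_, C) => pure C : Timed (List ℕ)).val = _
      rcases prof.foldl (fun b a => (mainStep M F.length F b a).val) none with _ | ⟨w, C⟩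
      · simp
      · rfl
  obtain ⟨step, hstep, hval⟩ := hstep
  have key := foldl_best _ (fun C => (evalT [] (selectT F C).val).val) step hstep good prof
    (fun a _ v C h => hgood a v C h) none (by simp)
  obtain ⟨C', hC', hle⟩ := key.2 C (Or.inr ⟨û, hû, v, hsolve⟩)
  rw [hC'] at hval
  rw [hval]
  exact ⟨(key.1 _ _ hC').2, hle⟩

theorem sortedT_profile {M : ℕ} {v : ℕ → WithBot ℚ} (h : ∀ j < M, v j ≤ v (j + 1)) (j len : ℕ)
    (hj : j + len ≤ M + 1) : (sortedT ((List.range' j len).map v)).val = true := by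
  induction len generalizing j with
  | zero => rfl
  | succ len ih =>
    cases len with
    | zero => rfl
    | succ len =>
      have h1 := ih (j + 1) (by omega)
      simp only [List.range'_succ, List.map_cons] at h1 ⊢
      simp only [sortedT, val_bind, andT_val, notT_val, utilLtT_val, h1]
      simpa using h j (by omega)

/-- With two configurations per action a valid index is 0 or 1, so a list of valid indices is the
same as the set of positions holding 1. -/
theorem selectT_ofFn {n : ℕ} (outC inC : Fin n → Config) (C : List ℕ)
    (h : List.Forall₂ (fun A ℓ => ℓ < A.length) (List.ofFn fun i => [outC i, inC i]) C) :
    (selectT (List.ofFn fun i => [outC i, inC i]) C).val =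
      List.ofFn (choose outC inC (Finset.univ.filter fun i : Fin n => C[(i : ℕ)]? = some 1)) := by
  have h2 : ∀ i : Fin n, choose outC inC
      (Finset.univ.filter fun i : Fin n => C[(i : ℕ)]? = some 1) i =
        if C[(i : ℕ)]? = some 1 then inC i else outC i := by
    intro i; simp [choose]
  rw [funext h2]
  clear h2
  induction n generalizing C with
  | zero => simp
  | succ n ih =>
    rw [List.ofFn_succ] at h ⊢
    rw [List.ofFn_succ]
    cases h with
    | @cons _ ℓ _ C h1 h2 =>
      rw [selectT_cons, ih _ _ C h2]
      simp only [List.length_cons, List.length_nil] at h1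
      congr 1
      interval_cases ℓ <;> simp

theorem forall₂_ofFn {n : ℕ} (outC inC : Fin n → Config) (f : Fin n → ℕ) (hf : ∀ i, f i < 2) :
    List.Forall₂ (fun A ℓ => ℓ < A.length) (List.ofFn fun i => [outC i, inC i]) (List.ofFn f) := by
  rw [List.forall₂_iff_get]
  refine ⟨by simp, fun i h1 h2 => ?_⟩
  simp only [List.get_eq_getElem, List.getElem_ofFn]
  exact hf _

/-- Rounding down to multiples of 1/D loses at most 1/D for each of the n actions. -/
theorem sum_floor_div (n : ℕ) (q : Fin n → ℚ) (D : ℚ) (hD : 0 < D) (hq : ∀ i, 0 ≤ q i) :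
    ((∑ i, ⌊q i * D⌋₊ : ℕ) : ℚ) / D ≤ ∑ i, q i ∧
      ∑ i, q i - n / D ≤ ((∑ i, ⌊q i * D⌋₊ : ℕ) : ℚ) / D := by
  constructor
  · rw [div_le_iff₀ hD, Finset.sum_mul]
    push_cast
    exact Finset.sum_le_sum fun i _ => Nat.floor_le (mul_nonneg (hq i) hD.le)
  · rw [le_div_iff₀ hD, sub_mul, div_mul_cancel₀ _ hD.ne', Finset.sum_mul]
    push_cast
    have h1 : ∑ i, q i * D ≤ ∑ i, ((⌊q i * D⌋₊ : ℚ) + 1) :=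
      Finset.sum_le_sum fun i _ => (Nat.lt_floor_add_one _).le
    rw [Finset.sum_add_distrib] at h1
    simp only [Finset.sum_const, Finset.card_univ, Fintype.card_fin, nsmul_eq_mul, mul_one] at h1
    linarith

/-- The main argument: the configuration found for the even profile of an optimal assortment. -/
theorem IsModel.configureT_ge {n M : ℕ} {outC inC : Fin n → Config} (h : IsModel M outC inC)
    (hM : 1 < M) {S : Finset (Fin n)} (hS : S.Nonempty)
    (hopt : ∀ R, utility (choose outC inC R) ≤ utility (choose outC inC S)) (F₀ : UC)
    (hF : (preprocessT M F₀).val = List.ofFn fun i => [outC i, inC i]) :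
    (1 - 32 / √(M : ℝ)) * (utility (choose outC inC S) : ℝ) ≤
      (utility (choose outC inC
        (Finset.univ.filter fun i : Fin n => (configureT M F₀).val[(i : ℕ)]? = some 1)) : ℝ) := by
  set F : UC := List.ofFn fun i => [outC i, inC i] with hFdef
  have hFlen : F.length = n := by simp [hFdef]
  have hmass : ∀ i, (∀ t ∈ outC i, t.uA ∈ candidates F) ∧ ∀ t ∈ inC i, t.uA ∈ candidates F := by
    intro i
    have hFi : F[(i : ℕ)]? = some [outC i, inC i] := by simp [hFdef]
    have h0 := group_allMassesT F i 0 _ (outC i) hFi rfl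
    have h1 := group_allMassesT F i 1 _ (inC i) hFi rfl
    constructor
    · intro t ht
      have h2 : (⟨i, 0, t⟩ : Tagged) ∈ group (allMassesT F).val i 0 := by
        rw [h0]; exact List.mem_map_of_mem ht
      exact List.mem_map.2 ⟨_, List.mem_of_mem_filter h2, rfl⟩
    · intro t ht
      have h2 : (⟨i, 1, t⟩ : Tagged) ∈ group (allMassesT F).val i 1 := by
        rw [h1]; exact List.mem_map_of_mem ht
      exact List.mem_map.2 ⟨_, List.mem_of_mem_filter h2, rfl⟩
  obtain ⟨v, hv, htop, hvmem⟩ := h.exists_isEven hM.le hS (candidates F).toFinset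
    (fun k t ht => List.mem_toFinset.2 ((hmass k).2 t ht))
    (fun k t ht => List.mem_toFinset.2 ((hmass k).1 t ht))
  simp only [List.mem_toFinset] at htop hvmem
  have hprof := hv.profile
  have hn : 0 < n := by
    obtain ⟨i, -⟩ := hS
    exact i.pos
  have hnQ : (0 : ℚ) < n := by exact_mod_cast hn
  have hM0 : (0 : ℚ) < M := by exact_mod_cast hprof.pos
  have hD : (0 : ℚ) < ((M ^ 2 * n : ℕ) : ℚ) := by push_cast; positivity
  -- The total rounding error. It is exactly the slack in the lower constraints, so S stays feasible
  -- after rounding, and it is the extra term in the hypothesis of `IsChoice.objective_le_utility`.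
  have hnD : (n : ℚ) / ((M ^ 2 * n : ℕ) : ℚ) = 1 / (M : ℚ) ^ 2 := by push_cast; field_simp
  have htopc : ∀ R i, ∀ t ∈ choose outC inC R i, t.uA ≤ v M := by
    intro R i t ht
    unfold choose at ht
    split at ht
    · exact htop _ ((hmass i).2 t ht)
    · exact htop _ ((hmass i).1 t ht)
  set û := (List.range' 1 M).map v with hû
  have hbins : (binsT 1 ⊥ û).val = binList M v := binsT_profile M v hprof.zero
  obtain ⟨box, hbox, hsol⟩ := solveT_isOpt M n (binList M v) F
  have hunits : ∀ R, ∀ j < M, (((List.ofFn (choose outC inC R)).map fun c =>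
      (unitsT ((M ^ 2 * n : ℕ) : ℚ) c ⟨j + 1, v j, v (j + 1), decide (j + 1 = M)⟩).val).sum) =
      ∑ i, ⌊condPr M v (choose outC inC R i) j * ((M ^ 2 * n : ℕ) : ℚ)⌋₊ := by
    intro R j hj
    rw [List.map_ofFn, List.sum_ofFn]
    exact Finset.sum_congr rfl fun i _ => unitsT_val hprof hj (htopc R i) _
  have hobj : ∀ R, ((List.ofFn (choose outC inC R)).map fun c =>
      (profileT M ((M ^ 2 * n : ℕ) : ℚ) (binList M v) c).val.1).sum =
      ∑ i, objective M v (choose outC inC R i) := by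
    intro R
    rw [List.map_ofFn, List.sum_ofFn]
    exact Finset.sum_congr rfl fun i _ => profileT_objective hprof (htopc R i) _
  have hfloor : ∀ R j, _ := fun R j => sum_floor_div n (fun i => condPr M v (choose outC inC R i) j)
    _ hD fun i => (h.isChoice R).condPr_nonneg hprof i j
  -- the optimal assortment is a feasible solution
  set Copt : List ℕ := List.ofFn fun i => if i ∈ S then 1 else 0 with hCopt
  have hCoptV : List.Forall₂ (fun A ℓ => ℓ < A.length) F Copt :=
    forall₂_ofFn _ _ _ fun i => by split <;> norm_num
  have hselopt : (selectT F Copt).val = List.ofFn (choose outC inC S) := by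
    rw [hFdef, selectT_ofFn outC inC Copt hCoptV]
    congr 2
    ext i
    simp [hCopt]
  have hpath := isPath_of_feasible (M := M) (D := ((M ^ 2 * n : ℕ) : ℚ)) (B := binList M v)
    (f := fun _ => 0) (C := Copt) (M ^ 2 * n) (M ^ 2 * n * n) hbox (by simp [binList]) hCoptV
    (by
      rw [hselopt]
      intro c hc b hb
      obtain ⟨i, rfl⟩ := (List.mem_ofFn' _ _).1 hc
      simp only [binList, List.mem_map, List.mem_range] at hb
      obtain ⟨j, hj, rfl⟩ := hb
      rw [unitsT_val hprof hj (htopc S i)]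
      refine Nat.floor_le_of_le ?_
      have := (h.isChoice S).condPr_le_one (M := M) (v := v) i j
      nlinarith)
    (by intro b _; rw [hFlen]; omega)
    (by
      intro b hb
      simp only [binList, List.mem_map, List.mem_range] at hb
      obtain ⟨j, hj, rfl⟩ := hb
      rw [hselopt, hunits S j hj, Nat.zero_add, binFeasibleT_val]
      obtain ⟨h1, h2⟩ := hfloor S j
      rw [hnD] at h2
      refine ⟨?_, ?_⟩
      · have := hv.le_sum_condPr hj
        linarith
      · rcases Nat.eq_zero_or_pos j with h0 | h0
        · exact Or.inl h0
        · exact Or.inr (h1.trans (hv.sum_condPr_le h0 hj)))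
  rw [hselopt, hobj] at hpath
  rcases hsolve : (solveT M n (binList M v) F).val with _ | ⟨v₁, C₁⟩
  · rw [hsolve] at hsol
    exact absurd hpath (hsol _ _)
  rw [hsolve] at hsol
  obtain ⟨hV₁, hv₁, hfeas₁⟩ := hsol.1.sound
  have hge := hsol.2 _ _ hpath
  set R₁ := Finset.univ.filter fun i : Fin n => C₁[(i : ℕ)]? = some 1 with hR₁
  have hsel₁ : (selectT F C₁).val = List.ofFn (choose outC inC R₁) :=
    selectT_ofFn outC inC C₁ hV₁
  rw [hsel₁, hobj] at hv₁
  have hle₁ : v₁ ≤ utility (choose outC inC R₁) := by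
    rw [hv₁]
    refine (h.isChoice R₁).objective_le_utility hprof fun j h1 hj => ?_
    have h3 := hfeas₁ ⟨j + 1, v j, v (j + 1), decide (j + 1 = M)⟩
      (List.mem_map.2 ⟨j, List.mem_range.2 hj, rfl⟩)
    rw [hsel₁, hunits R₁ j hj, Nat.zero_add, binFeasibleT_val] at h3
    obtain ⟨-, h4⟩ := hfloor R₁ j
    rw [hnD] at h4
    rcases h3.2 with h5 | h5
    · omega
    · linarith
  -- The output may come from another profile than the even one. Only validity of its indices is
  -- needed: the loop compares true utilities.
  have hconf := configureT_spec M F₀ hF (fun C => List.Forall₂ (fun A ℓ => ℓ < A.length) F C)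
    (by
      intro û' v' C' hs
      obtain ⟨box', -, hsol'⟩ := solveT_isOpt M F.length (binsT 1 ⊥ û').val F
      rw [hs] at hsol'
      exact hsol'.1.sound.1)
    (û := û) (by simp [hû])
    (by
      intro u hu
      simp only [hû, List.mem_map, List.mem_range'_1] at hu
      obtain ⟨j, ⟨h1, h2⟩, rfl⟩ := hu
      exact hvmem j h1 (by omega))
    (sortedT_profile hprof.mono 1 M (by omega))
    (by rw [hbins, hFlen]; exact hsolve)
  obtain ⟨hV, hle⟩ := hconf
  rw [hsel₁, evalT_nil_ofFn, hFdef, selectT_ofFn outC inC _ hV, evalT_nil_ofFn] at hle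
  have hloss := hv.utility_le hM (h.choose_mono S)
  -- Optimality of S enters here: it bounds the utility of all subsets of S, and so turns the loss
  -- 16/√M into a relative loss 32/√M.
  have hhalf : ((∑ i, halfUtil (choose outC inC S) i : ℚ) : ℝ) ≤
      2 * (utility (choose outC inC S) : ℝ) := by
    exact_mod_cast h.sum_halfUtil_le S _ hopt
  have hobjle : ((∑ i, objective M v (choose outC inC S i) : ℚ) : ℝ) ≤
      (utility (choose outC inC
        (Finset.univ.filter fun i : Fin n => (configureT M F₀).val[(i : ℕ)]? = some 1)) : ℝ) := by
    exact_mod_cast hge.trans (hle₁.trans hle)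
  have h16 : 0 ≤ 16 / √(M : ℝ) := by positivity
  have := mul_le_mul_of_nonneg_left hhalf h16
  have e : (1 - 32 / √(M : ℝ)) * (utility (choose outC inC S) : ℝ) =
      (utility (choose outC inC S) : ℝ) -
        16 / √(M : ℝ) * (2 * (utility (choose outC inC S) : ℝ)) := by ring
  rw [e]
  linarith

theorem IsChoice.utility_nonneg {n : ℕ} {cf : Fin n → Config} (h : IsChoice cf) : 0 ≤ utility cf :=
  Finset.sum_nonneg fun i _ => ex_nonneg (h.pr_nonneg i) fun t ht =>
    mul_nonneg (h.uP_nonneg i t ht) (Finset.prod_nonneg fun k _ => cdf_nonneg (h.pr_nonneg k) _)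

/-- Compares with a best assortment S₀ instead of S, since the loss estimate is only available for
an optimum. -/
theorem revenue_ptas_ge (M : ℕ) (hM : 1 ≤ M) (I : Inst) (hI : I.Valid)
    (S : Finset (Fin I.items.length)) :
    (1 - 32 / √(M : ℝ)) * (I.revenue S : ℝ) ≤ (I.revenue (I.stocked (ptas M I).val) : ℝ) := by
  obtain ⟨outC, inC, κ, P, href, hF⟩ := exists_isRefinement M hM I hI
  have hmod := href.isModel hI
  have hrev : ∀ R, I.revenue R = utility (choose outC inC R) := fun R =>
    (href.utility_choose hI R).symm
  have hnn : ∀ R, (0 : ℝ) ≤ (I.revenue R : ℝ) := by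
    intro R
    rw [hrev]
    exact_mod_cast (hmod.isChoice R).utility_nonneg
  rcases le_or_gt √(M : ℝ) 32 with hs | hs
  -- For √M ≤ 32 the factor is nonpositive, and nonnegativity of the revenue suffices. This also
  -- disposes of M = 1, where the coefficients have denominator 0.
  · have hM0 : (0 : ℝ) < √(M : ℝ) := Real.sqrt_pos.2 (by exact_mod_cast hM)
    have h1 : 1 - 32 / √(M : ℝ) ≤ 0 := by
      have : 1 ≤ 32 / √(M : ℝ) := by rw [le_div_iff₀ hM0]; linarith
      linarith
    exact (mul_nonpos_of_nonpos_of_nonneg h1 (hnn S)).trans (hnn _)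
  have h1 : 0 ≤ 1 - 32 / √(M : ℝ) := by
    have : 32 / √(M : ℝ) ≤ 1 := by rw [div_le_one (by linarith)]; linarith
    linarith
  have hM1 : 1 < M := by
    by_contra hcon
    have : M = 1 := by omega
    subst this
    norm_num at hs
  obtain ⟨S₀, -, hS₀⟩ := Finset.exists_max_image (Finset.univ : Finset (Finset (Fin I.items.length)))
    (fun R => I.revenue R) ⟨∅, Finset.mem_univ _⟩
  have hSS : (I.revenue S : ℝ) ≤ (I.revenue S₀ : ℝ) := by
    exact_mod_cast hS₀ S (Finset.mem_univ _)
  refine (mul_le_mul_of_nonneg_left hSS h1).trans ?_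
  rcases S₀.eq_empty_or_nonempty with he | hne
  · have : I.revenue S₀ = 0 := by rw [hrev, he, hmod.utility_choose, Finset.sum_empty]
    rw [this, Rat.cast_zero, mul_zero]
    exact hnn _
  · rw [hrev, hrev]
    exact hmod.configureT_ge hM1 hne (fun R => by
      rw [← hrev, ← hrev]; exact hS₀ R (Finset.mem_univ _)) _ hF

/-! ### Polynomially bounded functions -/

/-- Bounded by a polynomial with natural coefficients. -/
@[fun_prop]
def PB (f : ℕ → ℕ) : Prop := ∃ P : Polynomial ℕ, ∀ s, f s ≤ P.eval s

theorem polynomial_eval_mono (P : Polynomial ℕ) {a b : ℕ} (h : a ≤ b) : P.eval a ≤ P.eval b := by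
  rw [Polynomial.eval_eq_sum, Polynomial.eval_eq_sum]
  exact Finset.sum_le_sum fun i _ => Nat.mul_le_mul_left _ (Nat.pow_le_pow_left h i)

namespace PB

@[fun_prop]
theorem id' : PB fun s => s := ⟨Polynomial.X, fun s => by simp⟩

@[fun_prop]
theorem const (c : ℕ) : PB fun _ => c := ⟨Polynomial.C c, fun s => by simp⟩

@[fun_prop]
theorem comp {f g : ℕ → ℕ} (hf : PB f) (hg : PB g) : PB fun s => f (g s) := by
  obtain ⟨P, hP⟩ := hf
  obtain ⟨Q, hQ⟩ := hg
  exact ⟨P.comp Q, fun s => (hP _).trans (by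
    rw [Polynomial.eval_comp]; exact polynomial_eval_mono P (hQ s))⟩

@[fun_prop]
theorem add {f g : ℕ → ℕ} (hf : PB f) (hg : PB g) : PB fun s => f s + g s := by
  obtain ⟨P, hP⟩ := hf
  obtain ⟨Q, hQ⟩ := hg
  exact ⟨P + Q, fun s => by rw [Polynomial.eval_add]; exact Nat.add_le_add (hP s) (hQ s)⟩

@[fun_prop]
theorem mul {f g : ℕ → ℕ} (hf : PB f) (hg : PB g) : PB fun s => f s * g s := by
  obtain ⟨P, hP⟩ := hf
  obtain ⟨Q, hQ⟩ := hg
  exact ⟨P * Q, fun s => by rw [Polynomial.eval_mul]; exact Nat.mul_le_mul (hP s) (hQ s)⟩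

@[fun_prop]
theorem pow {f : ℕ → ℕ} (hf : PB f) (k : ℕ) : PB fun s => f s ^ k := by
  obtain ⟨P, hP⟩ := hf
  exact ⟨P ^ k, fun s => by rw [Polynomial.eval_pow]; exact Nat.pow_le_pow_left (hP s) k⟩

end PB

/-! ### Heights of rational numbers -/

theorem size_mul_le (a b : ℕ) : (a * b).size ≤ a.size + b.size := by
  rcases Nat.eq_zero_or_pos a with rfl | ha
  · simp
  rw [Nat.size_le, pow_add]
  exact Nat.mul_lt_mul'' (Nat.lt_size_self a) (Nat.lt_size_self b)

theorem size_add_le_max (a b : ℕ) : (a + b).size ≤ max a.size b.size + 1 := by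
  rw [Nat.size_le, pow_succ]
  have h1 : a < 2 ^ max a.size b.size :=
    (Nat.lt_size_self a).trans_le (Nat.pow_le_pow_right (by norm_num) (le_max_left _ _))
  have h2 : b < 2 ^ max a.size b.size :=
    (Nat.lt_size_self b).trans_le (Nat.pow_le_pow_right (by norm_num) (le_max_right _ _))
  omega

theorem nat_size_le_self (n : ℕ) : n.size ≤ n := by
  rw [Nat.size_le]; exact Nat.lt_two_pow_self

/-- The larger one of the bit lengths of the numerator and the denominator. -/
def height (x : ℚ) : ℕ := max x.num.natAbs.size x.den.size

theorem height_le_ratSize (x : ℚ) : height x ≤ ratSize x := by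
  unfold height ratSize; omega

theorem ratSize_le_height (x : ℚ) : ratSize x ≤ 2 * height x + 1 := by
  unfold height ratSize; omega

/-- Reduction to lowest terms replaces numerator and denominator by divisors. It therefore suffices
to bound the schoolbook fraction of a sum, product or inverse. -/
theorem height_divInt_le (a b : ℤ) (hb : b ≠ 0) :
    height (Rat.divInt a b) ≤ max a.natAbs.size b.natAbs.size := by
  refine max_le_max (Nat.size_le_size ?_) (Nat.size_le_size ?_)
  · rcases eq_or_ne a 0 with rfl | ha
    · simp
    · exact Nat.le_of_dvd (Int.natAbs_pos.2 ha) (Int.natAbs_dvd_natAbs.2 (Rat.num_dvd a hb))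
  · have h := Int.natAbs_dvd_natAbs.2 (Rat.den_dvd a b)
    rw [Int.natAbs_natCast] at h
    exact Nat.le_of_dvd (Int.natAbs_pos.2 hb) h

theorem height_mul (x y : ℚ) : height (x * y) ≤ height x + height y := by
  have h : x * y = Rat.divInt (x.num * y.num) (x.den * y.den) := by
    rw [← Rat.divInt_mul_divInt, Rat.num_divInt_den, Rat.num_divInt_den]
  rw [h]
  refine (height_divInt_le _ _ (by positivity)).trans ?_
  rw [Int.natAbs_mul, Int.natAbs_mul, Int.natAbs_natCast, Int.natAbs_natCast]
  have h1 := size_mul_le x.num.natAbs y.num.natAbs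
  have h2 := size_mul_le x.den y.den
  unfold height; omega

theorem height_add (x y : ℚ) : height (x + y) ≤ height x + height y + 1 := by
  have h : x + y = Rat.divInt (x.num * y.den + y.num * x.den) (x.den * y.den) := by
    rw [← Rat.divInt_add_divInt _ _ (by positivity) (by positivity), Rat.num_divInt_den,
      Rat.num_divInt_den]
  rw [h]
  refine (height_divInt_le _ _ (by positivity)).trans ?_
  rw [Int.natAbs_mul, Int.natAbs_natCast, Int.natAbs_natCast]
  have h0 := Nat.size_le_size (Int.natAbs_add_le (x.num * y.den) (y.num * x.den))
  rw [Int.natAbs_mul, Int.natAbs_mul, Int.natAbs_natCast, Int.natAbs_natCast] at h0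
  have h1 := size_mul_le x.num.natAbs y.den
  have h2 := size_mul_le y.num.natAbs x.den
  have h3 := size_add_le_max (x.num.natAbs * y.den) (y.num.natAbs * x.den)
  have h4 := size_mul_le x.den y.den
  unfold height; omega

theorem height_neg (x : ℚ) : height (-x) = height x := by simp [height]

theorem height_sub (x y : ℚ) : height (x - y) ≤ height x + height y + 1 := by
  rw [sub_eq_add_neg, ← height_neg y]; exact height_add _ _

theorem height_inv (x : ℚ) : height x⁻¹ ≤ height x := by
  rcases eq_or_ne x 0 with rfl | hx
  · simp
  have h : x⁻¹ = Rat.divInt x.den x.num := by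
    conv_lhs => rw [← Rat.num_divInt_den x]
    exact Rat.inv_divInt _ _
  rw [h]
  refine (height_divInt_le _ _ (Rat.num_ne_zero.2 hx)).trans ?_
  rw [Int.natAbs_natCast]
  unfold height; omega

theorem height_div (x y : ℚ) : height (x / y) ≤ height x + height y := by
  rw [div_eq_mul_inv]
  exact (height_mul _ _).trans (Nat.add_le_add_left (height_inv y) _)

theorem height_natCast (n : ℕ) : height n ≤ n.size + 1 := by
  unfold height
  simp

theorem size_floor_le (x : ℚ) : ⌊x⌋₊.size ≤ height x := by
  refine (Nat.size_le_size ?_).trans (le_max_left _ _)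
  rcases le_or_gt 0 x with hx | hx
  · refine Nat.floor_le_of_le ?_
    have h1 : (x.num.natAbs : ℚ) = x.num := by
      rw [Nat.cast_natAbs, abs_of_nonneg (Rat.num_nonneg.2 hx)]
    rw [h1]
    have h2 : x = x.num / x.den := (Rat.num_div_den x).symm
    have h3 : (1 : ℚ) ≤ x.den := by exact_mod_cast x.den_pos
    have h4 : (0 : ℚ) ≤ x.num := by exact_mod_cast Rat.num_nonneg.2 hx
    calc x = x.num / x.den := h2
      _ ≤ x.num := div_le_self h4 h3
  · rw [Nat.floor_of_nonpos hx.le]; exact Nat.zero_le _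

/-! ### Objects of bounded size -/

/-- `bd s x`: all numbers in `x` have at most `s` bits and all lists have at most `s` entries. -/
class Sized (α : Type) where
  bd : ℕ → α → Prop
  mono : ∀ {s t : ℕ} {x : α}, s ≤ t → bd s x → bd t x
  ex : ∀ x : α, ∃ s, bd s x

open Sized (bd)

section Instances

variable {α β : Type} [Sized α] [Sized β]

/-- The bound is on the bit length, not on the value. Counters that control the length of a list
therefore need separate bounds on their values. -/
instance : Sized ℕ where
  bd s n := n.size ≤ s
  mono h h' := le_trans h' h
  ex _ := ⟨_, le_rfl⟩

instance : Sized ℚ where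
  bd s x := height x ≤ s
  mono h h' := le_trans h' h
  ex _ := ⟨_, le_rfl⟩

instance : Sized Bool := ⟨fun _ _ => True, fun _ _ => trivial, fun _ => ⟨0, trivial⟩⟩

instance : Sized Unit := ⟨fun _ _ => True, fun _ _ => trivial, fun _ => ⟨0, trivial⟩⟩

instance : Sized (WithBot ℚ) where
  bd s u := utilSize u ≤ s
  mono h h' := le_trans h' h
  ex _ := ⟨_, le_rfl⟩

instance : Sized (α × β) where
  bd s x := bd s x.1 ∧ bd s x.2
  mono h h' := ⟨Sized.mono h h'.1, Sized.mono h h'.2⟩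
  ex x := by
    obtain ⟨s, hs⟩ := Sized.ex x.1
    obtain ⟨t, ht⟩ := Sized.ex x.2
    exact ⟨s + t, Sized.mono (by omega) hs, Sized.mono (by omega) ht⟩

instance : Sized (Option α) where
  bd s x := ∀ a, x = some a → bd s a
  mono h h' := fun a ha => Sized.mono h (h' a ha)
  ex x := by
    cases x with
    | none => exact ⟨0, by simp⟩
    | some a =>
      obtain ⟨s, hs⟩ := Sized.ex a
      exact ⟨s, by rintro _ ⟨⟩; exact hs⟩

instance : Sized (List α) where
  bd s l := l.length ≤ s ∧ ∀ a ∈ l, bd s a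
  mono h h' := ⟨h'.1.trans h, fun a ha => Sized.mono h (h'.2 a ha)⟩
  ex l := by
    induction l with
    | nil => exact ⟨0, by simp⟩
    | cons a l ih =>
      obtain ⟨s, hs⟩ := ih
      obtain ⟨t, ht⟩ := Sized.ex a
      refine ⟨s + t + 1, by simp; omega, ?_⟩
      intro b hb
      rcases List.mem_cons.1 hb with rfl | hb
      · exact Sized.mono (by omega) ht
      · exact Sized.mono (by omega) (hs.2 b hb)

instance : Sized Mass where
  bd s t := bd s t.uA ∧ bd s t.uP ∧ bd s t.pr
  mono h h' := ⟨Sized.mono h h'.1, Sized.mono h h'.2.1, Sized.mono h h'.2.2⟩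
  ex t := by
    obtain ⟨s, hs⟩ := Sized.ex (t.uA, t.uP, t.pr)
    exact ⟨s, hs⟩

instance : Sized Tagged where
  bd s t := bd s t.act ∧ bd s t.cfg ∧ bd s t.mass
  mono h h' := ⟨Sized.mono h h'.1, Sized.mono h h'.2.1, Sized.mono h h'.2.2⟩
  ex t := by
    obtain ⟨s, hs⟩ := Sized.ex (t.act, t.cfg, t.mass)
    exact ⟨s, hs⟩

instance : Sized Bin where
  bd s b := bd s b.idx ∧ bd s b.lo ∧ bd s b.hi
  mono h h' := ⟨Sized.mono h h'.1, Sized.mono h h'.2.1, Sized.mono h h'.2.2⟩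
  ex b := by
    obtain ⟨s, hs⟩ := Sized.ex (b.idx, b.lo, b.hi)
    exact ⟨s, hs⟩

instance : Sized Item where
  bd s t := bd s t.price ∧ bd s t.dist
  mono h h' := ⟨Sized.mono h h'.1, Sized.mono h h'.2⟩
  ex t := by
    obtain ⟨s, hs⟩ := Sized.ex (t.price, t.dist)
    exact ⟨s, hs⟩

end Instances

/-- The size of the value is polynomially bounded. -/
class PolyF {α β : Type} [Sized α] [Sized β] (f : α → β) : Prop where
  out : ∃ B, PB B ∧ ∀ s x, bd s x → bd (B s) (f x)

/-- The size of the value and the number of steps are polynomially bounded. -/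
class PolyT {α β : Type} [Sized α] [Sized β] (f : α → Timed β) : Prop where
  out : ∃ B, PB B ∧ ∀ s x, bd s x → (f x).steps ≤ B s ∧ bd (B s) (f x).val

/-! ### Closure rules for polynomial bounds, arranged for instance search -/

section Calculus

variable {α β γ δ : Type} [Sized α] [Sized β] [Sized γ] [Sized δ]

instance (priority := 100) (f : α → β) (g : α → γ) [hf : PolyF f] [hg : PolyF g] :
    PolyF fun a => (f a, g a) := by
  obtain ⟨B, hB, hf⟩ := hf
  obtain ⟨C, hC, hg⟩ := hg
  exact ⟨fun s => B s + C s, by fun_prop, fun s x hx =>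
    ⟨Sized.mono (Nat.le_add_right _ _) (hf s x hx), Sized.mono (Nat.le_add_left _ _) (hg s x hx)⟩⟩

instance (priority := 100) (f : α → WithBot ℚ) (g h : α → ℚ) [hf : PolyF f] [hg : PolyF g] [hh : PolyF h] :
    PolyF fun a => (⟨f a, g a, h a⟩ : Mass) := by
  obtain ⟨B, hB, h'⟩ := (inferInstance : PolyF fun a => (f a, g a, h a))
  exact ⟨B, hB, fun s x hx => h' s x hx⟩

instance (priority := 100) (f g : α → ℕ) (h : α → Mass) [hf : PolyF f] [hg : PolyF g] [hh : PolyF h] :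
    PolyF fun a => (⟨f a, g a, h a⟩ : Tagged) := by
  obtain ⟨B, hB, h'⟩ := (inferInstance : PolyF fun a => (f a, g a, h a))
  exact ⟨B, hB, fun s x hx => h' s x hx⟩

instance (b : β) : PolyF fun _ : α => b := by
  obtain ⟨s, hs⟩ := Sized.ex b
  exact ⟨fun _ => s, by fun_prop, fun _ _ _ => hs⟩

instance (f : α → β) (g : α → List β) [hf : PolyF f] [hg : PolyF g] :
    PolyF fun a => f a :: g a := by
  obtain ⟨B, hB, hf⟩ := hf
  obtain ⟨C, hC, hg⟩ := hg
  refine ⟨fun s => B s + C s + 1, by fun_prop, fun s x hx => ⟨?_, fun b hb => ?_⟩⟩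
  · have := (hg s x hx).1
    simp only [List.length_cons]; omega
  · rcases List.mem_cons.1 hb with rfl | hb
    · exact Sized.mono (by dsimp only; omega) (hf s x hx)
    · exact Sized.mono (by dsimp only; omega) ((hg s x hx).2 b hb)

instance (f : α → β) [hf : PolyF f] : PolyF fun a => some (f a) := by
  obtain ⟨B, hB, hf⟩ := hf
  exact ⟨B, hB, fun s x hx => by rintro _ ⟨⟩; exact hf s x hx⟩

instance (f : α → ℚ) [hf : PolyF f] : PolyF fun a => (f a : WithBot ℚ) := by
  obtain ⟨B, hB, hf⟩ := hf
  refine ⟨fun s => 2 * B s + 1, by fun_prop, fun s x hx => ?_⟩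
  have h1 : height (f x) ≤ B s := hf s x hx
  have h2 := ratSize_le_height (f x)
  change ratSize (f x) ≤ 2 * B s + 1
  omega

instance (f : α → β × γ) [h : PolyF f] : PolyF fun a => (f a).1 := by
  obtain ⟨B, hB, h⟩ := h
  exact ⟨B, hB, fun s x hx => (h s x hx).1⟩

instance (f : α → β × γ) [h : PolyF f] : PolyF fun a => (f a).2 := by
  obtain ⟨B, hB, h⟩ := h
  exact ⟨B, hB, fun s x hx => (h s x hx).2⟩

instance (f : α → Tagged) [h : PolyF f] : PolyF fun a => (f a).act := by
  obtain ⟨B, hB, h⟩ := h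
  exact ⟨B, hB, fun s x hx => (h s x hx).1⟩

instance (f : α → Tagged) [h : PolyF f] : PolyF fun a => (f a).cfg := by
  obtain ⟨B, hB, h⟩ := h
  exact ⟨B, hB, fun s x hx => (h s x hx).2.1⟩

instance (f : α → Tagged) [h : PolyF f] : PolyF fun a => (f a).mass := by
  obtain ⟨B, hB, h⟩ := h
  exact ⟨B, hB, fun s x hx => (h s x hx).2.2⟩

instance (f : α → Mass) [h : PolyF f] : PolyF fun a => (f a).uA := by
  obtain ⟨B, hB, h⟩ := h
  exact ⟨B, hB, fun s x hx => (h s x hx).1⟩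

instance (f : α → Mass) [h : PolyF f] : PolyF fun a => (f a).uP := by
  obtain ⟨B, hB, h⟩ := h
  exact ⟨B, hB, fun s x hx => (h s x hx).2.1⟩

instance (f : α → Mass) [h : PolyF f] : PolyF fun a => (f a).pr := by
  obtain ⟨B, hB, h⟩ := h
  exact ⟨B, hB, fun s x hx => (h s x hx).2.2⟩

instance (f : α → Bin) [h : PolyF f] : PolyF fun a => (f a).idx := by
  obtain ⟨B, hB, h⟩ := h
  exact ⟨B, hB, fun s x hx => (h s x hx).1⟩

instance (f : α → Bin) [h : PolyF f] : PolyF fun a => (f a).lo := by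
  obtain ⟨B, hB, h⟩ := h
  exact ⟨B, hB, fun s x hx => (h s x hx).2.1⟩

instance (f : α → Bin) [h : PolyF f] : PolyF fun a => (f a).hi := by
  obtain ⟨B, hB, h⟩ := h
  exact ⟨B, hB, fun s x hx => (h s x hx).2.2⟩

instance (f : α → Item) [h : PolyF f] : PolyF fun a => (f a).price := by
  obtain ⟨B, hB, h⟩ := h
  exact ⟨B, hB, fun s x hx => (h s x hx).1⟩

instance (f : α → Item) [h : PolyF f] : PolyF fun a => (f a).dist := by
  obtain ⟨B, hB, h⟩ := h
  exact ⟨B, hB, fun s x hx => (h s x hx).2⟩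

instance : PolyF fun a : α => a := ⟨fun s => s, by fun_prop, fun _ _ h => h⟩

instance (f : α → β) [hf : PolyF f] : PolyT fun a => (pure (f a) : Timed β) := by
  obtain ⟨B, hB, hf⟩ := hf
  exact ⟨B, hB, fun s x hx => ⟨Nat.zero_le _, hf s x hx⟩⟩

/-- The continuation is measured on the pair of the input and the intermediate result, a pair of
size s + B s; polynomials are closed under this substitution. Nested binds thus build up an
environment of pairs. -/
instance (f : α → Timed β) (g : α → β → Timed γ) [hf : PolyT f]
    [hg : PolyT fun p : α × β => g p.1 p.2] : PolyT fun a => f a >>= g a := by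
  obtain ⟨B, hB, hf⟩ := hf
  obtain ⟨C, hC, hg⟩ := hg
  refine ⟨fun s => B s + C (s + B s), by fun_prop, fun s x hx => ?_⟩
  obtain ⟨h1, h2⟩ := hf s x hx
  obtain ⟨h3, h4⟩ := hg (s + B s) (x, (f x).val)
    ⟨Sized.mono (Nat.le_add_right _ _) hx, Sized.mono (Nat.le_add_left _ _) h2⟩
  exact ⟨Nat.add_le_add h1 h3, Sized.mono (Nat.le_add_left _ _) h4⟩

instance (p : α → Prop) [DecidablePred p] (f g : α → Timed β) [hf : PolyT f] [hg : PolyT g] :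
    PolyT fun a => if p a then f a else g a := by
  obtain ⟨B, hB, hf⟩ := hf
  obtain ⟨C, hC, hg⟩ := hg
  refine ⟨fun s => B s + C s, by fun_prop, fun s x hx => ?_⟩
  obtain ⟨h1, h2⟩ := hf s x hx
  obtain ⟨h3, h4⟩ := hg s x hx
  by_cases h : p x
  · simp only [h, if_true]
    exact ⟨by omega, Sized.mono (Nat.le_add_right _ _) h2⟩
  · simp only [h, if_false]
    exact ⟨by omega, Sized.mono (Nat.le_add_left _ _) h4⟩

theorem PolyT.comp {f : β → Timed γ} {g : α → β} (hf : PolyT f) (hg : PolyF g) :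
    PolyT fun a => f (g a) := by
  obtain ⟨B, hB, hf⟩ := hf
  obtain ⟨C, hC, hg⟩ := hg
  exact ⟨fun s => B (C s), by fun_prop, fun s x hx => hf _ _ (hg s x hx)⟩

theorem PolyT.val {f : α → Timed β} (hf : PolyT f) : PolyF fun a => (f a).val := by
  obtain ⟨B, hB, hf⟩ := hf
  exact ⟨B, hB, fun s x hx => (hf s x hx).2⟩

instance : PolyT fun _ : α => tick := ⟨fun _ => 1, by fun_prop, fun _ _ _ => ⟨le_rfl, trivial⟩⟩

theorem sq_ratSize_le {x y : ℚ} {a b : ℕ} (hx : height x ≤ a) (hy : height y ≤ b) :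
    (ratSize x + ratSize y) ^ 2 ≤ (2 * a + 2 * b + 2) ^ 2 := by
  have h1 := ratSize_le_height x
  have h2 := ratSize_le_height y
  exact Nat.pow_le_pow_left (by omega) 2

theorem polyT_ratOp (op : ℚ → ℚ → Timed ℚ) (hs : ∀ x y, (op x y).steps = (ratSize x + ratSize y) ^ 2)
    (hv : ∀ x y, height (op x y).val ≤ height x + height y + 1) (f g : α → ℚ) [hf : PolyF f]
    [hg : PolyF g] : PolyT fun a => op (f a) (g a) := by
  obtain ⟨B, hB, hf⟩ := hf
  obtain ⟨C, hC, hg⟩ := hg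
  refine ⟨fun s => (2 * B s + 2 * C s + 2) ^ 2 + (B s + C s + 1), by fun_prop, fun s x hx => ?_⟩
  have h1 : height (f x) ≤ B s := hf s x hx
  have h2 : height (g x) ≤ C s := hg s x hx
  refine ⟨?_, ?_⟩
  · rw [hs]
    exact (sq_ratSize_le h1 h2).trans (Nat.le_add_right _ _)
  · refine (hv _ _).trans ?_
    dsimp only; omega

instance (f g : α → ℚ) [PolyF f] [PolyF g] : PolyT fun a => addT (f a) (g a) :=
  polyT_ratOp addT (fun _ _ => rfl) height_add f g

instance (f g : α → ℚ) [PolyF f] [PolyF g] : PolyT fun a => subT (f a) (g a) :=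
  polyT_ratOp subT (fun _ _ => rfl) height_sub f g

instance (f g : α → ℚ) [PolyF f] [PolyF g] : PolyT fun a => mulT (f a) (g a) :=
  polyT_ratOp mulT (fun _ _ => rfl) (fun x y => (height_mul x y).trans (Nat.le_succ _)) f g

instance (f g : α → ℚ) [PolyF f] [PolyF g] : PolyT fun a => divT (f a) (g a) :=
  polyT_ratOp divT (fun _ _ => rfl) (fun x y => (height_div x y).trans (Nat.le_succ _)) f g

theorem polyT_ratCmp (op : ℚ → ℚ → Timed Bool)
    (hs : ∀ x y, (op x y).steps = (ratSize x + ratSize y) ^ 2) (f g : α → ℚ) [hf : PolyF f]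
    [hg : PolyF g] : PolyT fun a => op (f a) (g a) := by
  obtain ⟨B, hB, hf⟩ := hf
  obtain ⟨C, hC, hg⟩ := hg
  refine ⟨fun s => (2 * B s + 2 * C s + 2) ^ 2, by fun_prop, fun s x hx => ⟨?_, trivial⟩⟩
  rw [hs]
  exact sq_ratSize_le (hf s x hx) (hg s x hx)

instance (f g : α → ℚ) [PolyF f] [PolyF g] : PolyT fun a => leT (f a) (g a) :=
  polyT_ratCmp leT (fun _ _ => rfl) f g

instance (f g : α → ℚ) [PolyF f] [PolyF g] : PolyT fun a => ltT (f a) (g a) :=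
  polyT_ratCmp ltT (fun _ _ => rfl) f g

instance (f : α → ℚ) [hf : PolyF f] : PolyT fun a => floorT (f a) := by
  obtain ⟨B, hB, hf⟩ := hf
  refine ⟨fun s => (2 * B s + 1) ^ 2 + B s, by fun_prop, fun s x hx => ?_⟩
  have h1 : height (f x) ≤ B s := hf s x hx
  have h2 := ratSize_le_height (f x)
  refine ⟨le_trans (Nat.pow_le_pow_left (show ratSize (f x) ≤ 2 * B s + 1 by omega) 2)
    (Nat.le_add_right _ _), ?_⟩
  exact (size_floor_le _).trans (by dsimp only; omega)

instance (f : α → ℕ) [hf : PolyF f] : PolyT fun a => castT (f a) := by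
  obtain ⟨B, hB, hf⟩ := hf
  refine ⟨fun s => B s + 1, by fun_prop, fun s x hx => ?_⟩
  have h1 : (f x).size ≤ B s := hf s x hx
  exact ⟨Nat.succ_le_succ h1, (height_natCast _).trans (Nat.succ_le_succ h1)⟩

instance (f g : α → ℕ) [hf : PolyF f] [hg : PolyF g] : PolyT fun a => natAddT (f a) (g a) := by
  obtain ⟨B, hB, hf⟩ := hf
  obtain ⟨C, hC, hg⟩ := hg
  refine ⟨fun s => B s + C s + 1, by fun_prop, fun s x hx => ?_⟩
  have h1 : (f x).size ≤ B s := hf s x hx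
  have h2 : (g x).size ≤ C s := hg s x hx
  have h3 := size_add_le_max (f x) (g x)
  refine ⟨?_, ?_⟩
  · change (f x).size + (g x).size + 1 ≤ B s + C s + 1; omega
  · change (f x + g x).size ≤ B s + C s + 1; omega

instance (f g : α → ℕ) [hf : PolyF f] [hg : PolyF g] : PolyT fun a => natMulT (f a) (g a) := by
  obtain ⟨B, hB, hf⟩ := hf
  obtain ⟨C, hC, hg⟩ := hg
  refine ⟨fun s => (B s + C s + 1) ^ 2, by fun_prop, fun s x hx => ?_⟩
  have h1 : (f x).size ≤ B s := hf s x hx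
  have h2 : (g x).size ≤ C s := hg s x hx
  have h3 := size_mul_le (f x) (g x)
  refine ⟨Nat.pow_le_pow_left (by omega) 2, ?_⟩
  change (f x * g x).size ≤ _
  nlinarith

instance (f g : α → ℕ) [hf : PolyF f] [hg : PolyF g] : PolyT fun a => natEqT (f a) (g a) := by
  obtain ⟨B, hB, hf⟩ := hf
  obtain ⟨C, hC, hg⟩ := hg
  refine ⟨fun s => B s + C s + 1, by fun_prop, fun s x hx => ⟨?_, trivial⟩⟩
  have h1 : (f x).size ≤ B s := hf s x hx
  have h2 : (g x).size ≤ C s := hg s x hx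
  change (f x).size + (g x).size + 1 ≤ B s + C s + 1; omega

instance (f g : α → WithBot ℚ) [hf : PolyF f] [hg : PolyF g] :
    PolyT fun a => utilLtT (f a) (g a) := by
  obtain ⟨B, hB, hf⟩ := hf
  obtain ⟨C, hC, hg⟩ := hg
  exact ⟨fun s => (B s + C s) ^ 2, by fun_prop, fun s x hx =>
    ⟨Nat.pow_le_pow_left (Nat.add_le_add (hf s x hx) (hg s x hx)) 2, trivial⟩⟩

instance (f : α → WithBot ℚ) (g : α → ℚ) [hf : PolyF f] [hg : PolyF g] :
    PolyT fun a => utilAddT (f a) (g a) := by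
  obtain ⟨B, hB, hf⟩ := hf
  obtain ⟨C, hC, hg⟩ := hg
  refine ⟨fun s => (B s + (2 * C s + 1)) ^ 2 + (2 * (B s + C s + 1) + 1), by fun_prop,
    fun s x hx => ?_⟩
  have h1 : utilSize (f x) ≤ B s := hf s x hx
  have h2 : height (g x) ≤ C s := hg s x hx
  have h3 := ratSize_le_height (g x)
  refine ⟨le_trans (Nat.pow_le_pow_left (show utilSize (f x) + ratSize (g x) ≤ B s + (2 * C s + 1)
    by omega) 2) (Nat.le_add_right _ _), ?_⟩
  change utilSize (f x + ((g x : ℚ) : WithBot ℚ)) ≤ _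
  refine le_trans ?_ (Nat.le_add_left _ _)
  rcases hfx : f x with _ | y
  · change 1 ≤ _; omega
  · rw [hfx] at h1
    have h1 : ratSize y ≤ B s := h1
    have h4 := height_le_ratSize y
    have h5 := height_add y (g x)
    change ratSize (y + g x) ≤ _
    have := ratSize_le_height (y + g x)
    omega

instance (f : α → Timed Bool) [hf : PolyT f] : PolyT fun a => notT (f a) := by
  unfold notT
  obtain ⟨B, hB, hf⟩ := hf
  exact ⟨B, hB, fun s x hx => ⟨(hf s x hx).1, trivial⟩⟩

instance (f g : α → Timed Bool) [hf : PolyT f] [hg : PolyT g] :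
    PolyT fun a => andT (f a) (g a) := by
  unfold andT
  have : PolyT fun p : α × Bool => g p.1 := hg.comp inferInstance
  infer_instance

end Calculus

/-! ### Step counts of the list operations -/

section Steps

variable {α β : Type}

theorem mapT_steps_le (f : α → Timed β) (l : List α) (c : ℕ) (h : ∀ a ∈ l, (f a).steps ≤ c) :
    (mapT f l).steps ≤ l.length * (c + 1) + 1 := by
  induction l with
  | nil => simp [mapT]
  | cons a l ih =>
    have h1 := h a (by simp)
    have h2 := ih fun b hb => h b (by simp [hb])
    simp only [mapT, steps_bind, steps_tick, steps_pure, List.length_cons, Nat.succ_mul]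
    omega

theorem filterT_steps_le (f : α → Timed Bool) (l : List α) (c : ℕ)
    (h : ∀ a ∈ l, (f a).steps ≤ c) : (filterT f l).steps ≤ l.length * (c + 1) + 1 := by
  induction l with
  | nil => simp [filterT]
  | cons a l ih =>
    have h1 := h a (by simp)
    have h2 := ih fun b hb => h b (by simp [hb])
    have h3 (b : Bool) (x y : List α) :
        (if b = true then (pure x : Timed (List α)) else pure y).steps = 0 := by cases b <;> rfl
    simp only [filterT, steps_bind, steps_tick, h3, List.length_cons, Nat.succ_mul]
    omega

theorem appendT_steps (l r : List α) : (appendT l r).steps = l.length + 1 := by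
  induction l with
  | nil => simp [appendT]
  | cons a l ih =>
    simp only [appendT, steps_bind, steps_tick, steps_pure, List.length_cons, ih]
    omega

theorem flatMapT_steps_le (f : α → Timed (List β)) (l : List α) (c d : ℕ)
    (h : ∀ a ∈ l, (f a).steps ≤ c ∧ (f a).val.length ≤ d) :
    (flatMapT f l).steps ≤ l.length * (c + d + 2) + 1 := by
  induction l with
  | nil => simp [flatMapT]
  | cons a l ih =>
    obtain ⟨h1, h2⟩ := h a (by simp)
    have h3 := ih fun b hb => h b (by simp [hb])
    simp only [flatMapT, steps_bind, steps_tick, appendT_steps, List.length_cons, Nat.succ_mul]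
    omega

theorem length_flatMap_le (f : α → List β) (l : List α) (d : ℕ)
    (h : ∀ a ∈ l, (f a).length ≤ d) : (l.flatMap f).length ≤ l.length * d := by
  induction l with
  | nil => simp
  | cons a l ih =>
    have h1 := h a (by simp)
    have h2 := ih fun b hb => h b (by simp [hb])
    simp only [List.flatMap_cons, List.length_append, List.length_cons, Nat.succ_mul]
    omega

theorem lengthT_steps_le (l : List α) : (lengthT l).steps ≤ l.length * (l.length + 3) + 1 := by
  induction l with
  | nil => simp [lengthT]
  | cons a l ih =>
    have h1 := nat_size_le_self l.length
    have h2 : (natAddT l.length 1).steps = l.length.size + Nat.size 1 + 1 := rfl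
    simp only [lengthT, steps_bind, steps_tick, List.length_cons, lengthT_val, h2, Nat.size_one]
    nlinarith

theorem size_succ_le (i : ℕ) : (i + 1).size ≤ i.size + 1 := by
  have h := size_add_le_max i 1
  rcases Nat.eq_zero_or_pos i with rfl | hi
  · simp
  · have := Nat.size_pos.2 hi
    rw [Nat.size_one] at h
    omega

theorem size_add_le_size_add (i k : ℕ) : (i + k).size ≤ i.size + k := by
  induction k with
  | zero => simp
  | succ k ih => exact (size_succ_le (i + k)).trans (by omega)

theorem enumT_steps_le (i : ℕ) (l : List α) :
    (enumT i l).steps ≤ l.length * (i.size + l.length + 4) + 1 := by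
  induction l generalizing i with
  | nil => simp [enumT]
  | cons a l ih =>
    have h1 := ih (i + 1)
    have h2 : (natAddT i 1).steps = i.size + Nat.size 1 + 1 := rfl
    have h3 := size_succ_le i
    simp only [enumT, steps_bind, steps_tick, steps_pure, List.length_cons, natAddT_val, h2,
      Nat.size_one]
    nlinarith

theorem getT_steps_le (l : List α) (i : ℕ) : (getT l i).steps ≤ l.length + 1 := by
  induction l generalizing i with
  | nil => simp [getT]
  | cons a l ih =>
    cases i with
    | zero => simp [getT]
    | succ i =>
      have := ih i
      simp only [getT, steps_bind, steps_tick, List.length_cons]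
      omega

theorem downToT_steps_le (k : ℕ) : (downToT k).steps ≤ k * (k + 3) + 1 := by
  induction k with
  | zero => simp [downToT]
  | succ k ih =>
    have h1 := nat_size_le_self k
    have h2 : (natAddT k 1).steps = k.size + Nat.size 1 + 1 := rfl
    simp only [downToT, steps_bind, steps_tick, steps_pure, h2, Nat.size_one]
    nlinarith

theorem downToT_length (k : ℕ) : (downToT k).val.length = k + 1 := by
  induction k with
  | zero => rfl
  | succ k ih => simpa [downToT] using ih

/-- The invariant depends on the number of completed iterations, so the state may grow along the
loop as long as each step stays below the uniform cost c. -/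
theorem foldT_induction (f : β → α → Timed β) (Inv : ℕ → β → Prop) (c : ℕ) (l : List α)
    (h : ∀ i < l.length, ∀ b, Inv i b → ∀ a ∈ l, (f b a).steps ≤ c ∧ Inv (i + 1) (f b a).val)
    (b : β) (hb : Inv 0 b) :
    (foldT f b l).steps ≤ l.length * (c + 1) + 1 ∧ Inv l.length (foldT f b l).val := by
  induction l generalizing b Inv with
  | nil => simpa [foldT] using hb
  | cons a l ih =>
    obtain ⟨h1, h2⟩ := h 0 (by simp) b hb a (by simp)
    obtain ⟨h3, h4⟩ := ih (fun i => Inv (i + 1))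
      (fun i hi b hb a ha => h (i + 1) (by simpa using hi) b hb a (by simp [ha])) _ h2
    simp only [foldT, steps_bind, steps_tick, List.length_cons, Nat.succ_mul, val_bind]
    exact ⟨by omega, h4⟩

end Steps

/-! ### Polynomial bounds for list operations and loops -/

section Lists

variable {α β γ δ : Type} [Sized α] [Sized β] [Sized γ] [Sized δ]

instance (f : α → β → Timed γ) (l : α → List β) [hf : PolyT fun p : α × β => f p.1 p.2]
    [hl : PolyF l] : PolyT fun a => mapT (f a) (l a) := by
  obtain ⟨B, hB, hf⟩ := hf
  obtain ⟨C, hC, hl⟩ := hl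
  refine ⟨fun s => C s * (B (s + C s) + 1) + 1 + B (s + C s), by fun_prop, fun s x hx => ?_⟩
  obtain ⟨h1, h2⟩ := hl s x hx
  have h3 (b) (hb : b ∈ l x) := hf (s + C s) (x, b)
    ⟨Sized.mono (Nat.le_add_right _ _) hx, Sized.mono (Nat.le_add_left _ _) (h2 b hb)⟩
  have h4 := Nat.mul_le_mul_right (B (s + C s) + 1) h1
  refine ⟨(mapT_steps_le _ _ (B (s + C s)) fun b hb => (h3 b hb).1).trans
    (by dsimp only; omega), ?_, ?_⟩
  · simp only [mapT_val, List.length_map]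
    nlinarith
  · intro c hc
    rw [mapT_val] at hc
    obtain ⟨b, hb, rfl⟩ := List.mem_map.1 hc
    exact Sized.mono (Nat.le_add_left _ _) (h3 b hb).2

instance (f : α → β → Timed Bool) (l : α → List β) [hf : PolyT fun p : α × β => f p.1 p.2]
    [hl : PolyF l] : PolyT fun a => filterT (f a) (l a) := by
  obtain ⟨B, hB, hf⟩ := hf
  obtain ⟨C, hC, hl⟩ := hl
  refine ⟨fun s => C s * (B (s + C s) + 1) + 1 + C s, by fun_prop, fun s x hx => ?_⟩
  obtain ⟨h1, h2⟩ := hl s x hx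
  have h3 (b) (hb : b ∈ l x) := hf (s + C s) (x, b)
    ⟨Sized.mono (Nat.le_add_right _ _) hx, Sized.mono (Nat.le_add_left _ _) (h2 b hb)⟩
  have h4 := Nat.mul_le_mul_right (B (s + C s) + 1) h1
  refine ⟨(filterT_steps_le _ _ (B (s + C s)) fun b hb => (h3 b hb).1).trans
    (by dsimp only; omega), ?_, ?_⟩
  · rw [filterT_val]
    exact (List.length_filter_le _ _).trans (h1.trans (Nat.le_add_left _ _))
  · intro c hc
    rw [filterT_val] at hc
    exact Sized.mono (Nat.le_add_left _ _) (h2 c (List.mem_of_mem_filter hc))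

instance (f : α → β → Timed (List γ)) (l : α → List β) [hf : PolyT fun p : α × β => f p.1 p.2]
    [hl : PolyF l] : PolyT fun a => flatMapT (f a) (l a) := by
  obtain ⟨B, hB, hf⟩ := hf
  obtain ⟨C, hC, hl⟩ := hl
  refine ⟨fun s => C s * (B (s + C s) + B (s + C s) + 2) + 1 + B (s + C s), by fun_prop,
    fun s x hx => ?_⟩
  obtain ⟨h1, h2⟩ := hl s x hx
  have h3 (b) (hb : b ∈ l x) := hf (s + C s) (x, b)
    ⟨Sized.mono (Nat.le_add_right _ _) hx, Sized.mono (Nat.le_add_left _ _) (h2 b hb)⟩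
  refine ⟨(flatMapT_steps_le _ _ (B (s + C s)) (B (s + C s)) fun b hb =>
    ⟨(h3 b hb).1, (h3 b hb).2.1⟩).trans ?_, ?_, ?_⟩
  · have h4 := Nat.mul_le_mul_right (B (s + C s) + B (s + C s) + 2) h1
    dsimp only; omega
  · rw [flatMapT_val]
    refine (length_flatMap_le _ _ (B (s + C s)) fun b hb => (h3 b hb).2.1).trans ?_
    have h4 := Nat.mul_le_mul_right (B (s + C s)) h1
    nlinarith
  · intro c hc
    rw [flatMapT_val] at hc
    obtain ⟨b, hb, hc⟩ := List.mem_flatMap.1 hc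
    exact Sized.mono (Nat.le_add_left _ _) ((h3 b hb).2.2 c hc)

instance (l : α → List β) [hl : PolyF l] : PolyT fun a => lengthT (l a) := by
  obtain ⟨B, hB, hl⟩ := hl
  refine ⟨fun s => B s * (B s + 3) + 1, by fun_prop, fun s x hx => ?_⟩
  obtain ⟨h1, -⟩ := hl s x hx
  refine ⟨(lengthT_steps_le _).trans ?_, ?_⟩
  · dsimp only; gcongr
  · rw [lengthT_val]
    change Nat.size _ ≤ _
    refine (nat_size_le_self _).trans (h1.trans ?_)
    nlinarith

instance (i : α → ℕ) (l : α → List β) [hi : PolyF i] [hl : PolyF l] :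
    PolyT fun a => enumT (i a) (l a) := by
  obtain ⟨A, hA, hi⟩ := hi
  obtain ⟨B, hB, hl⟩ := hl
  refine ⟨fun s => B s * (A s + B s + 4) + 1 + (A s + B s), by fun_prop, fun s x hx => ?_⟩
  have h0 : (i x).size ≤ A s := hi s x hx
  obtain ⟨h1, h2⟩ := hl s x hx
  refine ⟨(enumT_steps_le _ _).trans (le_trans ?_ (Nat.le_add_right _ _)), ?_, ?_⟩
  · gcongr
  · rw [enumT_val]
    simp only [List.length_map, List.length_zipIdx]
    omega
  · rintro ⟨k, b⟩ hc
    rw [enumT_val] at hc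
    obtain ⟨⟨b', k'⟩, hc', h⟩ := List.mem_map.1 hc
    cases h
    obtain ⟨h3, h4, h5⟩ := List.mem_zipIdx hc'
    refine ⟨?_, Sized.mono (by dsimp only; omega) (h2 b' (h5 ▸ List.getElem_mem _))⟩
    change Nat.size k' ≤ _
    have h6 := Nat.size_le_size (show k' ≤ i x + (l x).length by omega)
    have h7 := size_add_le_size_add (i x) (l x).length
    dsimp only
    omega

instance (b : α → γ) (l : α → List β) [hb : PolyF b] [hl : PolyF l] :
    PolyT fun a => constT (b a) (l a) := by
  unfold constT
  have h : PolyF fun p : α × β => b p.1 := by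
    obtain ⟨B, hB, hb⟩ := hb
    exact ⟨B, hB, fun s x hx => hb s x.1 hx.1⟩
  infer_instance

theorem PolyF.comp {f : β → γ} {g : α → β} (hf : PolyF f) (hg : PolyF g) :
    PolyF fun a => f (g a) := by
  obtain ⟨B, hB, hf⟩ := hf
  obtain ⟨C, hC, hg⟩ := hg
  exact ⟨fun s => B (C s), by fun_prop, fun s x hx => hf _ _ (hg s x hx)⟩

/-- For each fixed d there is a polynomial, obtained by composing d times; its degree depends on d.
This is where the number of bins has to be a constant. -/
theorem polyT_tuplesT (d : ℕ) : PolyT fun xs : List β => tuplesT xs d := by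
  induction d with
  | zero => unfold tuplesT; infer_instance
  | succ d ih =>
    unfold tuplesT
    have : PolyT fun p : List β × Unit => tuplesT p.1 d := ih.comp inferInstance
    infer_instance

instance (xs : α → List β) (d : ℕ) [hx : PolyF xs] : PolyT fun a => tuplesT (xs a) d :=
  (polyT_tuplesT d).comp hx

/-- Heights are subadditive up to 1 under sums and products, so the accumulator grows by at most b +
1 per iteration. Iterating a general polynomial bound would not stay polynomial. -/
theorem polyT_foldT_accumulate (op : ℚ → ℚ → Timed ℚ)
    (hs : ∀ x y, (op x y).steps = (ratSize x + ratSize y) ^ 2)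
    (hv : ∀ x y, height (op x y).val ≤ height x + height y + 1) (x₀ : ℚ)
    (f : α → β → Timed ℚ) (l : α → List β) [hf : PolyT fun p : α × β => f p.1 p.2]
    [hl : PolyF l] :
    PolyT fun a => foldT (fun s b => do let x ← f a b; op s x) x₀ (l a) := by
  obtain ⟨B, hB, hf⟩ := hf
  obtain ⟨C, hC, hl⟩ := hl
  refine ⟨fun s => C s * (B (s + C s) + (2 * (height x₀ + C s * (B (s + C s) + 1)) +
    2 * B (s + C s) + 2) ^ 2 + 1) + 1 + (height x₀ + C s * (B (s + C s) + 1)), by fun_prop,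
    fun s x hx => ?_⟩
  obtain ⟨h1, h2⟩ := hl s x hx
  have h3 (b) (hb : b ∈ l x) := hf (s + C s) (x, b)
    ⟨Sized.mono (Nat.le_add_right _ _) hx, Sized.mono (Nat.le_add_left _ _) (h2 b hb)⟩
  dsimp only
  generalize B (s + C s) = b at *
  have h4 := foldT_induction (fun s b => do let x ← f x b; op s x)
    (fun i y => height y ≤ height x₀ + i * (b + 1))
    (b + (2 * (height x₀ + C s * (b + 1)) + 2 * b + 2) ^ 2) (l x)
  obtain ⟨h4, h5⟩ := h4 (by
    intro i hi y hy a ha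
    obtain ⟨h6, h7⟩ := h3 a ha
    have h7 : height (f x a).val ≤ b := h7
    have h8 := hv y (f x a).val
    simp only [steps_bind, val_bind, hs]
    refine ⟨Nat.add_le_add h6 (sq_ratSize_le (hy.trans ?_) h7), by
      rw [Nat.succ_mul]; omega⟩
    exact Nat.add_le_add_left (Nat.mul_le_mul_right _ (hi.le.trans h1)) _) x₀ (by simp)
  refine ⟨h4.trans ?_, h5.trans ?_⟩
  · have := Nat.mul_le_mul_right
      (b + (2 * (height x₀ + C s * (b + 1)) + 2 * b + 2) ^ 2 + 1) h1
    omega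
  · have := Nat.mul_le_mul_right (b + 1) h1
    omega

instance (f : α → β → Timed ℚ) (l : α → List β) [hf : PolyT fun p : α × β => f p.1 p.2]
    [hl : PolyF l] : PolyT fun a => sumT (f a) (l a) :=
  polyT_foldT_accumulate addT (fun _ _ => rfl) height_add 0 f l

instance (f : α → β → Timed ℚ) (l : α → List β) [hf : PolyT fun p : α × β => f p.1 p.2]
    [hl : PolyF l] : PolyT fun a => prodT (f a) (l a) :=
  polyT_foldT_accumulate mulT (fun _ _ => rfl)
    (fun x y => (height_mul x y).trans (Nat.le_succ _)) 1 f l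

/-- A fold whose state is kept or replaced by a value of polynomially bounded size. -/
theorem polyT_foldT (f : α → β → γ → Timed β) (b : α → β) (l : α → List γ)
    (hf : PolyT fun p : (α × β) × γ => f p.1.1 p.1.2 p.2) (hb : PolyF b) (hl : PolyF l)
    (h : ∃ D, PB D ∧ ∀ s a x c, bd s a → bd s c → (f a x c).val = x ∨ bd (D s) (f a x c).val) :
    PolyT fun a => foldT (f a) (b a) (l a) := by
  obtain ⟨A, hA, hf⟩ := hf
  obtain ⟨B, hB, hb⟩ := hb
  obtain ⟨C, hC, hl⟩ := hl
  obtain ⟨D, hD, h⟩ := h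
  refine ⟨fun s => C s * (A (s + C s + (B s + D (s + C s))) + 1) + 1 + (B s + D (s + C s)),
    by fun_prop, fun s x hx => ?_⟩
  obtain ⟨h1, h2⟩ := hl s x hx
  have h3 := foldT_induction (f x) (fun _ y => bd (B s + D (s + C s)) y)
    (A (s + C s + (B s + D (s + C s)))) (l x)
  obtain ⟨h3, h4⟩ := h3 (by
    intro i _ y hy c hc
    refine ⟨(hf _ ((x, y), c) ⟨⟨Sized.mono (by omega) hx, Sized.mono (by omega) hy⟩,
      Sized.mono (by omega) (h2 c hc)⟩).1, ?_⟩
    rcases h (s + C s) x y c (Sized.mono (Nat.le_add_right _ _) hx)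
      (Sized.mono (Nat.le_add_left _ _) (h2 c hc)) with h5 | h5
    · rwa [h5]
    · exact Sized.mono (Nat.le_add_left _ _) h5) (b x)
    (Sized.mono (Nat.le_add_right _ _) (hb s x hx))
  refine ⟨h3.trans ?_, Sized.mono (Nat.le_add_left _ _) h4⟩
  have := Nat.mul_le_mul_right (A (s + C s + (B s + D (s + C s))) + 1) h1
  dsimp only; omega

/-- In contrast to the general rule for binds, the continuation is only examined at the value
actually computed. Facts that a size bound forgets remain usable, such as a number being the length
of a list or probabilities being at most 1. -/
theorem polyT_bind_val {f : α → Timed β} {g : α → β → Timed γ} (hf : PolyT f)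
    (hg : PolyT fun a => g a (f a).val) : PolyT fun a => f a >>= g a := by
  obtain ⟨B, hB, hf⟩ := hf
  obtain ⟨C, hC, hg⟩ := hg
  refine ⟨fun s => B s + C s, by fun_prop, fun s x hx => ?_⟩
  exact ⟨Nat.add_le_add (hf s x hx).1 (hg s x hx).1,
    Sized.mono (Nat.le_add_left _ _) (hg s x hx).2⟩

end Lists

/-! ### Step counts of the priced subroutines -/

section Subroutines

variable {α : Type} [Sized α]

instance {β : Type} [Sized β] (f : α → Timed β) [hf : PolyT f] :
    PolyF fun a => (f a).val := hf.val

/-- The pattern for subroutines: instance search follows the code on a tuple of arguments, and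
composition then yields an instance for arguments depending on an arbitrary environment. -/
theorem polyT_inCumT : PolyT fun p : Bin × WithBot ℚ => inCumT p.1 p.2 := by
  unfold inCumT; infer_instance

instance (b : α → Bin) (x : α → WithBot ℚ) [PolyF b] [PolyF x] :
    PolyT fun a => inCumT (b a) (x a) :=
  polyT_inCumT.comp (g := fun a => (b a, x a)) inferInstance

theorem polyT_inBinT : PolyT fun p : Bin × WithBot ℚ => inBinT p.1 p.2 := by
  unfold inBinT; infer_instance

instance (b : α → Bin) (x : α → WithBot ℚ) [PolyF b] [PolyF x] :
    PolyT fun a => inBinT (b a) (x a) :=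
  polyT_inBinT.comp (g := fun a => (b a, x a)) inferInstance

theorem polyT_probCumT : PolyT fun p : Bin × Config => probCumT p.1 p.2 := by
  unfold probCumT; infer_instance

instance (b : α → Bin) (c : α → Config) [PolyF b] [PolyF c] :
    PolyT fun a => probCumT (b a) (c a) :=
  polyT_probCumT.comp (g := fun a => (b a, c a)) inferInstance

theorem polyT_probBinT : PolyT fun p : Bin × Config => probBinT p.1 p.2 := by
  unfold probBinT; infer_instance

instance (b : α → Bin) (c : α → Config) [PolyF b] [PolyF c] :
    PolyT fun a => probBinT (b a) (c a) :=
  polyT_probBinT.comp (g := fun a => (b a, c a)) inferInstance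

theorem polyT_utilBinT : PolyT fun p : Bin × Config => utilBinT p.1 p.2 := by
  unfold utilBinT; infer_instance

instance (b : α → Bin) (c : α → Config) [PolyF b] [PolyF c] :
    PolyT fun a => utilBinT (b a) (c a) :=
  polyT_utilBinT.comp (g := fun a => (b a, c a)) inferInstance

theorem polyT_unitsT : PolyT fun p : ℚ × Config × Bin => unitsT p.1 p.2.1 p.2.2 := by
  unfold unitsT; infer_instance

instance (D : α → ℚ) (c : α → Config) (b : α → Bin) [PolyF D] [PolyF c] [PolyF b] :
    PolyT fun a => unitsT (D a) (c a) (b a) :=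
  polyT_unitsT.comp (g := fun a => (D a, c a, b a)) inferInstance

set_option synthInstance.maxSize 1000 in
theorem polyT_weightedUtilT (M : ℕ) :
    PolyT fun p : Config × Bin => weightedUtilT M p.1 p.2 := by
  unfold weightedUtilT; infer_instance

instance (M : ℕ) (c : α → Config) (b : α → Bin) [PolyF c] [PolyF b] :
    PolyT fun a => weightedUtilT M (c a) (b a) :=
  (polyT_weightedUtilT M).comp (g := fun a => (c a, b a)) inferInstance

theorem polyT_profileT (M : ℕ) :
    PolyT fun p : ℚ × List Bin × Config => profileT M p.1 p.2.1 p.2.2 := by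
  unfold profileT; infer_instance

instance (M : ℕ) (D : α → ℚ) (B : α → List Bin) (c : α → Config) [PolyF D] [PolyF B]
    [PolyF c] : PolyT fun a => profileT M (D a) (B a) (c a) :=
  (polyT_profileT M).comp (g := fun a => (D a, B a, c a)) inferInstance

set_option synthInstance.maxSize 1000 in
theorem polyT_binFeasibleT (M : ℕ) :
    PolyT fun p : ℚ × Bin × ℕ => binFeasibleT M p.1 p.2.1 p.2.2 := by
  unfold binFeasibleT; infer_instance

instance (u : α → WithBot ℚ) (c : α → Config) [PolyF u] [PolyF c] :
    PolyT fun a => probLtT (u a) (c a) :=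
  PolyT.comp (f := fun p : WithBot ℚ × Config => probLtT p.1 p.2)
    (by unfold probLtT; infer_instance) (g := fun a => (u a, c a)) inferInstance

theorem feasibleT_steps_le (M : ℕ) (D : ℚ) (B : List Bin) (v : List ℕ) (c : ℕ)
    (h : ∀ b ∈ B, ∀ k ∈ v, (binFeasibleT M D b k).steps ≤ c) :
    (feasibleT M D B v).steps ≤ B.length * (c + 1) + 1 := by
  induction B generalizing v with
  | nil => simp [feasibleT]
  | cons b B ih =>
    cases v with
    | nil => simp [feasibleT]
    | cons k v =>
      have h1 := h b (by simp) k (by simp)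
      have h2 := ih v fun b hb k hk => h b (by simp [hb]) k (by simp [hk])
      have h3 (x : Bool) (y : Timed Bool) :
          (if x = true then y else pure false).steps ≤ y.steps := by
        cases x <;> simp
      have h4 := h3 (binFeasibleT M D b k).val (feasibleT M D B v)
      simp only [feasibleT, andT, steps_bind, steps_tick, List.length_cons, Nat.succ_mul]
      omega

instance (M : ℕ) (D : α → ℚ) (B : α → List Bin) (v : α → List ℕ) [hD : PolyF D]
    [hB : PolyF B] [hv : PolyF v] : PolyT fun a => feasibleT M (D a) (B a) (v a) := by
  obtain ⟨c, hc, h⟩ := polyT_binFeasibleT M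
  obtain ⟨d, hd, h'⟩ := (inferInstance : PolyF fun a => (D a, B a, v a))
  refine ⟨fun s => d s * (c (d s) + 1) + 1, by fun_prop, fun s x hx => ⟨?_, trivial⟩⟩
  obtain ⟨h1, h2, h3⟩ := h' s x hx
  refine (feasibleT_steps_le M _ _ _ (c (d s)) fun b hb k hk =>
    (h (d s) (D x, b, k) ⟨h1, h2.2 b hb, h3.2 k hk⟩).1).trans ?_
  have := h2.1
  dsimp only at this ⊢
  gcongr

theorem vecAddT_steps_le (v w : List ℕ) (s : ℕ) (hv : bd s v) (hw : bd s w) :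
    (vecAddT v w).steps ≤ v.length * (2 * s + 2) + 1 := by
  replace hv : ∀ a ∈ v, a.size ≤ s := hv.2
  replace hw : ∀ a ∈ w, a.size ≤ s := hw.2
  induction v generalizing w with
  | nil => simp [vecAddT]
  | cons a v ih =>
    cases w with
    | nil => simp [vecAddT]
    | cons b w =>
      have h1 := hv a (by simp)
      have h2 := hw b (by simp)
      have h3 := ih w (fun b hb => hv b (by simp [hb])) fun b hb => hw b (by simp [hb])
      have h4 : (natAddT a b).steps = a.size + b.size + 1 := rfl
      rw [List.length_cons, Nat.add_one_mul v.length]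
      simp only [vecAddT, steps_bind, steps_tick, steps_pure, h4]
      omega

instance (v w : α → List ℕ) [hv : PolyF v] [hw : PolyF w] :
    PolyT fun a => vecAddT (v a) (w a) := by
  obtain ⟨d, hd, h'⟩ := (inferInstance : PolyF fun a => (v a, w a))
  refine ⟨fun s => d s * (2 * d s + 2) + 1 + d s, by fun_prop, fun s x hx => ?_⟩
  obtain ⟨h1, h2⟩ := h' s x hx
  refine ⟨(vecAddT_steps_le _ _ _ h1 h2).trans ?_, ?_, ?_⟩
  · have := Nat.mul_le_mul_right (2 * d s + 2) h1.1
    dsimp only at this ⊢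
    omega
  · rw [vecAddT_val, List.length_zipWith]
    have := h1.1
    dsimp only at this ⊢
    omega
  · intro k hk
    rw [vecAddT_val, ← List.map_uncurry_zip_eq_zipWith] at hk
    obtain ⟨⟨a, b⟩, hab, rfl⟩ := List.mem_map.1 hk
    have h3 : a.size ≤ d s := h1.2 a (List.of_mem_zip hab).1
    have h4 : b.size ≤ d s := h2.2 b (List.of_mem_zip hab).2
    have h5 := size_add_le_max a b
    change (a + b).size ≤ d s * (2 * d s + 2) + 1 + d s
    omega

theorem vecEqT_steps_le (v w : List ℕ) (s : ℕ) (hv : bd s v) (hw : bd s w) :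
    (vecEqT v w).steps ≤ v.length * (2 * s + 2) + 1 := by
  replace hv : ∀ a ∈ v, a.size ≤ s := hv.2
  replace hw : ∀ a ∈ w, a.size ≤ s := hw.2
  induction v generalizing w with
  | nil => cases w <;> simp [vecEqT]
  | cons a v ih =>
    cases w with
    | nil => simp [vecEqT]
    | cons b w =>
      have h1 := hv a (by simp)
      have h2 := hw b (by simp)
      have h3 := ih w (fun b hb => hv b (by simp [hb])) fun b hb => hw b (by simp [hb])
      have h4 : (natEqT a b).steps = a.size + b.size + 1 := rfl
      have h5 (x : Bool) (y : Timed Bool) :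
          (if x = true then y else pure false).steps ≤ y.steps := by
        cases x <;> simp
      have h6 := h5 (natEqT a b).val (vecEqT v w)
      rw [List.length_cons, Nat.add_one_mul v.length]
      simp only [vecEqT, andT, steps_bind, steps_tick, h4]
      omega

instance (v w : α → List ℕ) [hv : PolyF v] [hw : PolyF w] :
    PolyT fun a => vecEqT (v a) (w a) := by
  obtain ⟨d, hd, h'⟩ := (inferInstance : PolyF fun a => (v a, w a))
  refine ⟨fun s => d s * (2 * d s + 2) + 1, by fun_prop, fun s x hx => ⟨?_, trivial⟩⟩
  obtain ⟨h1, h2⟩ := h' s x hx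
  refine (vecEqT_steps_le _ _ _ h1 h2).trans ?_
  have := Nat.mul_le_mul_right (2 * d s + 2) h1.1
  dsimp only at this ⊢
  omega

theorem lookupT_steps_le (k : List ℕ) (T : Table) (c : ℕ)
    (h : ∀ e ∈ T, (vecEqT k e.1).steps ≤ c) :
    (lookupT k T).steps ≤ T.length * (c + 1) + 1 := by
  induction T with
  | nil => simp [lookupT]
  | cons e T ih =>
    have h1 := h e (by simp)
    have h2 := ih fun b hb => h b (by simp [hb])
    have h3 (x : Bool) (y : Timed Entry) :
        (if x = true then pure e.2 else y).steps ≤ y.steps := by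
      cases x <;> simp
    have h4 := h3 (vecEqT k e.1).val (lookupT k T)
    simp only [lookupT, steps_bind, steps_tick, List.length_cons, Nat.succ_mul]
    omega

theorem lookupT_val_mem (k : List ℕ) (T : Table) :
    (lookupT k T).val = none ∨ ∃ e ∈ T, (lookupT k T).val = e.2 := by
  induction T with
  | nil => exact Or.inl rfl
  | cons e T ih =>
    by_cases h : (vecEqT k e.1).val = true
    · exact Or.inr ⟨e, by simp, by simp only [lookupT, val_bind, if_pos h, val_pure]⟩
    · rcases ih with ih | ⟨e', he', ih⟩
      · exact Or.inl (by simpa only [lookupT, val_bind, if_neg h] using ih)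
      · exact Or.inr ⟨e', by simp [he'], by simpa only [lookupT, val_bind, if_neg h] using ih⟩

instance (k : α → List ℕ) (T : α → Table) [hk : PolyF k] [hT : PolyF T] :
    PolyT fun a => lookupT (k a) (T a) := by
  obtain ⟨c, hc, h⟩ :=
    (inferInstance : PolyT fun p : List ℕ × List ℕ => vecEqT p.1 p.2)
  obtain ⟨d, hd, h'⟩ := (inferInstance : PolyF fun a => (k a, T a))
  refine ⟨fun s => d s * (c (d s) + 1) + 1 + d s, by fun_prop, fun s x hx => ?_⟩
  obtain ⟨h1, h2⟩ := h' s x hx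
  refine ⟨(lookupT_steps_le _ _ (c (d s)) fun e he =>
    (h (d s) (k x, e.1) ⟨h1, (h2.2 e he).1⟩).1).trans ?_, ?_⟩
  · have := Nat.mul_le_mul_right (c (d s) + 1) h2.1
    dsimp only at this ⊢
    omega
  · rcases lookupT_val_mem (k x) (T x) with h3 | ⟨e, he, h3⟩
    · rw [h3]; rintro _ ⟨⟩
    · rw [h3]; exact Sized.mono (Nat.le_add_left _ _) (h2.2 e he).2

theorem sortedT_steps_le (l : List (WithBot ℚ)) (s : ℕ) (h : bd s l) :
    (sortedT l).steps ≤ l.length * ((2 * s) ^ 2 + 1) + 1 := by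
  replace h : ∀ u ∈ l, utilSize u ≤ s := h.2
  induction l with
  | nil => simp [sortedT]
  | cons x l ih =>
    cases l with
    | nil => simp [sortedT]
    | cons y l =>
      have h1 := h x (by simp)
      have h2 := h y (by simp)
      have h3 := ih fun b hb => h b (by simp at hb ⊢; tauto)
      have h4 : (notT (utilLtT y x)).steps = (utilSize y + utilSize x) ^ 2 := rfl
      have h5 : (utilSize y + utilSize x) ^ 2 ≤ (2 * s) ^ 2 := Nat.pow_le_pow_left (by omega) 2
      have h6 (b : Bool) (y : Timed Bool) :
          (if b = true then y else pure false).steps ≤ y.steps := by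
        cases b <;> simp
      have h7 := h6 (notT (utilLtT y x)).val (sortedT (y :: l))
      rw [List.length_cons, Nat.succ_mul]
      simp only [sortedT, andT, steps_bind, steps_tick, h4] at h7 ⊢
      omega

instance (l : α → List (WithBot ℚ)) [hl : PolyF l] : PolyT fun a => sortedT (l a) := by
  obtain ⟨d, hd, h⟩ := hl
  refine ⟨fun s => d s * ((2 * d s) ^ 2 + 1) + 1, by fun_prop, fun s x hx => ⟨?_, trivial⟩⟩
  refine (sortedT_steps_le _ _ (h s x hx)).trans ?_
  have := Nat.mul_le_mul_right ((2 * d s) ^ 2 + 1) (h s x hx).1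
  dsimp only at this ⊢
  omega

theorem binsT_bd (l : List (WithBot ℚ)) (j : ℕ) (lo : WithBot ℚ) (s : ℕ) (hl : bd s l)
    (hlo : bd s lo) :
    (binsT j lo l).steps ≤ l.length * (j.size + l.length + 4) + 1 ∧
      (binsT j lo l).val.length = l.length ∧
      ∀ b ∈ (binsT j lo l).val, b.idx.size ≤ j.size + l.length ∧ bd s b.lo ∧ bd s b.hi := by
  replace hl : ∀ u ∈ l, utilSize u ≤ s := hl.2
  induction l generalizing j lo with
  | nil => simp [binsT]
  | cons h l ih =>
    cases l with
    | nil =>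
      refine ⟨by simp [binsT], by simp [binsT], fun b hb => ?_⟩
      obtain rfl : b = ⟨j, lo, h, true⟩ := by simpa [binsT] using hb
      exact ⟨Nat.le_add_right _ _, hlo, hl h (by simp)⟩
    | cons h' l =>
      obtain ⟨h1, h2, h3⟩ := ih (j + 1) h (hl h (by simp))
        fun b hb => hl b (by simp at hb ⊢; tauto)
      have h4 := size_succ_le j
      have h5 : (natAddT j 1).steps = j.size + Nat.size 1 + 1 := rfl
      have h6 : (h :: h' :: l).length = (h' :: l).length + 1 := rfl
      refine ⟨?_, ?_, fun b hb => ?_⟩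
      · simp only [binsT, steps_bind, steps_tick, steps_pure, h5, natAddT_val, Nat.size_one]
        rw [h6]
        nlinarith
      · rw [h6, ← h2]; rfl
      · have hb : b = ⟨j, lo, h, false⟩ ∨ b ∈ (binsT (j + 1) h (h' :: l)).val :=
          List.mem_cons.1 hb
        rcases hb with rfl | hb
        · exact ⟨Nat.le_add_right _ _, hlo, hl h (by simp)⟩
        · obtain ⟨h7, h8⟩ := h3 b hb
          exact ⟨by omega, h8⟩

instance (j : α → ℕ) (lo : α → WithBot ℚ) (l : α → List (WithBot ℚ)) [hj : PolyF j]
    [hlo : PolyF lo] [hl : PolyF l] : PolyT fun a => binsT (j a) (lo a) (l a) := by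
  obtain ⟨d, hd, h⟩ := (inferInstance : PolyF fun a => (j a, lo a, l a))
  refine ⟨fun s => d s * (d s + d s + 4) + 1 + 2 * d s, by fun_prop, fun s x hx => ?_⟩
  obtain ⟨h1, h2, h3⟩ := h s x hx
  obtain ⟨h4, h5, h6⟩ := binsT_bd (l x) (j x) (lo x) _ h3 h2
  have h1 : (j x).size ≤ d s := h1
  have h7 : (l x).length ≤ d s := h3.1
  dsimp only
  refine ⟨(h4.trans ?_).trans (Nat.le_add_right _ _), by omega, fun b hb => ?_⟩
  · gcongr
  · obtain ⟨h8, h9, h10⟩ := h6 b hb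
    refine ⟨h8.trans (by omega), Sized.mono (by omega) h9, Sized.mono (by omega) h10⟩

theorem selectT_bd (F : UC) (C : List ℕ) (s : ℕ) (hF : bd s F) :
    (selectT F C).steps ≤ F.length * (s + 2) + 1 ∧ (selectT F C).val.length ≤ F.length ∧
      ∀ c ∈ (selectT F C).val, bd s c := by
  replace hF : ∀ A ∈ F, bd s A := hF.2
  induction F generalizing C with
  | nil => simp [selectT]
  | cons A F ih =>
    cases C with
    | nil => simp [selectT]
    | cons ℓ C =>
      obtain ⟨h1, h2, h3⟩ := ih C fun b hb => hF b (by simp [hb])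
      have h4 := getT_steps_le A ℓ
      have h5 := (hF A (by simp)).1
      refine ⟨?_, ?_, fun c hc => ?_⟩
      · simp only [selectT, steps_bind, steps_tick, steps_pure, List.length_cons, Nat.succ_mul]
        omega
      · simpa [selectT] using h2
      · have hc : c = (A[ℓ]?).getD [] ∨ c ∈ (selectT F C).val := by
          simpa [selectT] using hc
        rcases hc with rfl | hc
        · rcases h6 : A[ℓ]? with _ | c
          · exact ⟨Nat.zero_le _, by simp⟩
          · exact (hF A (by simp)).2 c (List.mem_of_getElem? h6)
        · exact h3 c hc

instance (F : α → UC) (C : α → List ℕ) [hF : PolyF F] : PolyT fun a => selectT (F a) (C a) := by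
  obtain ⟨d, hd, h⟩ := hF
  refine ⟨fun s => d s * (d s + 2) + 1 + d s, by fun_prop, fun s x hx => ?_⟩
  obtain ⟨h1, h2, h3⟩ := selectT_bd (F x) (C x) _ (h s x hx)
  have h4 : (F x).length ≤ d s := (h s x hx).1
  have h5 := Nat.mul_le_mul_right (d s + 2) h4
  exact ⟨by dsimp only; omega, by dsimp only; omega,
    fun c hc => Sized.mono (by dsimp only; omega) (h3 c hc)⟩

theorem insertT_steps_le (t : Tagged) (l : List Tagged) (c : ℕ)
    (h : ∀ u ∈ l, (leT t.mass.uP u.mass.uP).steps ≤ c) :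
    (insertT t l).steps ≤ l.length * (c + 1) + 1 := by
  induction l with
  | nil => simp [insertT]
  | cons u l ih =>
    have h1 := h u (by simp)
    have h2 := ih fun b hb => h b (by simp [hb])
    have h3 (b : Bool) (x : List Tagged) (y : Timed (List Tagged)) :
        (if b = true then pure x else do let r ← y; return u :: r).steps ≤ y.steps := by
      cases b <;> simp
    have h4 := h3 (leT t.mass.uP u.mass.uP).val (t :: u :: l) (insertT t l)
    simp only [insertT, steps_bind, steps_tick, List.length_cons, Nat.succ_mul]
    omega

theorem sortT_steps_le (l : List Tagged) (c : ℕ)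
    (h : ∀ t ∈ l, ∀ u ∈ l, (leT t.mass.uP u.mass.uP).steps ≤ c) :
    (sortT l).steps ≤ l.length * (l.length * (c + 1) + 2) + 1 := by
  induction l with
  | nil => simp [sortT]
  | cons t l ih =>
    have h1 := ih fun t ht u hu => h t (by simp [ht]) u (by simp [hu])
    have h2 := insertT_steps_le t (sortT l).val c fun u hu =>
      h t (by simp) u (by simp [(sortT_perm l).mem_iff.1 hu])
    rw [(sortT_perm l).length_eq] at h2
    simp only [sortT, steps_bind, steps_tick, List.length_cons]
    nlinarith

instance (l : α → List Tagged) [hl : PolyF l] : PolyT fun a => sortT (l a) := by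
  obtain ⟨c, hc, h⟩ := (inferInstance : PolyT fun p : ℚ × ℚ => leT p.1 p.2)
  obtain ⟨d, hd, h'⟩ := hl
  refine ⟨fun s => d s * (d s * (c (d s) + 1) + 2) + 1 + d s, by fun_prop, fun s x hx => ?_⟩
  obtain ⟨h1, h2⟩ := h' s x hx
  refine ⟨(sortT_steps_le _ (c (d s)) fun t ht u hu => (h (d s) (t.mass.uP, u.mass.uP)
    ⟨(h2 t ht).2.2.2.1, (h2 u hu).2.2.2.1⟩).1).trans (le_trans ?_ (Nat.le_add_right _ _)), ?_⟩
  · gcongr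
  · refine Sized.mono (Nat.le_add_left _ _) ⟨(sortT_perm _).length_eq.trans_le h1, fun t ht => ?_⟩
    exact h2 t ((sortT_perm _).mem_iff.1 ht)

end Subroutines

/-! ### Step counts of the dynamic program and of the evaluation -/

section Program

set_option synthInstance.maxSize 4000
set_option synthInstance.maxHeartbeats 200000

variable {α : Type} [Sized α]

/-- The branching rule for optional values. Steps of the program that match on an entry are restated
with `Option.elim` below in order to fall under it. -/
instance {β γ : Type} [Sized β] [Sized γ] (e : α → Option β) (x : α → Timed γ)
    (f : α → β → Timed γ) [he : PolyF e] [hx : PolyT x] [hf : PolyT fun p : α × β => f p.1 p.2] :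
    PolyT fun a => (e a).elim (x a) (f a) := by
  obtain ⟨A, hA, he⟩ := he
  obtain ⟨B, hB, hx⟩ := hx
  obtain ⟨C, hC, hf⟩ := hf
  refine ⟨fun s => B s + C (s + A s), by fun_prop, fun s a ha => ?_⟩
  rcases h : e a with _ | b
  · obtain ⟨h1, h2⟩ := hx s a ha
    exact ⟨h1.trans (Nat.le_add_right _ _), Sized.mono (Nat.le_add_right _ _) h2⟩
  · obtain ⟨h1, h2⟩ := hf (s + A s) (a, b)
      ⟨Sized.mono (Nat.le_add_right _ _) ha, Sized.mono (Nat.le_add_left _ _) (he s a ha b h)⟩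
    exact ⟨h1.trans (Nat.le_add_left _ _), Sized.mono (Nat.le_add_left _ _) h2⟩

/-- The better one of the candidates `best` and `(w, C)`. -/
def betterT (best : Entry) (w : ℚ) (C : List ℕ) : Timed Entry :=
  best.elim (pure (some (w, C))) fun b => do
    if ← ltT b.1 w then return some (w, C) else return some b

theorem betterT_val (best : Entry) (w : ℚ) (C : List ℕ) :
    (betterT best w C).val = best ∨ (betterT best w C).val = some (w, C) := by
  rcases best with _ | b
  · exact Or.inr rfl
  · by_cases h : b.1 < w
    · exact Or.inr (by simp [betterT, h])
    · exact Or.inl (by simp [betterT, h])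

instance (best : α → Entry) (w : α → ℚ) (C : α → List ℕ) [PolyF best] [PolyF w] [PolyF C] :
    PolyT fun a => betterT (best a) (w a) (C a) :=
  PolyT.comp (f := fun p : Entry × ℚ × List ℕ => betterT p.1 p.2.1 p.2.2)
    (by unfold betterT; infer_instance) (g := fun a => (best a, w a, C a)) inferInstance

/-- One step of the maximization in `entryT`. -/
def entryStepT (T : Table) (k : List ℕ) (best : Entry) (o : ℕ × (ℚ × List ℕ)) : Timed Entry := do
  let k' ← vecAddT k o.2.2
  let e ← lookupT k' T
  e.elim (pure best) fun v => do
    let w ← addT o.2.1 v.1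
    betterT best w (o.1 :: v.2)

theorem entryT_eq (opts : List (ℕ × (ℚ × List ℕ))) (T : Table) (k : List ℕ) :
    entryT opts T k = foldT (entryStepT T k) none opts := by
  unfold entryT
  congr 1
  funext best o
  unfold entryStepT
  congr 1
  funext k'
  congr 1
  funext e
  rcases e with _ | ⟨v, C⟩
  · rfl
  · rcases best with _ | ⟨w, C'⟩ <;> rfl

instance (T : α → Table) (k : α → List ℕ) (best : α → Entry) (o : α → ℕ × (ℚ × List ℕ))
    [PolyF T] [PolyF k] [PolyF best] [PolyF o] :
    PolyT fun a => entryStepT (T a) (k a) (best a) (o a) :=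
  PolyT.comp (f := fun p : Table × List ℕ × Entry × ℕ × ℚ × List ℕ =>
      entryStepT p.1 p.2.1 p.2.2.1 p.2.2.2)
    (by unfold entryStepT; infer_instance) (g := fun a => (T a, k a, best a, o a)) inferInstance

/-- A changed state is a table entry extended by one option. Its size does not depend on the
previous state, so the loop over the options causes no growth. -/
theorem entryStepT_val (T : Table) (k : List ℕ) (best : Entry) (o : ℕ × (ℚ × List ℕ)) :
    (entryStepT T k best o).val = best ∨
      ∃ k' v C, (k', some (v, C)) ∈ T ∧
        (entryStepT T k best o).val = some (o.2.1 + v, o.1 :: C) := by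
  rcases h : (lookupT (vecAddT k o.2.2).val T).val with _ | ⟨v, C⟩
  · left; simp only [entryStepT, val_bind, h, Option.elim, val_pure]
  · have h1 : (entryStepT T k best o).val = (betterT best (o.2.1 + v) (o.1 :: C)).val := by
      simp only [entryStepT, val_bind, h, Option.elim, addT_val]
    rw [h1]
    rcases betterT_val best (o.2.1 + v) (o.1 :: C) with h2 | h2
    · exact Or.inl h2
    · rcases lookupT_val_mem (vecAddT k o.2.2).val T with h3 | ⟨e, he, h3⟩
      · rw [h] at h3; cases h3
      · exact Or.inr ⟨e.1, v, C, by rw [← h, h3]; exact he, h2⟩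

theorem foldl_induction {β γ : Type} (f : β → γ → β) (Inv : β → Prop) (l : List γ)
    (h : ∀ b, Inv b → ∀ c ∈ l, Inv (f b c)) (b : β) (hb : Inv b) : Inv (l.foldl f b) := by
  induction l generalizing b with
  | nil => exact hb
  | cons c l ih =>
    exact ih (fun b hb c hc => h b hb c (by simp [hc])) _ (h b hb c (by simp))

instance (opts : α → List (ℕ × (ℚ × List ℕ))) (T : α → Table) (k : α → List ℕ) [ho : PolyF opts]
    [hT : PolyF T] [hk : PolyF k] : PolyT fun a => entryT (opts a) (T a) (k a) := by
  simp only [entryT_eq]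
  obtain ⟨B, hB, hT'⟩ := hT
  have : PolyF fun p : (α × Entry) × (ℕ × (ℚ × List ℕ)) => T p.1.1 :=
    PolyF.comp (f := T) ⟨B, hB, hT'⟩ inferInstance
  have : PolyF fun p : (α × Entry) × (ℕ × (ℚ × List ℕ)) => k p.1.1 := hk.comp inferInstance
  refine polyT_foldT (fun a => entryStepT (T a) (k a)) (fun _ => none) opts inferInstance
    inferInstance ho ⟨fun s => s + B s + 1, by fun_prop, fun s a b o ha hob => ?_⟩
  rcases entryStepT_val (T a) (k a) b o with h | ⟨k', v, C, h1, h2⟩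
  · exact Or.inl h
  · refine Or.inr ?_
    rw [h2]
    rintro _ ⟨⟩
    obtain ⟨h3, h4⟩ := ((hT' s a ha).2 _ h1).2 _ rfl
    refine ⟨(height_add _ _).trans ?_, ?_, ?_⟩
    · have h5 : height o.2.1 ≤ s := hob.2.1
      have h6 : height v ≤ B s := h3
      dsimp only; omega
    · have h5 : C.length ≤ B s := h4.1
      simp only [List.length_cons]; omega
    · intro ℓ hℓ
      rcases List.mem_cons.1 hℓ with rfl | hℓ
      · exact Sized.mono (by dsimp only; omega) hob.1
      · exact Sized.mono (by dsimp only; omega) (h4.2 ℓ hℓ)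

instance (M : ℕ) (D : α → ℚ) (B : α → List Bin) (box : α → List (List ℕ)) [PolyF D] [PolyF B]
    [PolyF box] : PolyT fun a => baseTableT M (D a) (B a) (box a) :=
  PolyT.comp (f := fun p : ℚ × List Bin × List (List ℕ) => baseTableT M p.1 p.2.1 p.2.2)
    (by unfold baseTableT; infer_instance) (g := fun a => (D a, B a, box a)) inferInstance

/-- The options of an action. -/
def optsT (M : ℕ) (D : ℚ) (B : List Bin) (A : List Config) : Timed (List (ℕ × (ℚ × List ℕ))) := do
  let P ← mapT (profileT M D B) A
  enumT 0 P

instance (M : ℕ) (D : α → ℚ) (B : α → List Bin) (A : α → List Config) [PolyF D] [PolyF B]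
    [PolyF A] : PolyT fun a => optsT M (D a) (B a) (A a) :=
  PolyT.comp (f := fun p : ℚ × List Bin × List Config => optsT M p.1 p.2.1 p.2.2)
    (by unfold optsT; infer_instance) (g := fun a => (D a, B a, A a)) inferInstance

/-- The table of an action, from the one of the next action. -/
def stepTableT (M : ℕ) (D : ℚ) (B : List Bin) (box : List (List ℕ)) (A : List Config) (T : Table) :
    Timed Table := do
  let opts ← optsT M D B A
  mapT (fun k => do let e ← entryT opts T k; return (k, e)) box

instance (M : ℕ) (D : α → ℚ) (B : α → List Bin) (box : α → List (List ℕ)) (A : α → List Config)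
    (T : α → Table) [PolyF D] [PolyF B] [PolyF box] [PolyF A] [PolyF T] :
    PolyT fun a => stepTableT M (D a) (B a) (box a) (A a) (T a) :=
  PolyT.comp (f := fun p : ℚ × List Bin × List (List ℕ) × List Config × Table =>
      stepTableT M p.1 p.2.1 p.2.2.1 p.2.2.2.1 p.2.2.2.2)
    (by unfold stepTableT; infer_instance) (g := fun a => (D a, B a, box a, A a, T a)) inferInstance

theorem tableT_cons_steps (M : ℕ) (D : ℚ) (B : List Bin) (box : List (List ℕ)) (A : List Config)
    (F : UC) : (tableT M D B box (A :: F)).steps = 1 + (tableT M D B box F).steps +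
      (stepTableT M D B box A (tableT M D B box F).val).steps := by
  simp only [tableT, stepTableT, optsT, steps_bind, steps_tick, val_bind]
  omega

theorem tableT_cons_val (M : ℕ) (D : ℚ) (B : List Bin) (box : List (List ℕ)) (A : List Config)
    (F : UC) : (tableT M D B box (A :: F)).val =
      (stepTableT M D B box A (tableT M D B box F).val).val := rfl

/-- The size of a solution for `n` actions whose contributions and indices have at most `s` bits. -/
def EntryBound (s n : ℕ) (e : Entry) : Prop :=
  ∀ w C, e = some (w, C) → height w ≤ n * (s + 1) + 1 ∧ C.length ≤ n ∧ ∀ ℓ ∈ C, ℓ.size ≤ s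

/-- Each action adds one summand of height at most s and one index, so entries grow linearly with
the number of actions instead of by an iterated polynomial. -/
theorem entryBound_entryT (opts : List (ℕ × (ℚ × List ℕ))) (T : Table) (k : List ℕ) (s n : ℕ)
    (ho : bd s opts) (hT : ∀ e ∈ T, EntryBound s n e.2) :
    EntryBound s (n + 1) (entryT opts T k).val := by
  rw [entryT_eq, foldT_val]
  refine foldl_induction _ (EntryBound s (n + 1)) opts (fun b hb o hob => ?_) none
    (by rintro _ _ ⟨⟩)
  rcases entryStepT_val T k b o with h | ⟨k', v, C, h1, h2⟩
  · rwa [h]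
  · rw [h2]
    rintro _ _ ⟨⟩
    obtain ⟨h3, h4, h5⟩ := hT _ h1 v C rfl
    have h6 : height o.2.1 ≤ s := (ho.2 o hob).2.1
    have h7 : o.1.size ≤ s := (ho.2 o hob).1
    have h8 := height_add o.2.1 v
    refine ⟨by rw [Nat.add_one_mul n]; omega, by simpa using h4, fun ℓ hℓ => ?_⟩
    rcases List.mem_cons.1 hℓ with rfl | hℓ
    · exact h7
    · exact h5 ℓ hℓ

theorem entryBound_tableT (M : ℕ) (D : ℚ) (B : List Bin) (box : List (List ℕ)) (F : UC) (s : ℕ)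
    (h : ∀ A ∈ F, bd s (optsT M D B A).val) :
    (tableT M D B box F).val.map Prod.fst = box ∧
      ∀ e ∈ (tableT M D B box F).val, EntryBound s F.length e.2 := by
  induction F with
  | nil =>
    have h0 : (tableT M D B box []).val = box.map fun k =>
        (if (feasibleT M D B k).val = true then (k, some (0, [])) else (k, none)) := by
      simp [tableT, baseTableT]
    rw [h0]
    refine ⟨?_, fun e he => ?_⟩
    · rw [List.map_map]
      conv_rhs => rw [← List.map_id box]
      refine List.map_congr_left fun k _ => ?_
      simp only [Function.comp_apply, id]
      split <;> rfl
    · obtain ⟨k, -, rfl⟩ := List.mem_map.1 he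
      split
      · rintro _ _ ⟨⟩
        exact ⟨by simp [height], by simp, by simp⟩
      · rintro _ _ ⟨⟩
  | cons A F ih =>
    obtain ⟨-, h2⟩ := ih fun b hb => h b (by simp [hb])
    have h0 : (tableT M D B box (A :: F)).val = box.map fun k =>
        (k, (entryT (optsT M D B A).val (tableT M D B box F).val k).val) := by
      rw [tableT_cons_val]
      simp [stepTableT]
    rw [h0]
    refine ⟨by simp [Function.comp_def], fun e he => ?_⟩
    obtain ⟨k, -, rfl⟩ := List.mem_map.1 he
    exact entryBound_entryT _ _ _ _ _ (h A (by simp)) h2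

theorem bd_tableT (M : ℕ) (D : ℚ) (B : List Bin) (box : List (List ℕ)) (F : UC) (s t : ℕ)
    (h : ∀ A ∈ F, bd t (optsT M D B A).val) (hbox : bd s box) (hF : F.length ≤ s) :
    bd (s + t + s * (t + 1) + 1) (tableT M D B box F).val := by
  obtain ⟨h1, h2⟩ := entryBound_tableT M D B box F t h
  have h3 := Nat.mul_le_mul_right (t + 1) hF
  refine ⟨?_, fun e he => ⟨?_, ?_⟩⟩
  · have h4 : (tableT M D B box F).val.length = box.length := by
      conv_rhs => rw [← h1]
      simp
    rw [h4]
    exact hbox.1.trans (by omega)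
  · have h4 : e.1 ∈ (tableT M D B box F).val.map Prod.fst := List.mem_map_of_mem he
    rw [h1] at h4
    exact Sized.mono (by omega) (hbox.2 e.1 h4)
  · rintro ⟨w, C⟩ hw
    obtain ⟨h4, h5, h6⟩ := h2 e he w C hw
    refine ⟨h4.trans (by omega), ?_, fun ℓ hℓ => (h6 ℓ hℓ).trans (by omega)⟩
    dsimp only; omega

theorem polyT_tableT (M : ℕ) :
    PolyT fun p : ℚ × List Bin × List (List ℕ) × UC => tableT M p.1 p.2.1 p.2.2.1 p.2.2.2 := by
  obtain ⟨a, ha, h1⟩ := (inferInstance : PolyT fun p : ℚ × List Bin × List Config =>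
    optsT M p.1 p.2.1 p.2.2)
  obtain ⟨b, hb, h2⟩ := (inferInstance : PolyT fun p : ℚ × List Bin × List (List ℕ) =>
    baseTableT M p.1 p.2.1 p.2.2)
  obtain ⟨c, hc, h3⟩ := (inferInstance : PolyT fun p : ℚ × List Bin × List (List ℕ) ×
    List Config × Table => stepTableT M p.1 p.2.1 p.2.2.1 p.2.2.2.1 p.2.2.2.2)
  refine ⟨fun s => s * (c (s + a s + s * (a s + 1) + 1) + 1) + b s + 1 +
    (s + a s + s * (a s + 1) + 1), by fun_prop, ?_⟩
  rintro s ⟨D, B, box, F⟩ ⟨hD, hB, hbox, hF⟩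
  dsimp only at *
  have h4 (A) (hA : A ∈ F) := (h1 s (D, B, A) ⟨hD, hB, hF.2 A hA⟩).2
  refine ⟨le_trans ?_ (Nat.le_add_right _ _), Sized.mono (Nat.le_add_left _ _)
    (bd_tableT M D B box F s (a s) h4 hbox hF.1)⟩
  -- The size bound from `bd_tableT` is the same for the tables of all levels, so every level has
  -- the same cost bound and the costs add up.
  have h5 : (tableT M D B box F).steps ≤
      F.length * (c (s + a s + s * (a s + 1) + 1) + 1) + b s + 1 := by
    obtain ⟨hF1, hF2⟩ := hF
    induction F with
    | nil =>
      have := (h2 s (D, B, box) ⟨hD, hB, hbox⟩).1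
      simp only [tableT, steps_bind, steps_tick, List.length_nil]
      dsimp only at this
      omega
    | cons A F ih =>
      rw [List.length_cons] at hF1
      have h6 := ih (fun A hA => h4 A (by simp [hA])) (by omega) fun A hA => hF2 A (by simp [hA])
      have h7 := bd_tableT M D B box F s (a s) (fun A hA => h4 A (by simp [hA])) hbox (by omega)
      have h8 := (h3 (s + a s + s * (a s + 1) + 1) (D, B, box, A, (tableT M D B box F).val)
        ⟨Sized.mono (by omega) hD, Sized.mono (by omega) hB, Sized.mono (by omega) hbox,
          Sized.mono (by omega) (hF2 A (by simp)), h7⟩).1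
      rw [tableT_cons_steps, List.length_cons, Nat.add_one_mul F.length]
      dsimp only at h8
      omega
  refine h5.trans ?_
  have := hF.1
  gcongr

instance (M : ℕ) (D : α → ℚ) (B : α → List Bin) (box : α → List (List ℕ)) (F : α → UC) [PolyF D]
    [PolyF B] [PolyF box] [PolyF F] : PolyT fun a => tableT M (D a) (B a) (box a) (F a) :=
  (polyT_tableT M).comp (g := fun a => (D a, B a, box a, F a)) inferInstance

/-- The list has as many entries as the value of h, hence the hypothesis on values; a bound on the
bit length would only give an exponential length. -/
theorem polyT_downToT (h : α → ℕ) (hh : ∃ B, PB B ∧ ∀ s x, bd s x → h x ≤ B s) :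
    PolyT fun a => downToT (h a) := by
  obtain ⟨B, hB, hh⟩ := hh
  refine ⟨fun s => B s * (B s + 3) + 1 + (B s + 1), by fun_prop, fun s x hx => ?_⟩
  have h1 := hh s x hx
  refine ⟨(downToT_steps_le _).trans (le_trans ?_ (Nat.le_add_right _ _)), ?_, fun k hk => ?_⟩
  · gcongr
  · rw [downToT_length]; dsimp only; omega
  · have h2 := mem_downToT.1 hk
    have h3 := nat_size_le_self k
    change k.size ≤ B s * (B s + 3) + 1 + (B s + 1)
    omega

instance {β : Type} [Sized β] (l : α → List β) [PolyF l] : PolyF fun a => (l a).length := by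
  have : PolyF fun a => (lengthT (l a)).val := inferInstance
  simpa using this

/-- The number of actions enters as the length of a list, so M²n² is polynomial as a value. With M
fixed, the box of all vectors of length M is then polynomial too. -/
theorem polyT_solveT (M : ℕ) :
    PolyT fun p : List Bin × UC => solveT M p.2.length p.1 p.2 := by
  unfold solveT
  refine polyT_bind_val inferInstance ?_
  refine polyT_bind_val inferInstance ?_
  refine polyT_bind_val inferInstance ?_
  have h1 : PolyT fun p : List Bin × UC =>
      downToT (natMulT (natMulT (M ^ 2) p.2.length).val p.2.length).val := by
    refine polyT_downToT _ ⟨fun s => M ^ 2 * s * s, by fun_prop, fun s p hp => ?_⟩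
    have := hp.2.1
    simp only [natMulT_val]
    gcongr
  infer_instance

theorem evalT_cons (pre : List Config) (c : Config) (post : List Config) :
    ∃ x : Timed ℚ, x = sumT (fun t => do
      let p ← prodT (probLtT t.uA) pre
      let q ← prodT (probLtT t.uA) post
      let pq ← mulT p q
      let w ← mulT t.pr t.uP
      mulT w pq) c ∧ (evalT pre (c :: post)).steps = 1 + x.steps + (evalT (c :: pre) post).steps +
        (ratSize x.val + ratSize (evalT (c :: pre) post).val) ^ 2 ∧
      (evalT pre (c :: post)).val = x.val + (evalT (c :: pre) post).val := by
  refine ⟨_, rfl, ?_, ?_⟩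
  · simp only [evalT, steps_bind, steps_tick]
    rw [← add_assoc, ← add_assoc]
    rfl
  · simp only [evalT, val_bind, addT_val]

theorem polyT_evalT : PolyT fun C : List Config => evalT [] C := by
  obtain ⟨b, hb, h⟩ := (inferInstance : PolyT fun p : List Config × Config × List Config =>
    sumT (fun t => do
      let x ← prodT (probLtT t.uA) p.1
      let q ← prodT (probLtT t.uA) p.2.2
      let pq ← mulT x q
      let w ← mulT t.pr t.uP
      mulT w pq) p.2.1)
  refine ⟨fun s => s * (b s + (2 * b s + 2 * (s * (b s + 1) + 1) + 2) ^ 2 + 1) + 1 +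
    (s * (b s + 1) + 1), by fun_prop, fun s C hC => ?_⟩
  -- Configurations only move from `post` to `pre`, so every inner sum has an input of size s, and
  -- each level adds at most b s + 1 to the height.
  suffices H : ∀ (post pre : List Config), pre.length + post.length ≤ s → (∀ c ∈ pre, bd s c) →
      (∀ c ∈ post, bd s c) → (evalT pre post).steps ≤
        post.length * (b s + (2 * b s + 2 * (s * (b s + 1) + 1) + 2) ^ 2 + 1) + 1 ∧
      height (evalT pre post).val ≤ post.length * (b s + 1) + 1 by
    obtain ⟨h1, h2⟩ := H C [] (by simpa using hC.1) (by simp) hC.2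
    have h3 := Nat.mul_le_mul_right (b s + (2 * b s + 2 * (s * (b s + 1) + 1) + 2) ^ 2 + 1) hC.1
    have h4 := Nat.mul_le_mul_right (b s + 1) hC.1
    refine ⟨by dsimp only; omega, h2.trans ?_⟩
    dsimp only; omega
  intro post
  induction post with
  | nil =>
    intro pre _ _ _
    simp [evalT, height]
  | cons c post ih =>
    intro pre h1 h2 h3
    rw [List.length_cons] at h1
    obtain ⟨h4, h5⟩ := ih (c :: pre) (by rw [List.length_cons]; omega)
      (by simpa using ⟨h3 c (by simp), h2⟩) fun d hd => h3 d (by simp [hd])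
    obtain ⟨x, hx, h6, h7⟩ := evalT_cons pre c post
    obtain ⟨h8, h9⟩ := h s (pre, c, post) ⟨⟨by dsimp only; omega, h2⟩, h3 c (by simp),
      by dsimp only; omega, fun d hd => h3 d (by simp [hd])⟩
    dsimp only at h8 h9
    rw [← hx] at h8 h9
    have h9 : height x.val ≤ b s := h9
    have h10 := Nat.mul_le_mul_right (b s + 1) (show post.length ≤ s by omega)
    have h11 := sq_ratSize_le h9 (h5.trans (Nat.add_le_add_right h10 1))
    have h12 := height_add x.val (evalT (c :: pre) post).val
    rw [h6, h7, List.length_cons, Nat.add_one_mul post.length, Nat.add_one_mul post.length]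
    exact ⟨by omega, by omega⟩

end Program

/-! ### Step counts of the preprocessing -/

section Preprocessing

set_option synthInstance.maxSize 4000
set_option synthInstance.maxHeartbeats 200000

variable {α : Type} [Sized α]

theorem polyT_allMassesT : PolyT fun p : UC × Unit => allMassesT p.1 := by
  unfold allMassesT; infer_instance

instance (F : α → UC) [hF : PolyF F] : PolyT fun a => allMassesT (F a) :=
  polyT_allMassesT.comp (g := fun a => (F a, ())) inferInstance

/-- The finite agent utilities. -/
def finitePart (u : WithBot ℚ) : Option ℚ := u

theorem height_of_finitePart {u : WithBot ℚ} {x : ℚ} {s : ℕ} (hu : bd s u)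
    (h : finitePart u = some x) : height x ≤ s := by
  have h1 : u = (x : WithBot ℚ) := h
  rw [h1] at hu
  exact (height_le_ratSize x).trans hu

instance (u : α → WithBot ℚ) [hu : PolyF u] : PolyF fun a => finitePart (u a) := by
  obtain ⟨B, hB, hu⟩ := hu
  exact ⟨B, hB, fun s a ha x hx => height_of_finitePart (hu s a ha) hx⟩

/-- One step of the minimization in `gapT`. -/
def gapStepT (s : Tagged) (g : ℚ) (t : Tagged) : Timed ℚ :=
  (finitePart s.mass.uA).elim (pure g) fun x => (finitePart t.mass.uA).elim (pure g) fun y => do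
    if ← ltT x y then
      let d ← subT y x
      if ← ltT d g then return d else return g
    else return g

theorem gapT_eq (L : List Tagged) : gapT L = foldT (fun g s => foldT (gapStepT s) g L) 1 L := by
  unfold gapT
  congr 1
  funext g s
  congr 1
  funext g t
  unfold gapStepT
  rcases s.mass.uA with _ | x
  · rcases t.mass.uA with _ | y <;> rfl
  · rcases t.mass.uA with _ | y <;> rfl

/-- The minimum is kept or replaced by a difference of two input utilities, so its height does not
accumulate over the nested folds. -/
theorem gapStepT_val (s t : Tagged) (g : ℚ) : (gapStepT s g t).val = g ∨
    ∃ x y, finitePart s.mass.uA = some x ∧ finitePart t.mass.uA = some y ∧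
      (gapStepT s g t).val = y - x := by
  unfold gapStepT
  rcases finitePart s.mass.uA with _ | x
  · exact Or.inl rfl
  rcases finitePart t.mass.uA with _ | y
  · exact Or.inl rfl
  by_cases h : x < y
  · by_cases h' : y - x < g
    · exact Or.inr ⟨x, y, rfl, rfl, by simp only [Option.elim, val_bind, ltT_val, h, decide_true,
        if_true, subT_val, h', val_pure]⟩
    · exact Or.inl (by simp only [Option.elim, val_bind, ltT_val, h, decide_true,
        if_true, subT_val, h', decide_false, Bool.false_eq_true, if_false, val_pure])
  · exact Or.inl (by simp only [Option.elim, val_bind, ltT_val, h, decide_false,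
      Bool.false_eq_true, if_false, val_pure])

theorem gapStepT_val_bd {s t : Tagged} (g : ℚ) {k : ℕ} (hs : bd k s) (ht : bd k t) :
    (gapStepT s g t).val = g ∨ bd (2 * k + 1) (gapStepT s g t).val := by
  rcases gapStepT_val s t g with h | ⟨x, y, hx, hy, h⟩
  · exact Or.inl h
  · have h1 := height_of_finitePart hs.2.2.1 hx
    have h2 := height_of_finitePart ht.2.2.1 hy
    have h3 := height_sub y x
    right
    rw [h]
    change height (y - x) ≤ _
    omega

instance (s : α → Tagged) (g : α → ℚ) (t : α → Tagged) [PolyF s] [PolyF g] [PolyF t] :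
    PolyT fun a => gapStepT (s a) (g a) (t a) :=
  PolyT.comp (f := fun p : Tagged × ℚ × Tagged => gapStepT p.1 p.2.1 p.2.2)
    (by unfold gapStepT; infer_instance) (g := fun a => (s a, g a, t a)) inferInstance

theorem foldT_val_or {β γ : Type} (f : β → γ → Timed β) (Q : β → Prop) (l : List γ)
    (h : ∀ b, ∀ c ∈ l, (f b c).val = b ∨ Q (f b c).val) (b : β) :
    (foldT f b l).val = b ∨ Q (foldT f b l).val := by
  rw [foldT_val]
  refine foldl_induction _ (fun x => x = b ∨ Q x) l (fun x hx c hc => ?_) b (Or.inl rfl)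
  rcases h x c hc with h1 | h1
  · rwa [h1]
  · exact Or.inr h1

instance (s : α → Tagged) (g : α → ℚ) (L : α → List Tagged) [hs : PolyF s] [hg : PolyF g]
    [hL : PolyF L] : PolyT fun a => foldT (gapStepT (s a)) (g a) (L a) := by
  refine PolyT.comp (f := fun p : Tagged × ℚ × List Tagged => foldT (gapStepT p.1) p.2.1 p.2.2)
    ?_ (g := fun a => (s a, g a, L a)) inferInstance
  exact polyT_foldT (fun p : Tagged × ℚ × List Tagged => gapStepT p.1) (fun p => p.2.1)
    (fun p => p.2.2) inferInstance inferInstance inferInstance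
    ⟨fun k => 2 * k + 1, by fun_prop, fun k a x c ha hc => gapStepT_val_bd x ha.1 hc⟩

theorem polyT_gapT : PolyT fun L : List Tagged => gapT L := by
  simp only [gapT_eq]
  exact polyT_foldT (fun L g s => foldT (gapStepT s) g L) (fun _ => 1)
    (fun L => L) inferInstance inferInstance inferInstance
    ⟨fun k => 2 * k + 1, by fun_prop, fun k L x c hL hc =>
      foldT_val_or _ (bd (2 * k + 1)) L (fun b t ht => gapStepT_val_bd b hc (hL.2 t ht)) x⟩

instance (L : α → List Tagged) [hL : PolyF L] : PolyT fun a => gapT (L a) :=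
  polyT_gapT.comp hL

theorem polyT_deltaT (M : ℕ) : PolyT fun p : List Tagged × Unit => deltaT M p.1 := by
  unfold deltaT; infer_instance

instance (M : ℕ) (L : α → List Tagged) [hL : PolyF L] : PolyT fun a => deltaT M (L a) :=
  (polyT_deltaT M).comp (g := fun a => (L a, ())) inferInstance

theorem polyT_perturbT : PolyT fun p : ℚ × WithBot ℚ × ℕ => perturbT p.1 p.2.1 p.2.2 := by
  unfold perturbT; infer_instance

/-- The number of whole pieces and the remaining probability of a mass point. -/
def wholesT (M : ℕ) (t : Tagged) : Timed (ℕ × ℚ) := do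
  let x ← mulT t.mass.pr ((M : ℚ) ^ 2)
  let k ← floorT x
  let kq ← castT k
  let whole ← mulT kq (1 / (M : ℚ) ^ 2)
  let rem ← subT t.mass.pr whole
  return (k, rem)

theorem polyT_wholesT (M : ℕ) : PolyT (wholesT M) := by
  unfold wholesT; infer_instance

theorem wholesT_val (M : ℕ) (t : Tagged) : (wholesT M t).val =
    (wholes M t, t.mass.pr - (wholes M t : ℚ) * (1 / (M : ℚ) ^ 2)) := rfl

theorem piecesT_steps_le (M : ℕ) (δ : ℚ) (t : Tagged) (rem : ℚ) (k ℓ c N : ℕ)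
    (h : ∀ m ≤ N, (perturbT δ t.mass.uA m).steps ≤ c) (hN : ℓ + k ≤ N) :
    (piecesT M δ t rem k ℓ).steps ≤ (k + 1) * (c + N + 3) := by
  induction k generalizing ℓ with
  | zero =>
    have h1 := h ℓ (by omega)
    have h2 := nat_size_le_self ℓ
    have h3 : (natAddT ℓ 1).steps = ℓ.size + Nat.size 1 + 1 := rfl
    simp only [piecesT, steps_bind, steps_tick, steps_pure, h3, Nat.size_one]
    omega
  | succ k ih =>
    have h1 := h ℓ (by omega)
    have h2 := nat_size_le_self ℓ
    have h3 : (natAddT ℓ 1).steps = ℓ.size + Nat.size 1 + 1 := rfl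
    have h4 := ih (ℓ + 1) (by omega)
    rw [Nat.add_one_mul (k + 1)]
    simp only [piecesT, steps_bind, steps_tick, steps_pure, h3, Nat.size_one, natAddT_val]
    omega

theorem splitT_cons_steps (M : ℕ) (δ : ℚ) (ℓ : ℕ) (t : Tagged) (l : List Tagged) :
    (splitT M δ ℓ (t :: l)).steps = 1 + (wholesT M t).steps +
      (piecesT M δ t (wholesT M t).val.2 (wholes M t) ℓ).steps +
      (splitT M δ (ℓ + wholes M t + 1) l).steps + (wholes M t + 2) := by
  have h1 : (piecesT M δ t (wholesT M t).val.2 (wholes M t) ℓ).val.1.length = wholes M t + 1 := by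
    rw [piecesT_val]; simp
  have h2 : (piecesT M δ t (wholesT M t).val.2 (wholes M t) ℓ).val.2 = ℓ + wholes M t + 1 := by
    rw [piecesT_val]
  have h3 : (splitT M δ ℓ (t :: l)).steps = 1 + ((wholesT M t).steps +
      ((piecesT M δ t (wholesT M t).val.2 (wholes M t) ℓ).steps +
      ((splitT M δ (piecesT M δ t (wholesT M t).val.2 (wholes M t) ℓ).val.2 l).steps +
      (appendT (piecesT M δ t (wholesT M t).val.2 (wholes M t) ℓ).val.1
        (splitT M δ (piecesT M δ t (wholesT M t).val.2 (wholes M t) ℓ).val.2 l).val).steps))) := by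
    simp only [splitT, wholesT, steps_bind, steps_tick, steps_pure, val_bind, val_pure, add_zero,
      add_assoc]
    rfl
  rw [h3, appendT_steps, h1, h2]
  omega

theorem splitT_steps_le (M : ℕ) (δ : ℚ) (ℓ : ℕ) (l : List Tagged) (c d N : ℕ)
    (h : ∀ t ∈ l, ∀ m ≤ N, (perturbT δ t.mass.uA m).steps ≤ c)
    (h' : ∀ t ∈ l, (wholesT M t).steps ≤ d) (hp : ∀ t ∈ l, t.mass.pr ≤ 1)
    (hN : ℓ + l.length * (M ^ 2 + 1) ≤ N) :
    (splitT M δ ℓ l).steps ≤ l.length * (d + (M ^ 2 + 1) * (c + N + 3) + M ^ 2 + 3) + 1 := by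
  induction l generalizing ℓ with
  | nil => simp [splitT]
  | cons t l ih =>
    have h1 := wholes_le (M := M) (hp t (by simp))
    rw [List.length_cons, Nat.add_one_mul l.length] at hN
    have h2 := ih (ℓ + wholes M t + 1) (fun t ht => h t (by simp [ht]))
      (fun t ht => h' t (by simp [ht])) (fun t ht => hp t (by simp [ht])) (by omega)
    have h3 := piecesT_steps_le M δ t (wholesT M t).val.2 (wholes M t) ℓ c N
      (h t (by simp)) (by omega)
    have h4 := Nat.mul_le_mul_right (c + N + 3) (Nat.add_le_add_right h1 1)
    have h5 := h' t (by simp)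
    rw [splitT_cons_steps, List.length_cons, Nat.add_one_mul l.length]
    omega

theorem length_starts (M ℓ : ℕ) (L : List Tagged) : (starts M ℓ L).length = L.length := by
  rw [← List.length_map (f := Prod.fst), starts_map_fst]

/-- A mass p yields ⌊pM²⌋ + 1 pieces, which can be exponential in the bit length of p; for p ≤ 1 it
is at most M² + 1. The same bound keeps the values of the piece numbers polynomial. -/
theorem polyT_splitT (M : ℕ) (δ : α → ℚ) (L : α → List Tagged) [hδ : PolyF δ] [hL : PolyF L]
    (h : ∀ a, ∀ t ∈ L a, t.mass.pr ≤ 1) : PolyT fun a => splitT M (δ a) 0 (L a) := by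
  obtain ⟨d, hd, hd'⟩ := (inferInstance : PolyF fun a => (δ a, L a))
  obtain ⟨p, hp, hp'⟩ := polyT_perturbT
  obtain ⟨q, hq, hq'⟩ := polyT_wholesT M
  refine ⟨fun s => d s * (q (d s) + (M ^ 2 + 1) * (p (d s + d s * (M ^ 2 + 1)) +
    d s * (M ^ 2 + 1) + 3) + M ^ 2 + 3) + 1 + (d s * (M ^ 2 + 1) + d s +
      p (d s + d s * (M ^ 2 + 1)) + q (d s) + height (1 / (M : ℚ) ^ 2)), by fun_prop,
    fun s a ha => ?_⟩
  obtain ⟨h1, h2⟩ := hd' s a ha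
  dsimp only at h1 h2 ⊢
  have h3 (t) (ht : t ∈ L a) (m) (hm : m ≤ d s * (M ^ 2 + 1)) :=
    hp' (d s + d s * (M ^ 2 + 1)) (δ a, t.mass.uA, m) ⟨Sized.mono (Nat.le_add_right _ _) h1,
      Sized.mono (Nat.le_add_right _ _) (h2.2 t ht).2.2.1,
      (nat_size_le_self m).trans (hm.trans (Nat.le_add_left _ _))⟩
  have h4 (t) (ht : t ∈ L a) := hq' (d s) t (h2.2 t ht)
  have h5 : (L a).length * (M ^ 2 + 1) ≤ d s * (M ^ 2 + 1) := Nat.mul_le_mul_right _ h2.1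
  refine ⟨?_, ?_, fun u hu => ?_⟩
  · refine (splitT_steps_le M (δ a) 0 (L a) (p (d s + d s * (M ^ 2 + 1))) (q (d s))
      (d s * (M ^ 2 + 1)) (fun t ht m hm => (h3 t ht m hm).1) (fun t ht => (h4 t ht).1) (h a)
      (by omega)).trans (le_trans ?_ (Nat.le_add_right _ _))
    have := h2.1
    gcongr
  · rw [splitT_val]
    refine (length_flatMap_le _ _ (M ^ 2 + 1) fun e he => ?_).trans ?_
    · have h6 : e.1 ∈ L a := by
        rw [← starts_map_fst M 0 (L a)]; exact List.mem_map_of_mem he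
      have := wholes_le (M := M) (h a e.1 h6)
      simp only [pieces, List.length_map, List.length_range]
      omega
    · rw [length_starts]
      omega
  · rw [splitT_val] at hu
    obtain ⟨e, he, hu⟩ := List.mem_flatMap.1 hu
    obtain ⟨r, hr, rfl⟩ := List.mem_map.1 hu
    have h6 : e.1 ∈ L a := by
      rw [← starts_map_fst M 0 (L a)]; exact List.mem_map_of_mem he
    have h7 := lt_of_mem_starts (h a) he
    have h8 := List.mem_range.1 hr
    have h9 := (h3 e.1 h6 (e.2 + r) (by omega)).2
    have h10 := (h4 e.1 h6).2.2
    rw [wholesT_val] at h10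
    have h11 := h2.2 e.1 h6
    refine ⟨Sized.mono (by omega) h11.1, Sized.mono (by omega) h11.2.1,
      Sized.mono (by omega) h9, Sized.mono (by omega) h11.2.2.2.1, ?_⟩
    dsimp only
    split
    · change height (1 / (M : ℚ) ^ 2) ≤ _; omega
    · exact Sized.mono (by omega) h10

theorem polyT_regroupT : PolyT fun p : UC × List Tagged => regroupT p.1 p.2 := by
  unfold regroupT; infer_instance

theorem polyT_preprocessT (M : ℕ) (F : α → UC) [hF : PolyF F]
    (h : ∀ a, ∀ A ∈ F a, ∀ c ∈ A, ∀ t ∈ c, t.pr ≤ 1) : PolyT fun a => preprocessT M (F a) := by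
  unfold preprocessT
  refine polyT_bind_val inferInstance ?_
  refine polyT_bind_val inferInstance ?_
  refine polyT_bind_val inferInstance ?_
  have h1 := polyT_splitT M (fun a => (deltaT M (sortT (allMassesT (F a)).val).val).val)
    (fun a => (sortT (allMassesT (F a)).val).val) fun a t ht => by
      rw [(sortT_perm _).mem_iff, allMassesT_val] at ht
      obtain ⟨A, hA, ht⟩ := List.mem_flatMap.1 ht
      obtain ⟨c, hc, ht⟩ := List.mem_flatMap.1 ht
      obtain ⟨t, ht', rfl⟩ := List.mem_map.1 ht
      exact h a A.1 (List.fst_mem_of_mem_zipIdx hA) c.1 (List.fst_mem_of_mem_zipIdx hc) t ht'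
  refine polyT_bind_val h1 ?_
  exact polyT_regroupT.comp (g := fun a => (F a,
    (splitT M (deltaT M (sortT (allMassesT (F a)).val).val).val 0
      (sortT (allMassesT (F a)).val).val).val)) inferInstance

end Preprocessing

/-! ### Step counts of the main loop and of the algorithm -/

section Main

set_option synthInstance.maxSize 4000
set_option synthInstance.maxHeartbeats 200000

variable {α : Type} [Sized α]

instance (M : ℕ) (B : α → List Bin) (F : α → UC) [PolyF B] [PolyF F] :
    PolyT fun a => solveT M (F a).length (B a) (F a) :=
  (polyT_solveT M).comp (g := fun a => (B a, F a)) inferInstance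

instance (C : α → List Config) [hC : PolyF C] : PolyT fun a => evalT [] (C a) :=
  polyT_evalT.comp hC

theorem mainStep_eq (M n : ℕ) (F : UC) (best : Entry) (û : List (WithBot ℚ)) :
    mainStep M n F best û = (do
      let B ← binsT 1 ⊥ û
      let e ← solveT M n B F
      e.elim (pure best) fun v => do
        let sel ← selectT F v.2
        let w ← evalT [] sel
        betterT best w v.2) := by
  unfold mainStep
  congr 1
  funext B
  congr 1
  funext e
  rcases e with _ | ⟨v, C⟩
  · rfl
  · rcases best with _ | ⟨w, C'⟩ <;> rfl

/-- The configuration found for the profile `û`, with its expected principal utility. -/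
def candidateT (M n : ℕ) (F : UC) (û : List (WithBot ℚ)) : Timed Entry := do
  let B ← binsT 1 ⊥ û
  let e ← solveT M n B F
  e.elim (pure none) fun v => do
    let sel ← selectT F v.2
    let w ← evalT [] sel
    return some (w, v.2)

/-- The new candidate does not depend on the stored solution, so the state of the main loop stays of
bounded size over all profiles. -/
theorem mainStep_val (M n : ℕ) (F : UC) (best : Entry) (û : List (WithBot ℚ)) :
    (mainStep M n F best û).val = best ∨
      (mainStep M n F best û).val = (candidateT M n F û).val := by
  rw [mainStep_eq]
  simp only [candidateT, val_bind]
  rcases (solveT M n (binsT 1 ⊥ û).val F).val with _ | v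
  · exact Or.inl rfl
  · exact betterT_val _ _ _

theorem polyT_mainStep (M : ℕ) : PolyT fun p : (UC × Entry) × List (WithBot ℚ) =>
    mainStep M p.1.1.length p.1.1 p.1.2 p.2 := by
  simp only [mainStep_eq]
  infer_instance

theorem polyT_candidateT (M : ℕ) : PolyT fun p : UC × List (WithBot ℚ) =>
    candidateT M p.1.length p.1 p.2 := by
  unfold candidateT
  infer_instance

instance (M : ℕ) (F : α → UC) (prof : α → List (List (WithBot ℚ))) [PolyF F] [PolyF prof] :
    PolyT fun a => foldT (mainStep M (F a).length (F a)) none (prof a) := by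
  refine PolyT.comp (f := fun p : UC × List (List (WithBot ℚ)) =>
    foldT (mainStep M p.1.length p.1) none p.2) ?_ (g := fun a => (F a, prof a)) inferInstance
  obtain ⟨D, hD, h⟩ := polyT_candidateT M
  refine polyT_foldT (fun p : UC × List (List (WithBot ℚ)) => mainStep M p.1.length p.1)
    (fun _ => none) (fun p => p.2) ?_ inferInstance inferInstance
    ⟨D, hD, fun s a x c ha hc => ?_⟩
  · exact (polyT_mainStep M).comp
      (g := fun p : ((UC × List (List (WithBot ℚ))) × Entry) × List (WithBot ℚ) =>
        ((p.1.1.1, p.1.2), p.2)) inferInstance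
  · rcases mainStep_val M a.1.length a.1 x c with h1 | h1
    · exact Or.inl h1
    · right
      rw [h1]
      exact (h s (a.1, c) ⟨ha.1, hc⟩).2

/-- The main loop, after the preprocessing. -/
def mainLoopT (M : ℕ) (F : UC) : Timed (List ℕ) := do
  let n ← lengthT F
  let L ← allMassesT F
  let cand ← mapT (fun t => do return t.mass.uA) L
  let all ← tuplesT cand M
  let prof ← filterT sortedT all
  let best ← foldT (mainStep M n F) none prof
  best.elim (constT 0 F) fun v => pure v.2

theorem configureT_eq_mainLoopT (M : ℕ) (F₀ : UC) :
    configureT M F₀ = preprocessT M F₀ >>= mainLoopT M := by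
  rw [configureT_eq]
  congr 1
  funext F
  unfold mainLoopT
  congr 1; funext n
  congr 1; funext L
  congr 1; funext cand
  congr 1; funext all
  congr 1; funext prof
  congr 1; funext best
  rcases best with _ | ⟨w, C⟩ <;> rfl

theorem polyT_mainLoopT (M : ℕ) : PolyT fun p : UC × Unit => mainLoopT M p.1 := by
  unfold mainLoopT
  refine polyT_bind_val inferInstance ?_
  simp only [lengthT_val]
  infer_instance

theorem polyT_configureT (M : ℕ) (F : α → UC) [hF : PolyF F]
    (h : ∀ a, ∀ A ∈ F a, ∀ c ∈ A, ∀ t ∈ c, t.pr ≤ 1) : PolyT fun a => configureT M (F a) := by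
  simp only [configureT_eq_mainLoopT]
  have h1 := polyT_preprocessT M F h
  exact polyT_bind_val h1 ((polyT_mainLoopT M).comp
    (g := fun a => ((preprocessT M (F a)).val, ())) inferInstance)

instance : Sized Inst where
  bd s I := bd s I.items ∧ bd s I.outside
  mono h h' := ⟨Sized.mono h h'.1, Sized.mono h h'.2⟩
  ex I := by
    obtain ⟨s, hs⟩ := Sized.ex (I.items, I.outside)
    exact ⟨s, hs⟩

instance : Sized {I : Inst // I.Valid} where
  bd s I := bd s I.1
  mono h h' := Sized.mono h h'
  ex I := Sized.ex I.1

instance : PolyF fun I : {I : Inst // I.Valid} => I.1 := ⟨fun s => s, by fun_prop, fun _ _ h => h⟩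

instance (f : α → Inst) [h : PolyF f] : PolyF fun a => (f a).items := by
  obtain ⟨B, hB, h⟩ := h
  exact ⟨B, hB, fun s x hx => (h s x hx).1⟩

instance (f : α → Inst) [h : PolyF f] : PolyF fun a => (f a).outside := by
  obtain ⟨B, hB, h⟩ := h
  exact ⟨B, hB, fun s x hx => (h s x hx).2⟩

instance (o : α → List (ℚ × ℚ)) (u : α → ℚ) [PolyF o] [PolyF u] :
    PolyT fun a => outsideProbT (o a) (u a) :=
  PolyT.comp (f := fun p : List (ℚ × ℚ) × ℚ => outsideProbT p.1 p.2)
    (by unfold outsideProbT; infer_instance) (g := fun a => (o a, u a)) inferInstance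

instance (o : α → List (ℚ × ℚ)) (t : α → Item) [PolyF o] [PolyF t] :
    PolyT fun a => inConfigT (o a) (t a) :=
  PolyT.comp (f := fun p : List (ℚ × ℚ) × Item => inConfigT p.1 p.2)
    (by unfold inConfigT; infer_instance) (g := fun a => (o a, t a)) inferInstance

theorem polyT_reduceT : PolyT reduceT := by
  unfold reduceT; infer_instance

/-- Validity is part of the domain because the splitting is polynomial only for probabilities at
most 1. -/
theorem polyT_ptas (M : ℕ) : PolyT fun I : {I : Inst // I.Valid} => ptas M I.1 := by
  unfold ptas
  have h1 : PolyT fun I : {I : Inst // I.Valid} => reduceT I.1 := polyT_reduceT.comp inferInstance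
  refine polyT_bind_val h1 (polyT_configureT M _ ?_)
  rintro ⟨I, hI⟩ A hA c hc t ht
  rw [reduceT_val] at hA
  obtain ⟨it, hit, rfl⟩ := List.mem_map.1 hA
  rcases List.mem_cons.1 hc with rfl | hc
  · rw [List.mem_singleton.1 ht]
  · rw [List.mem_singleton.1 hc] at ht
    obtain ⟨x, hx, rfl⟩ := List.mem_map.1 ht
    exact (hI.1 it hit).2.le_one hx

/-- Every mass point contributes at least 1 to the encoding length, which therefore bounds the
number of cells as well as every single number. -/
theorem bd_distSize (l : List (ℚ × ℚ)) : bd (distSize l) l := by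
  refine ⟨?_, fun x hx => ?_⟩
  · have h1 := List.length_le_sum_of_one_le (l.map fun x => ratSize x.1 + ratSize x.2 + 1) (by
      intro i hi
      obtain ⟨x, -, rfl⟩ := List.mem_map.1 hi
      omega)
    rw [List.length_map] at h1
    unfold distSize
    omega
  · have h1 := List.single_le_sum (l := l.map fun x => ratSize x.1 + ratSize x.2 + 1)
      (fun _ _ => Nat.zero_le _) _ (List.mem_map_of_mem hx)
    have h2 := height_le_ratSize x.1
    have h3 := height_le_ratSize x.2
    refine ⟨?_, ?_⟩
    · change height x.1 ≤ distSize l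
      unfold distSize; omega
    · change height x.2 ≤ distSize l
      unfold distSize; omega

theorem Inst.bd_size (I : Inst) : bd I.size I := by
  refine ⟨⟨?_, fun x hx => ?_⟩, Sized.mono ?_ (bd_distSize I.outside)⟩
  · have h1 := List.length_le_sum_of_one_le
      (I.items.map fun it => ratSize it.price + distSize it.dist + 1) (by
      intro i hi
      obtain ⟨x, -, rfl⟩ := List.mem_map.1 hi
      omega)
    rw [List.length_map] at h1
    unfold Inst.size
    omega
  · have h1 := List.single_le_sum
      (l := I.items.map fun it => ratSize it.price + distSize it.dist + 1)
      (fun _ _ => Nat.zero_le _) _ (List.mem_map_of_mem hx)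
    have h2 := height_le_ratSize x.price
    refine ⟨?_, Sized.mono ?_ (bd_distSize x.dist)⟩
    · change height x.price ≤ I.size
      unfold Inst.size; omega
    · unfold Inst.size; omega
  · unfold Inst.size; omega

theorem ptas_steps_le (M : ℕ) :
    ∃ P : Polynomial ℕ, ∀ I : Inst, I.Valid → (ptas M I).steps ≤ P.eval I.size := by
  obtain ⟨B, ⟨P, hP⟩, h⟩ := polyT_ptas M
  exact ⟨P, fun I hI => (h I.size ⟨I, hI⟩ I.bd_size).1.trans (hP _)⟩

end Main

end AssortmentOpt

theorem mainTheorem9 :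
    (∃ K : ℝ, ∀ M : ℕ, 1 ≤ M → ∀ I : AssortmentOpt.Inst, I.Valid →
      ∀ S : Finset (Fin I.items.length),
        (1 - K / √(M : ℝ)) * (I.revenue S : ℝ) ≤
          (I.revenue (I.stocked (AssortmentOpt.ptas M I).val) : ℝ)) ∧
    (∀ M : ℕ, 1 ≤ M → ∃ P : Polynomial ℕ, ∀ I : AssortmentOpt.Inst, I.Valid →
      (AssortmentOpt.ptas M I).steps ≤ P.eval I.size) := by
  exact ⟨⟨32, fun M hM I hI S => AssortmentOpt.revenue_ptas_ge M hM I hI S⟩,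
    fun M _ => AssortmentOpt.ptas_steps_le M⟩
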